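/- Let $N\ge 2$, let $\Omega\subset\mathbb{R}^N$ be a bounded domain, $T>0$, $\Omega_T=\Omega\times(0,T)$, $m>\frac{N-2}{N}$ and $q>\max(1,m)$. Let $\mu$ and $\sigma$ be bounded (signed) Radon measures on $\Omega_T$ and $\Omega$ respectively. Consider the problem $$u_t-\Delta(|u|^{m-1}u)+|u|^{q-1}u=\mu\ \text{ in }\Omega_T,\qquad u=0\ \text{ on }\partial\Omega\times(0,T),\qquad u(0)=\sigma\ \text{ in }\Omega. \tag{1}$$ A function $u$ is called a very weak solution of (1) if $u\in L^{\max\{m,1\}}(\Omega_T)$, $|u|^{q-1}u\in L^1(\Omega_T)$, and for every $\varphi\in C_c^{2,1}(\Omega\times[0,T))$ $$-\int_{\Omega_T}u\,\varphi_t\,dx\,dt-\int_{\Omega_T}|u|^{m-1}u\,\Delta\varphi\,dx\,dt+\int_{\Omega_T}|u|^{q-1}u\,\varphi\,dx\,dt=\int_{\Omega_T}\varphi\,d\mu+\int_\Omega\varphi(\cdot,0)\,d\sigma .$$ For exponents $a,b\in(1,\infty)$ and a compact set $K\subset\mathbb{R}^{N+1}$ let $$\mathrm{Cap}_{2,1,a,b}(K)=\inf\Big\{\|\varphi\|_{W^{2,1}_{a,b}(\mathbb{R}^{N+1})}^{a}:\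 \varphi\in\mathcal{S}(\mathbb{R}^{N+1}),\ \varphi\ge 1\text{ in a neighborhood of }K\Big\},$$ where $\mathcal S(\mathbb{R}^{N+1})$ is the Schwartz space of real-valued functions and $$\|\varphi\|_{W^{2,1}_{a,b}(\mathbb{R}^{N+1})}=\|\varphi\|_{L^a}+\|\varphi_t\|_{L^b}+\||\nabla_x\varphi|\|_{L^a}+\sum_{i,j=1}^N\|\varphi_{x_ix_j}\|_{L^a}.$$ The capacity is extended as usual by $\mathrm{Cap}_{2,1,a,b}(O)=\sup\{\mathrm{Cap}_{2,1,a,b}(K):K\subset O\text{ compact}\}$ for $O$ open, and $\mathrm{Cap}_{2,1,a,b}(E)=\inf\{\mathrm{Cap}_{2,1,a,b}(O):O\supset E\text{ open}\}$ for $E$ Borel. A bounded measure $\nu$ is absolutely continuous with respect to the capacity if $|\nu|(E)=0$ for every Borel set $E\subset\mathbb{R}^{N+1}$ of zero capacity (measures on $\Omega_T$ being extended by $0$). If problem (1) has a very weak solution, then $\mu$ and $\sigma\otimes\delta_{\{t=0\}}$ are both absolutely continuous with respect to the capacity $\mathrm{Cap}_{2,1,\frac{q}{q-m},\frac{q}{q-1}}$.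 -/

import Mathlib

open MeasureTheory Set
open scoped ENNReal SchwartzMap

noncomputable section

namespace PorousMedium

/-- The space `ℝ^N` with its Euclidean norm. -/
abbrev Space (N : ℕ) : Type := EuclideanSpace ℝ (Fin N)

/-- The space `ℝ^{N+1}` of points `(x, t)`; its `volume` is Lebesgue measure. -/
abbrev SpaceTime (N : ℕ) : Type := Space N × ℝ

/-- The open cylinder `Ω_T = Ω × (0, T)`. -/
def cylinder {N : ℕ} (Ω : Set (Space N)) (T : ℝ) : Set (SpaceTime N) :=
  Ω ×ˢ Ioo (0 : ℝ) T

/-! ### Signed measures -/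

/-- `ν` lives on `S`. A bounded Radon measure on an open set `S` of a Euclidean space is a finite
signed Borel measure on the ambient space that is concentrated on `S` (extension by zero). -/
def ConcentratedOn {X : Type*} [MeasurableSpace X] (ν : SignedMeasure X) (S : Set X) : Prop :=
  ν.totalVariation Sᶜ = 0

/-- `∫_S f dν = ∫_S f dν⁺ - ∫_S f dν⁻`, with the Jordan decomposition `ν = ν⁺ - ν⁻`. -/
def signedIntegral {X : Type*} [MeasurableSpace X] (ν : SignedMeasure X) (S : Set X)
    (f : X → ℝ) : ℝ :=
  (∫ x in S, f x ∂ν.toJordanDecomposition.posPart) -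
    ∫ x in S, f x ∂ν.toJordanDecomposition.negPart

/-- The measure `σ ⊗ δ_{t = a}` on `ℝ^{N+1}`: the image of `σ` under `x ↦ (x, a)`. -/
def tensorDirac {N : ℕ} (σ : SignedMeasure (Space N)) (a : ℝ) : SignedMeasure (SpaceTime N) :=
  σ.map fun x => (x, a)

/-! ### Test functions and very weak solutions -/

/-- The time derivative `φ_t`, one-sided at `t = 0`. -/
def timeDeriv {N : ℕ} (φ : SpaceTime N → ℝ) (z : SpaceTime N) : ℝ :=
  derivWithin (fun t => φ (z.1, t)) (Ici 0) z.2

/-- The Laplacian in the space variable. -/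
def spaceLaplacian {N : ℕ} (φ : SpaceTime N → ℝ) (z : SpaceTime N) : ℝ :=
  Laplacian.laplacian (fun x => φ (x, z.2)) z.1

/-- `φ ∈ C_c^{2,1}(Ω × [0, T))`: `φ` has compact support in `Ω × [0, T)`, and `φ`, its space
derivatives of order at most two and its time derivative exist and are continuous there.
The values of `φ` outside `Ω × [0, T)` are irrelevant. -/
structure IsTestFunction {N : ℕ} (Ω : Set (Space N)) (T : ℝ) (φ : SpaceTime N → ℝ) : Prop where
  contDiffOn_space : ∀ t ∈ Ico (0 : ℝ) T, ContDiffOn ℝ 2 (fun x => φ (x, t)) Ω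
  differentiable_time : ∀ x ∈ Ω, ∀ t ∈ Ico (0 : ℝ) T,
    DifferentiableWithinAt ℝ (fun t => φ (x, t)) (Ici 0) t
  continuousOn : ContinuousOn φ (Ω ×ˢ Ico (0 : ℝ) T)
  continuousOn_fderiv : ContinuousOn
    (fun z : SpaceTime N => fderiv ℝ (fun x => φ (x, z.2)) z.1) (Ω ×ˢ Ico (0 : ℝ) T)
  continuousOn_fderiv_two : ContinuousOn
    (fun z : SpaceTime N => iteratedFDeriv ℝ 2 (fun x => φ (x, z.2)) z.1) (Ω ×ˢ Ico (0 : ℝ) T)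
  continuousOn_timeDeriv : ContinuousOn (timeDeriv φ) (Ω ×ˢ Ico (0 : ℝ) T)
  compact_support : ∃ K : Set (SpaceTime N), IsCompact K ∧ K ⊆ Ω ×ˢ Ico (0 : ℝ) T ∧
    ∀ z ∈ Ω ×ˢ Ico (0 : ℝ) T, z ∉ K → φ z = 0

/-- The odd power `s ↦ |s|^{a-1} s`. -/
def signedPow (a s : ℝ) : ℝ := |s| ^ (a - 1) * s

/-- `u` is a very weak solution of `u_t - Δ(|u|^{m-1} u) + g(u) = μ` in `Ω_T`, `u = 0` on
`∂Ω × (0, T)`, `u(0) = σ`. -/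
structure IsVeryWeakSolution {N : ℕ} (Ω : Set (Space N)) (T m : ℝ) (g : ℝ → ℝ)
    (μ : SignedMeasure (SpaceTime N)) (σ : SignedMeasure (Space N))
    (u : SpaceTime N → ℝ) : Prop where
  memLp : MemLp u (ENNReal.ofReal (max m 1)) (volume.restrict (cylinder Ω T))
  integrable : IntegrableOn (fun z => g (u z)) (cylinder Ω T)
  equation : ∀ φ : SpaceTime N → ℝ, IsTestFunction Ω T φ →
    -(∫ z in cylinder Ω T, u z * timeDeriv φ z)
      - (∫ z in cylinder Ω T, signedPow m (u z) * spaceLaplacian φ z)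
      + (∫ z in cylinder Ω T, g (u z) * φ z)
    = signedIntegral μ (cylinder Ω T) φ + signedIntegral σ Ω (fun x => φ (x, 0))

/-! ### The parabolic capacity with mixed exponents -/

/-- The partial derivative `∂φ/∂t`. -/
def partialT {N : ℕ} (φ : SpaceTime N → ℝ) (z : SpaceTime N) : ℝ :=
  fderiv ℝ φ z (0, 1)

/-- The partial derivative `∂φ/∂x_i`. -/
def partialX {N : ℕ} (i : Fin N) (φ : SpaceTime N → ℝ) (z : SpaceTime N) : ℝ :=
  fderiv ℝ φ z (EuclideanSpace.single i 1, 0)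

/-- The Euclidean length `|∇φ|` of the gradient in the space variable. -/
def gradNorm {N : ℕ} (φ : SpaceTime N → ℝ) (z : SpaceTime N) : ℝ :=
  Real.sqrt (∑ i : Fin N, partialX i φ z ^ 2)

/-- The norm of `W^{2,1}_{a,b}(ℝ^{N+1})`: the exponent `b` is used for `φ_t` and the exponent `a`
for `φ`, `|∇φ|` and the second derivatives in space. -/
def mixedNorm {N : ℕ} (a b : ℝ) (φ : SpaceTime N → ℝ) : ℝ≥0∞ :=
  eLpNorm φ (ENNReal.ofReal a) volume
    + eLpNorm (partialT φ) (ENNReal.ofReal b) volume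
    + eLpNorm (gradNorm φ) (ENNReal.ofReal a) volume
    + ∑ i : Fin N, ∑ j : Fin N,
        eLpNorm (partialX j (partialX i φ)) (ENNReal.ofReal a) volume

/-- The capacity `Cap_{2,1,a,b}` of a compact set. -/
def capCompact {N : ℕ} (a b : ℝ) (K : Set (SpaceTime N)) : ℝ≥0∞ :=
  ⨅ (φ : 𝓢(SpaceTime N, ℝ)) (_ : ∃ U, IsOpen U ∧ K ⊆ U ∧ ∀ z ∈ U, 1 ≤ φ z),
    mixedNorm a b φ ^ a

/-- The capacity of an open set, from inside by compact sets. -/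
def capOpen {N : ℕ} (a b : ℝ) (O : Set (SpaceTime N)) : ℝ≥0∞ :=
  ⨆ (K : Set (SpaceTime N)) (_ : IsCompact K) (_ : K ⊆ O), capCompact a b K

/-- The capacity `Cap_{2,1,a,b}` of an arbitrary set, from outside by open sets; on compact sets it
agrees with `capCompact`. -/
def cap {N : ℕ} (a b : ℝ) (E : Set (SpaceTime N)) : ℝ≥0∞ :=
  ⨅ (O : Set (SpaceTime N)) (_ : IsOpen O) (_ : E ⊆ O), capOpen a b O

/-- `ν` is absolutely continuous with respect to the set function `C`: the total variation `|ν|`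
vanishes on every Borel set on which `C` vanishes. -/
def AbsContinuous {X : Type*} [MeasurableSpace X] (ν : SignedMeasure X)
    (C : Set X → ℝ≥0∞) : Prop :=
  ∀ E : Set X, MeasurableSet E → C E = 0 → ν.totalVariation E = 0

end PorousMedium

end

/-! Let P = μ⁺ + σ⁺⊗δ₀ and M = μ⁻ + σ⁻⊗δ₀. For a compact K ⊂ Ω×(-∞,T) of zero capacity there are
test functions χ with values in [0,1], equal to 1 on K and supported near K, that make the left-hand
side of the weak formulation as small as desired (`exists_testFunction`). The equation then forces
P(K) = M(K) (`jointData_eq_of_capCompact_eq_zero`). As μ⁺ ⟂ μ⁻ and σ⁺ ⟂ σ⁻, inner regularity turns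
these equalities into the vanishing of all four measures on sets of zero capacity
(`eq_zero_of_jointData_eq`).

Smallness of the left-hand side is Hölder's inequality: u ∈ L^q is paired with χ_t ∈ L^{q/(q-1)},
and |u|^m ∈ L^{q/m} with the second space derivatives of χ in L^{q/(q-m)}. The other terms integrate
fixed L¹ weights against functions bounded by 1 and small in measure.

The real difficulty is the bound χ ≤ 1. The capacity provides φ ≥ 1 near K of small norm but with no
upper bound independent of φ, and composing φ with a smooth step creates a term |∇φ|² that the norm
of φ does not control in L^a. `exists_truncation` deals with this as follows. Let A_j be averaging
in x at scale 2^{-j} and f = 4φ. A mollification f_J of f is a telescoping sum of terms A_j p_j,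
where p_j is a difference of averages of f (p_0 is an average). By Taylor's formula A_j|p_j| ≤
4^{-j} Y, where Y is a multiple of MM|D²f| + MM|f| and M is the maximal function in x. Let h_j be a
smooth variant of A_j|p_j|. The truncation is a smooth step τ applied to a soft maximum of 0, h_0,
…, h_J and f_J.

Where some h_j exceeds 3, the soft maximum exceeds 1 and τ is flat there. Elsewhere A_j|p_j| ≤
min(4, 4^{-j}Y), so |∇f_J| is at most a multiple of Σ 2^j min(4, 4^{-j}Y), hence of √Y, and the
dangerous square is bounded by Y. The h_j do no harm: h_j enters only where it exceeds 1, which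
forces 4^j ≤ Y, and its derivatives of order one and two are at most C 2^j and C 4^j where h_j ≤ 3,
because the averaging kernel dominates its own derivatives. Geometric growth keeps all constants
independent of J.

First derivatives of a soft maximum are convex combinations, and averaging in x commutes with ∂_t,
so the time derivative of the truncation is bounded by a multiple of MM|∂_t f|. Since M acts only in
x and is bounded on L^p of space-time for every p > 1, the two exponents of the capacity never
interact. -/

noncomputable section

namespace PorousMedium

/-! ### The maximal function in the space variable -/

section Maximal

variable {N : ℕ}

/-- The mean of `F` over the ball of radius `r` about `x`. -/
def ballMean (r : ℝ) (F : Space N → ℝ≥0∞) (x : Space N) : ℝ≥0∞ :=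
  (volume (Metric.ball (0 : Space N) 1))⁻¹ * ∫⁻ y in Metric.ball (0 : Space N) 1, F (x + r • y)

/-- The Hardy–Littlewood maximal function over dyadic radii. -/
def maximalFn (F : Space N → ℝ≥0∞) (x : Space N) : ℝ≥0∞ :=
  ⨆ i : ℤ, ballMean ((2 : ℝ) ^ i) F x

lemma unitBall_ne_zero : volume (Metric.ball (0 : Space N) 1) ≠ 0 :=
  (Metric.measure_ball_pos _ _ one_pos).ne'

lemma unitBall_ne_top : volume (Metric.ball (0 : Space N) 1) ≠ ∞ :=
  measure_ball_lt_top.ne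

lemma lintegral_comp_add_smul {r : ℝ} (hr : 0 < r) {F : Space N → ℝ≥0∞} (hF : Measurable F)
    (x : Space N) :
    ∫⁻ y, F (x + r • y) = ENNReal.ofReal ((r ^ N)⁻¹) * ∫⁻ y, F y := by
  have h1 : ∫⁻ y, F (x + r • y) = ∫⁻ y, F (x + y) ∂(Measure.map (r • ·) volume) :=
    (lintegral_map (hF.comp (measurable_const_add x)) (measurable_const_smul r)).symm
  have hd : Module.finrank ℝ (Space N) = N := by simp
  rw [h1, Measure.map_addHaar_smul _ hr.ne', lintegral_smul_measure, hd,
    lintegral_add_left_eq_self F x, abs_of_pos (by positivity), smul_eq_mul]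

lemma volume_ball_eq {r : ℝ} (hr : 0 < r) (x : Space N) :
    volume (Metric.ball x r) = ENNReal.ofReal (r ^ N) * volume (Metric.ball (0 : Space N) 1) := by
  have := Measure.addHaar_ball_of_pos (volume : Measure (Space N)) x hr
  simpa using this

lemma setLIntegral_ball {r : ℝ} (hr : 0 < r) {F : Space N → ℝ≥0∞} (hF : Measurable F)
    (x : Space N) :
    ∫⁻ y in Metric.ball x r, F y = volume (Metric.ball x r) * ballMean r F x := by
  have h := lintegral_comp_add_smul hr (hF.indicator (measurableSet_ball (x := x) (ε := r))) x
  have h2 : ∀ y, (Metric.ball x r).indicator F (x + r • y)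
      = (Metric.ball (0 : Space N) 1).indicator (fun y => F (x + r • y)) y := by
    intro y
    have : x + r • y ∈ Metric.ball x r ↔ y ∈ Metric.ball (0 : Space N) 1 := by
      simp only [Metric.mem_ball, dist_self_add_left, dist_zero_right, norm_smul,
        Real.norm_of_nonneg hr.le]
      rw [mul_lt_iff_lt_one_right hr]
    by_cases hy : y ∈ Metric.ball (0 : Space N) 1
    · rw [indicator_of_mem hy, indicator_of_mem (this.2 hy)]
    · rw [indicator_of_notMem hy, indicator_of_notMem (fun h => hy (this.1 h))]
  simp only [h2] at h
  rw [lintegral_indicator measurableSet_ball, lintegral_indicator measurableSet_ball] at h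
  rw [ballMean, h, volume_ball_eq hr, mul_assoc, ← mul_assoc (volume _) _ _,
    ENNReal.mul_inv_cancel unitBall_ne_zero unitBall_ne_top, one_mul, ← mul_assoc,
    ← ENNReal.ofReal_mul (by positivity), mul_inv_cancel₀ (by positivity)]
  simp

/-- Vitali's covering argument. It needs bounded radii, hence the cap `n`; the bound does not depend
on `n`, so the cap is removed by monotone convergence of sets. -/
lemma volume_exists_ballMean_gt_le {F : Space N → ℝ≥0∞} (hF : Measurable F) (n : ℤ)
    {t : ℝ≥0∞} (ht : t ≠ 0) (ht' : t ≠ ∞) :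
    volume {x | ∃ i ≤ n, t < ballMean ((2 : ℝ) ^ i) F x} ≤ 5 ^ N * (t⁻¹ * ∫⁻ y, F y) := by
  set S := {x : Space N | ∃ i ≤ n, t < ballMean ((2 : ℝ) ^ i) F x}
  have hS : ∀ x : Space N, ∃ r : ℝ, 0 < r ∧ r ≤ (2 : ℝ) ^ n ∧ (x ∈ S → t < ballMean r F x) := by
    intro x
    by_cases hx : x ∈ S
    · obtain ⟨i, hi, h⟩ := hx
      exact ⟨2 ^ i, by positivity, zpow_le_zpow_right₀ (by norm_num) hi, fun _ => h⟩
    · exact ⟨2 ^ n, by positivity, le_rfl, fun h => (hx h).elim⟩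
  choose r hr0 hrn hr using hS
  obtain ⟨u, huS, hdisj, hcov⟩ := Vitali.exists_disjoint_subfamily_covering_enlargement_ball S
    (fun x => x) r _ (fun a _ => hrn a) 5 (by norm_num)
  have huc : u.Countable := hdisj.countable_of_isOpen (fun _ _ => Metric.isOpen_ball)
    (fun a _ => ⟨a, Metric.mem_ball_self (hr0 a)⟩)
  have hsub : S ⊆ ⋃ b ∈ u, Metric.ball b (5 * r b) := by
    intro x hx
    obtain ⟨b, hb, h⟩ := hcov x hx
    exact mem_biUnion hb (h (Metric.mem_ball_self (hr0 x)))
  have hball : ∀ b ∈ u, volume (Metric.ball b (5 * r b))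
      ≤ 5 ^ N * (t⁻¹ * ∫⁻ y in Metric.ball b (r b), F y) := by
    intro b hb
    have h1 : volume (Metric.ball b (5 * r b)) = 5 ^ N * volume (Metric.ball b (r b)) := by
      rw [volume_ball_eq (by have := hr0 b; positivity), volume_ball_eq (hr0 b), mul_pow,
        ENNReal.ofReal_mul (by positivity), mul_assoc, ENNReal.ofReal_pow (by norm_num)]
      simp
    rw [h1]
    gcongr
    rw [setLIntegral_ball (hr0 b) hF]
    calc volume (Metric.ball b (r b)) = t⁻¹ * (volume (Metric.ball b (r b)) * t) := by
          rw [mul_comm (volume _), ← mul_assoc, ENNReal.inv_mul_cancel ht ht', one_mul]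
      _ ≤ _ := by gcongr; exact (hr b (huS hb)).le
  have := huc.to_subtype
  calc volume S ≤ volume (⋃ b ∈ u, Metric.ball b (5 * r b)) := measure_mono hsub
    _ ≤ ∑' b : u, volume (Metric.ball (b : Space N) (5 * r b)) := measure_biUnion_le _ huc _
    _ ≤ ∑' b : u, 5 ^ N * (t⁻¹ * ∫⁻ y in Metric.ball (b : Space N) (r b), F y) :=
        ENNReal.tsum_le_tsum fun b => hball b b.2
    _ = 5 ^ N * (t⁻¹ * ∫⁻ y in ⋃ b ∈ u, Metric.ball b (r b), F y) := by
        rw [ENNReal.tsum_mul_left, ENNReal.tsum_mul_left,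
          lintegral_biUnion huc (fun _ _ => measurableSet_ball) hdisj]
    _ ≤ _ := by gcongr; exact Measure.restrict_le_self

lemma volume_maximalFn_gt_le {F : Space N → ℝ≥0∞} (hF : Measurable F)
    {t : ℝ≥0∞} (ht : t ≠ 0) (ht' : t ≠ ∞) :
    volume {x | t < maximalFn F x} ≤ 5 ^ N * (t⁻¹ * ∫⁻ y, F y) := by
  have h : {x | t < maximalFn F x}
      = ⋃ n : ℕ, {x | ∃ i ≤ (n : ℤ), t < ballMean ((2 : ℝ) ^ i) F x} := by
    ext x
    simp only [maximalFn, lt_iSup_iff, mem_ofPred_eq, mem_iUnion]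
    constructor
    · rintro ⟨i, hi⟩
      exact ⟨i.toNat, i, Int.self_le_toNat i, hi⟩
    · rintro ⟨n, i, -, hi⟩
      exact ⟨i, hi⟩
  rw [h]
  have hm : Monotone fun n : ℕ => {x : Space N | ∃ i ≤ (n : ℤ), t < ballMean ((2 : ℝ) ^ i) F x} := by
    rintro a b hab x ⟨i, hi, hx⟩
    exact ⟨i, hi.trans (by exact_mod_cast hab), hx⟩
  rw [hm.measure_iUnion]
  exact iSup_le fun n => volume_exists_ballMean_gt_le hF n ht ht'

lemma measurable_ballMean {r : ℝ} {F : Space N → ℝ≥0∞} (hF : Measurable F) :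
    Measurable (ballMean r F) := by
  unfold ballMean
  apply Measurable.const_mul
  exact Measurable.lintegral_prod_right' (f := fun p : Space N × Space N => F (p.1 + r • p.2))
    (by fun_prop)

lemma measurable_maximalFn {F : Space N → ℝ≥0∞} (hF : Measurable F) :
    Measurable (maximalFn F) :=
  Measurable.iSup fun _ => measurable_ballMean hF

lemma ballMean_mono {r : ℝ} {F G : Space N → ℝ≥0∞} (h : ∀ x, F x ≤ G x) (x : Space N) :
    ballMean r F x ≤ ballMean r G x := by
  unfold ballMean
  gcongr
  exact h _

lemma ballMean_const {r : ℝ} (c : ℝ≥0∞) (x : Space N) : ballMean r (fun _ => c) x = c := by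
  simp only [ballMean, lintegral_const, Measure.restrict_apply_univ]
  rw [mul_comm, mul_assoc, ENNReal.mul_inv_cancel unitBall_ne_zero unitBall_ne_top, mul_one]

lemma ballMean_add {r : ℝ} {F : Space N → ℝ≥0∞} (hF : Measurable F) (G : Space N → ℝ≥0∞)
    (x : Space N) : ballMean r (fun y => F y + G y) x = ballMean r F x + ballMean r G x := by
  unfold ballMean
  rw [lintegral_add_left (by fun_prop), mul_add]

/-- The part of `F` below height t/2 adds at most t/2 to any mean, so the weak bound is applied at
level t/2 to the part above. This is the form needed for interpolation. -/
lemma volume_maximalFn_gt_le_indicator {F : Space N → ℝ≥0∞} (hF : Measurable F)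
    {t : ℝ≥0∞} (ht : t ≠ 0) (ht' : t ≠ ∞) :
    volume {x | t < maximalFn F x}
      ≤ 2 * 5 ^ N * (t⁻¹ * ∫⁻ y in {y | t < 2 * F y}, F y) := by
  have hA : MeasurableSet {y | t < 2 * F y} :=
    measurableSet_lt measurable_const (hF.const_mul 2)
  set F₁ := ({y | t < 2 * F y}).indicator F
  have hF₁ : Measurable F₁ := hF.indicator hA
  have hsplit : ∀ y, F y ≤ F₁ y + t / 2 := by
    intro y
    by_cases hy : t < 2 * F y
    · exact le_add_right (by simp [F₁, hy])
    · refine le_add_left ?_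
      rw [ENNReal.le_div_iff_mul_le (by simp) (by simp), mul_comm]
      exact not_lt.1 hy
  have hsub : {x | t < maximalFn F x} ⊆ {x | t / 2 < maximalFn F₁ x} := by
    intro x hx
    obtain ⟨i, hi⟩ := lt_iSup_iff.1 (show t < ⨆ i : ℤ, ballMean ((2 : ℝ) ^ i) F x from hx)
    have h1 : t < ballMean ((2 : ℝ) ^ i) F₁ x + t / 2 := by
      refine hi.trans_le ((ballMean_mono hsplit x).trans ?_)
      rw [ballMean_add hF₁, ballMean_const]
    refine lt_of_lt_of_le ?_ (le_iSup (fun i : ℤ => ballMean ((2 : ℝ) ^ i) F₁ x) i)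
    by_contra hc
    have := h1.trans_le (add_le_add_left (not_lt.1 hc) (t / 2))
    rw [ENNReal.add_halves] at this
    exact this.false
  refine (measure_mono hsub).trans ((volume_maximalFn_gt_le hF₁ ?_ ?_).trans_eq ?_)
  · exact (ENNReal.half_pos ht).ne'
  · exact (ENNReal.half_lt_self ht ht').ne_top
  · rw [lintegral_indicator hA, ENNReal.div_eq_inv_mul,
      ENNReal.mul_inv (by simp) (by simp), inv_inv]
    ring

/-- Layer cake formula for a single extended nonnegative real. -/
lemma rpow_eq_lintegral_layer (g : ℝ≥0∞) {p : ℝ} (hp : 0 < p) :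
    g ^ p = ENNReal.ofReal p * ∫⁻ t in Ioi (0 : ℝ),
      (if ENNReal.ofReal t < g then 1 else 0) * ENNReal.ofReal (t ^ (p - 1)) := by
  have hfin : ∀ x : ℝ, 0 ≤ x → ENNReal.ofReal x ^ p = ENNReal.ofReal p * ∫⁻ t in Ioi (0 : ℝ),
      (if ENNReal.ofReal t < ENNReal.ofReal x then 1 else 0) * ENNReal.ofReal (t ^ (p - 1)) := by
    intro x hx
    -- The formula for one number is the layer cake formula for a constant on a one-point
    -- probability space.
    have h := lintegral_rpow_eq_lintegral_meas_lt_mul (Measure.dirac ()) (f := fun _ : Unit => x)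
      (Filter.Eventually.of_forall fun _ => hx) aemeasurable_const hp
    simp only [lintegral_dirac] at h
    rw [ENNReal.ofReal_rpow_of_nonneg hx hp.le, h]
    congr 1
    refine setLIntegral_congr_fun measurableSet_Ioi fun t ht => ?_
    have ht : (0 : ℝ) < t := ht
    by_cases htx : t < x
    · simp [htx, ENNReal.ofReal_lt_ofReal_iff (ht.trans htx)]
    · have : ¬ ENNReal.ofReal t < ENNReal.ofReal x :=
        not_lt.2 (ENNReal.ofReal_le_ofReal (not_lt.1 htx))
      simp [htx, this]
  by_cases hg : g = ∞
  · subst hg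
    rw [ENNReal.top_rpow_of_pos hp]
    symm
    -- For the value ∞, compare with the finite value r^{1/p}, whose layer integral is already known
    -- to be r.
    refine ENNReal.eq_top_of_forall_nnreal_le fun r => ?_
    have h := hfin ((r : ℝ) ^ p⁻¹) (by positivity)
    have h2 : ENNReal.ofReal ((r : ℝ) ^ p⁻¹) ^ p = r := by
      rw [ENNReal.ofReal_rpow_of_nonneg (by positivity) hp.le, ← Real.rpow_mul (NNReal.coe_nonneg r),
        inv_mul_cancel₀ hp.ne', Real.rpow_one]
      simp
    rw [← h2, h]
    gcongr with t
    split_ifs <;> simp_all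
  · have := hfin g.toReal ENNReal.toReal_nonneg
    rwa [ENNReal.ofReal_toReal hg] at this

/-- A weak type estimate on truncations implies a strong type estimate. -/
lemma lintegral_rpow_le_of_weak {X : Type*} [MeasurableSpace X] {ν : Measure X} [SFinite ν]
    {F G : X → ℝ≥0∞} (hF : Measurable F) (hG : Measurable G) {c : ℝ≥0∞}
    (h : ∀ t : ℝ≥0∞, t ≠ 0 → t ≠ ∞ →
      ν {x | t < G x} ≤ c * (t⁻¹ * ∫⁻ y in {y | t < 2 * F y}, F y ∂ν)) {p : ℝ} (hp : 1 < p) :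
    ∫⁻ x, G x ^ p ∂ν
      ≤ ENNReal.ofReal p * c * (ENNReal.ofReal (p - 1))⁻¹ * 2 ^ (p - 1) * ∫⁻ x, F x ^ p ∂ν := by
  have hp0 : 0 < p := by linarith
  have hp1 : 0 < p - 1 := by linarith
  have hmeas : ∀ H : X → ℝ≥0∞, Measurable H → ∀ s : ℝ, Measurable fun z : X × ℝ =>
      (if ENNReal.ofReal z.2 < H z.1 then (1 : ℝ≥0∞) else 0) * ENNReal.ofReal (z.2 ^ s) := by
    intro H hH s
    refine Measurable.mul (Measurable.ite ?_ measurable_const measurable_const) (by fun_prop)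
    exact measurableSet_lt (by fun_prop) (by fun_prop)
  have h2F : Measurable fun x => 2 * F x := hF.const_mul 2
  calc ∫⁻ x, G x ^ p ∂ν
      = ENNReal.ofReal p * ∫⁻ t in Ioi (0 : ℝ), ∫⁻ x,
          (if ENNReal.ofReal t < G x then 1 else 0) * ENNReal.ofReal (t ^ (p - 1)) ∂ν := by
        simp_rw [fun x => rpow_eq_lintegral_layer (G x) hp0]
        rw [lintegral_const_mul _ ((hmeas G hG _).lintegral_prod_right'),
          lintegral_lintegral_swap (hmeas G hG _).aemeasurable]
    _ ≤ ENNReal.ofReal p * ∫⁻ t in Ioi (0 : ℝ), ∫⁻ x, c * (F x *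
          ((if ENNReal.ofReal t < 2 * F x then 1 else 0) * ENNReal.ofReal (t ^ (p - 1 - 1)))) ∂ν := by
        gcongr ENNReal.ofReal p * ?_
        refine setLIntegral_mono' measurableSet_Ioi fun t ht => ?_
        have ht : (0 : ℝ) < t := ht
        have ht0 : ENNReal.ofReal t ≠ 0 := by simpa using ht
        have e1 : ∫⁻ x, (if ENNReal.ofReal t < G x then 1 else 0) * ENNReal.ofReal (t ^ (p - 1)) ∂ν
            = ν {x | ENNReal.ofReal t < G x} * ENNReal.ofReal (t ^ (p - 1)) := by
          rw [lintegral_mul_const' _ _ ENNReal.ofReal_ne_top]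
          congr 1
          rw [← lintegral_indicator_one (measurableSet_lt measurable_const hG)]
          refine lintegral_congr fun x => ?_
          simp [indicator_apply]
        have e2 : ∫⁻ x, c * (F x * ((if ENNReal.ofReal t < 2 * F x then 1 else 0)
              * ENNReal.ofReal (t ^ (p - 1 - 1)))) ∂ν
            = c * ((∫⁻ y in {y | ENNReal.ofReal t < 2 * F y}, F y ∂ν)
                * ENNReal.ofReal (t ^ (p - 1 - 1))) := by
          have hm : Measurable fun x => F x * (if ENNReal.ofReal t < 2 * F x then (1 : ℝ≥0∞) else 0) :=
            hF.mul (Measurable.ite (measurableSet_lt measurable_const h2F)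
              measurable_const measurable_const)
          simp_rw [← mul_assoc (F _)]
          rw [lintegral_const_mul _ (hm.mul_const _), lintegral_mul_const _ hm,
            ← lintegral_indicator (measurableSet_lt measurable_const h2F)]
          congr 2
          refine lintegral_congr fun x => ?_
          simp [indicator_apply]
        rw [e1, e2]
        calc _ ≤ c * ((ENNReal.ofReal t)⁻¹ * ∫⁻ y in {y | ENNReal.ofReal t < 2 * F y}, F y ∂ν)
              * ENNReal.ofReal (t ^ (p - 1)) := by
              gcongr
              exact h _ ht0 ENNReal.ofReal_ne_top
          _ = _ := by
              have : ENNReal.ofReal (t ^ (p - 1 - 1))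
                  = (ENNReal.ofReal t)⁻¹ * ENNReal.ofReal (t ^ (p - 1)) := by
                rw [← ENNReal.ofReal_inv_of_pos ht, ← ENNReal.ofReal_mul (by positivity),
                  Real.rpow_sub_one ht.ne', div_eq_inv_mul]
              rw [this]; ring
    -- After Tonelli the inner integral over t is the layer formula for the power p - 1 of 2F.
    _ = ENNReal.ofReal p * ∫⁻ x, c * (F x * ((ENNReal.ofReal (p - 1))⁻¹ * (2 * F x) ^ (p - 1))) ∂ν := by
        congr 1
        rw [← lintegral_lintegral_swap]
        · refine lintegral_congr fun x => ?_
          rw [rpow_eq_lintegral_layer (2 * F x) hp1, ← mul_assoc (ENNReal.ofReal (p-1))⁻¹,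
            ENNReal.inv_mul_cancel (by simpa using hp1) ENNReal.ofReal_ne_top, one_mul,
            lintegral_const_mul, lintegral_const_mul]
          · exact (hmeas _ h2F _).comp measurable_prodMk_left
          · exact ((hmeas _ h2F _).comp measurable_prodMk_left).const_mul _
        · refine Measurable.aemeasurable ?_
          exact ((hF.comp measurable_fst).mul (hmeas _ h2F _)).const_mul _
    _ = _ := by
        rw [← lintegral_const_mul _ (by fun_prop), ← lintegral_const_mul _ (by fun_prop)]
        refine lintegral_congr fun x => ?_
        have : F x ^ p = F x * F x ^ (p - 1) := by
          conv_lhs => rw [show p = 1 + (p - 1) by ring]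
          rw [ENNReal.rpow_add_of_nonneg _ _ zero_le_one hp1.le, ENNReal.rpow_one]
        rw [ENNReal.mul_rpow_of_nonneg _ _ hp1.le, this]
        ring

/-- The constant in the maximal inequality in `L^p`. -/
def maximalConst (N : ℕ) (p : ℝ) : ℝ≥0∞ :=
  ENNReal.ofReal p * (2 * 5 ^ N) * (ENNReal.ofReal (p - 1))⁻¹ * 2 ^ (p - 1)

lemma maximalConst_ne_top {p : ℝ} (hp : 1 < p) : maximalConst N p ≠ ∞ := by
  have h1 : (ENNReal.ofReal (p - 1))⁻¹ ≠ ∞ := by simpa using hp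
  have h2 : (2 : ℝ≥0∞) ^ (p - 1) ≠ ∞ := by finiteness
  have h3 : (2 * 5 ^ N : ℝ≥0∞) ≠ ∞ := by finiteness
  exact ENNReal.mul_ne_top (ENNReal.mul_ne_top (ENNReal.mul_ne_top ENNReal.ofReal_ne_top h3) h1) h2

lemma lintegral_maximalFn_rpow_le {F : Space N → ℝ≥0∞} (hF : Measurable F) {p : ℝ} (hp : 1 < p) :
    ∫⁻ x, maximalFn F x ^ p ≤ maximalConst N p * ∫⁻ x, F x ^ p :=
  lintegral_rpow_le_of_weak hF (measurable_maximalFn hF)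
    (fun _ ht ht' => volume_maximalFn_gt_le_indicator hF ht ht') hp

/-- The maximal function in the space variable, at fixed time. -/
def maximalX (F : SpaceTime N → ℝ≥0∞) (z : SpaceTime N) : ℝ≥0∞ :=
  maximalFn (fun x => F (x, z.2)) z.1

lemma measurable_maximalX {F : SpaceTime N → ℝ≥0∞} (hF : Measurable F) :
    Measurable (maximalX F) := by
  unfold maximalX maximalFn ballMean
  refine Measurable.iSup fun i => Measurable.const_mul ?_ _
  exact Measurable.lintegral_prod_right'
    (f := fun p : SpaceTime N × Space N => F (p.1.1 + (2 : ℝ) ^ i • p.2, p.1.2)) (by fun_prop)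

/-- The operator acts on each time slice separately, so the inequality in x integrates in t for
every p > 1. This lets one operator serve both exponents of the capacity. -/
lemma lintegral_maximalX_rpow_le {F : SpaceTime N → ℝ≥0∞} (hF : Measurable F) {p : ℝ}
    (hp : 1 < p) : ∫⁻ z, maximalX F z ^ p ≤ maximalConst N p * ∫⁻ z, F z ^ p := by
  rw [Measure.volume_eq_prod, lintegral_prod_symm' _ ((measurable_maximalX hF).pow_const p),
    lintegral_prod_symm' _ (hF.pow_const p), ← lintegral_const_mul]
  · refine lintegral_mono fun t => ?_
    exact lintegral_maximalFn_rpow_le (F := fun x => F (x, t)) (by fun_prop) hp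
  · exact Measurable.lintegral_prod_left' (hF.pow_const p)

end Maximal

/-! ### A smooth maximum of finitely many functions -/

section SoftSup

set_option linter.unusedSectionVars false

local notation "τ" => Real.smoothTransition

lemma contDiff_smoothTransition : ContDiff ℝ 3 τ :=
  Real.smoothTransition.contDiff (n := 3)

lemma contDiff_deriv_smoothTransition : ContDiff ℝ 2 (deriv τ) :=
  ((contDiff_succ_iff_deriv (n := 2)).1
    (by rw [show (2 + 1 : WithTop ℕ∞) = 3 by norm_num]; exact contDiff_smoothTransition)).2.2

lemma contDiff_deriv_deriv_smoothTransition : ContDiff ℝ 1 (deriv (deriv τ)) :=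
  ((contDiff_succ_iff_deriv (n := 1)).1
    (by simpa [one_add_one_eq_two] using contDiff_deriv_smoothTransition)).2.2

lemma deriv_smoothTransition_nonneg (s : ℝ) : 0 ≤ deriv τ s :=
  Real.smoothTransition.monotone.deriv_nonneg

/-- Such points are global minima of τ, hence critical; this includes the endpoint 0. The next
lemmas use the same device, applied to τ at its maxima and to its nonnegative derivative at its
zeros. -/
lemma deriv_smoothTransition_of_nonpos {s : ℝ} (hs : s ≤ 0) : deriv τ s = 0 := by
  refine IsLocalMin.deriv_eq_zero (Filter.Eventually.of_forall fun x => ?_)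
  rw [Real.smoothTransition.zero_of_nonpos hs]
  exact Real.smoothTransition.nonneg x

lemma deriv_smoothTransition_of_one_le {s : ℝ} (hs : 1 ≤ s) : deriv τ s = 0 := by
  refine IsLocalMax.deriv_eq_zero (Filter.Eventually.of_forall fun x => ?_)
  rw [Real.smoothTransition.one_of_one_le hs]
  exact Real.smoothTransition.le_one x

lemma deriv_deriv_smoothTransition_of_nonpos {s : ℝ} (hs : s ≤ 0) : deriv (deriv τ) s = 0 := by
  refine IsLocalMin.deriv_eq_zero (Filter.Eventually.of_forall fun x => ?_)
  rw [deriv_smoothTransition_of_nonpos hs]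
  exact deriv_smoothTransition_nonneg x

lemma deriv_deriv_smoothTransition_of_one_le {s : ℝ} (hs : 1 ≤ s) : deriv (deriv τ) s = 0 := by
  refine IsLocalMin.deriv_eq_zero (Filter.Eventually.of_forall fun x => ?_)
  rw [deriv_smoothTransition_of_one_le hs]
  exact deriv_smoothTransition_nonneg x

lemma exists_abs_le_of_continuous_of_eq_zero {g : ℝ → ℝ} (hg : Continuous g)
    (h0 : ∀ s ≤ 0, g s = 0) (h1 : ∀ s, 1 ≤ s → g s = 0) : ∃ S, 0 ≤ S ∧ ∀ s, |g s| ≤ S := by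
  obtain ⟨S, hS⟩ := isCompact_Icc.exists_bound_of_continuousOn
    (s := Icc (0 : ℝ) 1) hg.continuousOn
  refine ⟨S, (norm_nonneg _).trans (hS 0 (by simp)), fun s => ?_⟩
  rcases le_total s 0 with h | h
  · rw [h0 s h, abs_zero]; exact (norm_nonneg _).trans (hS 0 (by simp))
  rcases le_total 1 s with h' | h'
  · rw [h1 s h', abs_zero]; exact (norm_nonneg _).trans (hS 0 (by simp))
  · exact hS s ⟨h, h'⟩

lemma exists_smoothTransition_bound :
    ∃ S, 0 ≤ S ∧ (∀ s, |deriv τ s| ≤ S) ∧ ∀ s, |deriv (deriv τ) s| ≤ S := by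
  obtain ⟨S₁, h₁, h₁'⟩ := exists_abs_le_of_continuous_of_eq_zero
    contDiff_deriv_smoothTransition.continuous (fun _ => deriv_smoothTransition_of_nonpos)
    (fun _ => deriv_smoothTransition_of_one_le)
  obtain ⟨S₂, h₂, h₂'⟩ := exists_abs_le_of_continuous_of_eq_zero
    contDiff_deriv_deriv_smoothTransition.continuous
    (fun _ => deriv_deriv_smoothTransition_of_nonpos)
    (fun _ => deriv_deriv_smoothTransition_of_one_le)
  exact ⟨max S₁ S₂, le_max_of_le_left h₁, fun s => (h₁' s).trans (le_max_left _ _),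
    fun s => (h₂' s).trans (le_max_right _ _)⟩

/-- A smooth version of the positive part. -/
def softPos (s : ℝ) : ℝ := ∫ x in (0 : ℝ)..s, τ x

lemma hasDerivAt_softPos (s : ℝ) : HasDerivAt softPos (τ s) s :=
  intervalIntegral.integral_hasDerivAt_right (Real.smoothTransition.continuous.intervalIntegrable _ _)
    Real.smoothTransition.continuous.stronglyMeasurable.stronglyMeasurableAtFilter
    Real.smoothTransition.continuous.continuousAt

lemma deriv_softPos : deriv softPos = τ := funext fun s => (hasDerivAt_softPos s).deriv

lemma contDiff_softPos : ContDiff ℝ 2 softPos := by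
  rw [show (2 : WithTop ℕ∞) = 1 + 1 by norm_num, contDiff_succ_iff_deriv]
  refine ⟨fun s => (hasDerivAt_softPos s).differentiableAt, by simp, ?_⟩
  rw [deriv_softPos]
  exact contDiff_smoothTransition.of_le (by norm_num)

lemma softPos_of_nonpos {s : ℝ} (hs : s ≤ 0) : softPos s = 0 := by
  unfold softPos
  rw [intervalIntegral.integral_congr (g := fun _ => 0)]
  · simp
  · intro x hx
    rw [uIcc_of_ge hs] at hx
    exact Real.smoothTransition.zero_of_nonpos hx.2

lemma softPos_nonneg (s : ℝ) : 0 ≤ softPos s := by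
  rcases le_total s 0 with h | h
  · rw [softPos_of_nonpos h]
  · exact intervalIntegral.integral_nonneg h fun x _ => Real.smoothTransition.nonneg x

/-- The integrand equals 1 beyond 1, so at most the contribution of [0,1] is lost. -/
lemma sub_one_le_softPos (s : ℝ) : s - 1 ≤ softPos s := by
  rcases le_total s 1 with h | h
  · linarith [softPos_nonneg s]
  · have hi : ∀ a b : ℝ, IntervalIntegrable τ volume a b := fun a b =>
      Real.smoothTransition.continuous.intervalIntegrable _ _
    have h1 : softPos s = softPos 1 + ∫ x in (1 : ℝ)..s, τ x :=
      (intervalIntegral.integral_add_adjacent_intervals (hi 0 1) (hi 1 s)).symm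
    have h2 : ∫ x in (1 : ℝ)..s, τ x = s - 1 := by
      rw [intervalIntegral.integral_congr (g := fun _ => 1)]
      · simp
      · intro x hx
        rw [uIcc_of_le h] at hx
        exact Real.smoothTransition.one_of_one_le hx.1
    linarith [softPos_nonneg 1]

/-! ### Directional derivatives and soft maxima -/

variable {Z : Type*} [NormedAddCommGroup Z] [NormedSpace ℝ Z]

/-- The derivative of `F` in the direction `e`. -/
def dirDeriv {V : Type*} [NormedAddCommGroup V] [NormedSpace ℝ V] (e : Z) (F : Z → V) (z : Z) : V :=
  fderiv ℝ F z e

lemma dirDeriv_comp {g : ℝ → ℝ} {F : Z → ℝ} (e z : Z) (hg : DifferentiableAt ℝ g (F z))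
    (hF : DifferentiableAt ℝ F z) :
    dirDeriv e (fun z => g (F z)) z = deriv g (F z) * dirDeriv e F z := by
  have := (hg.hasDerivAt.comp_hasFDerivAt z hF.hasFDerivAt).fderiv
  unfold dirDeriv
  rw [show (fun z => g (F z)) = g ∘ F from rfl, this]
  simp

lemma contDiff_one_dirDeriv {V : Type*} [NormedAddCommGroup V] [NormedSpace ℝ V] (e : Z)
    {F : Z → V} (hF : ContDiff ℝ 2 F) : ContDiff ℝ 1 (dirDeriv e F) := by
  unfold dirDeriv
  exact (hF.fderiv_right (m := 1) (by norm_num [one_add_one_eq_two])).clm_apply contDiff_const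

lemma dirDeriv_add {V : Type*} [NormedAddCommGroup V] [NormedSpace ℝ V] {F G : Z → V} (e z : Z)
    (hF : DifferentiableAt ℝ F z) (hG : DifferentiableAt ℝ G z) :
    dirDeriv e (fun z => F z + G z) z = dirDeriv e F z + dirDeriv e G z := by
  unfold dirDeriv
  rw [fderiv_fun_add hF hG]; rfl

lemma dirDeriv_sub {V : Type*} [NormedAddCommGroup V] [NormedSpace ℝ V] {F G : Z → V} (e z : Z)
    (hF : DifferentiableAt ℝ F z) (hG : DifferentiableAt ℝ G z) :
    dirDeriv e (fun z => F z - G z) z = dirDeriv e F z - dirDeriv e G z := by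
  unfold dirDeriv
  rw [fderiv_fun_sub hF hG]; rfl

lemma dirDeriv_mul {F G : Z → ℝ} (e z : Z)
    (hF : DifferentiableAt ℝ F z) (hG : DifferentiableAt ℝ G z) :
    dirDeriv e (fun z => F z * G z) z = F z * dirDeriv e G z + dirDeriv e F z * G z := by
  unfold dirDeriv
  rw [fderiv_fun_mul hF hG]
  simp [mul_comm]

lemma dirDeriv_dirDeriv_comp {g : ℝ → ℝ} {F : Z → ℝ} (e z : Z) (hg : ContDiff ℝ 2 g)
    (hF : ContDiff ℝ 2 F) :
    dirDeriv e (dirDeriv e (fun z => g (F z))) z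
      = deriv (deriv g) (F z) * dirDeriv e F z ^ 2
        + deriv g (F z) * dirDeriv e (dirDeriv e F) z := by
  have hg' : ContDiff ℝ 1 (deriv g) := ((contDiff_succ_iff_deriv (n := 1)).1
    (by simpa [one_add_one_eq_two] using hg)).2.2
  have hFd := hF.differentiable (by norm_num)
  have h1 : dirDeriv e (fun z => g (F z)) = fun z => deriv g (F z) * dirDeriv e F z :=
    funext fun z => dirDeriv_comp e z (hg.differentiable (by norm_num) _) (hFd z)
  rw [h1, dirDeriv_mul (F := fun z => deriv g (F z)) e z
    (((hg'.differentiable (by norm_num)).comp hFd) z)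
    ((contDiff_one_dirDeriv e hF).differentiable (by norm_num) z),
    dirDeriv_comp e z (hg'.differentiable (by norm_num) _) (hFd z)]
  ring

/-- A smooth majorant of `0` and `v`, up to an error of `2`, equal to `u` where `v ≤ 1 + u`. -/
def softMax (u v : Z → ℝ) (z : Z) : ℝ := u z + softPos (v z - 1 - u z)

lemma contDiff_softMax {u v : Z → ℝ} (hu : ContDiff ℝ 2 u) (hv : ContDiff ℝ 2 v) :
    ContDiff ℝ 2 (softMax u v) :=
  hu.add (contDiff_softPos.comp ((hv.sub contDiff_const).sub hu))

lemma le_softMax (u v : Z → ℝ) (z : Z) : u z ≤ softMax u v z :=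
  le_add_of_nonneg_right (softPos_nonneg _)

lemma sub_two_le_softMax (u v : Z → ℝ) (z : Z) : v z - 2 ≤ softMax u v z := by
  have := sub_one_le_softPos (v z - 1 - u z)
  unfold softMax
  linarith

lemma softMax_of_le {u v : Z → ℝ} {z : Z} (h : v z - 1 - u z ≤ 0) : softMax u v z = u z := by
  simp [softMax, softPos_of_nonpos h]

lemma dirDeriv_shift {u v : Z → ℝ} (hu : ContDiff ℝ 2 u) (hv : ContDiff ℝ 2 v) (e z : Z) :
    dirDeriv e (fun z => v z - 1 - u z) z = dirDeriv e v z - dirDeriv e u z := by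
  have hu' := hu.differentiable (by norm_num)
  have hv' := hv.differentiable (by norm_num)
  rw [dirDeriv_sub e z (by fun_prop) (hu' z), dirDeriv_sub e z (hv' z) (by fun_prop)]
  simp [dirDeriv]

/-- A convex combination with weight τ: a common bound for first derivatives survives any number of
soft maxima without loss. -/
lemma dirDeriv_softMax {u v : Z → ℝ} (hu : ContDiff ℝ 2 u) (hv : ContDiff ℝ 2 v) (e z : Z) :
    dirDeriv e (softMax u v) z
      = (1 - τ (v z - 1 - u z)) * dirDeriv e u z + τ (v z - 1 - u z) * dirDeriv e v z := by
  have hd : Differentiable ℝ fun z => v z - 1 - u z :=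
    ((hv.sub contDiff_const).sub hu).differentiable (by norm_num)
  have hs := contDiff_softPos.differentiable (by norm_num)
  unfold softMax
  rw [dirDeriv_add (G := fun z => softPos (v z - 1 - u z)) e z
    (hu.differentiable (by norm_num) z) ((hs.comp hd) z),
    dirDeriv_comp e z (hs _) (hd z), deriv_softPos, dirDeriv_shift hu hv]
  ring

/-- The only excess over a convex combination is τ' times the square of a difference of first
derivatives. This quadratic term is what the dyadic construction has to absorb. -/
lemma dirDeriv_dirDeriv_softMax {u v : Z → ℝ} (hu : ContDiff ℝ 2 u) (hv : ContDiff ℝ 2 v)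
    (e z : Z) :
    dirDeriv e (dirDeriv e (softMax u v)) z
      = (1 - τ (v z - 1 - u z)) * dirDeriv e (dirDeriv e u) z
        + τ (v z - 1 - u z) * dirDeriv e (dirDeriv e v) z
        + deriv τ (v z - 1 - u z) * (dirDeriv e v z - dirDeriv e u z) ^ 2 := by
  have hc : ContDiff ℝ 2 fun z => v z - 1 - u z := (hv.sub contDiff_const).sub hu
  have hd := hc.differentiable (by norm_num)
  have hs := contDiff_softPos.differentiable (by norm_num)
  have hu1 := (contDiff_one_dirDeriv e hu).differentiable (by norm_num)
  have hv1 := (contDiff_one_dirDeriv e hv).differentiable (by norm_num)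
  have h1 : dirDeriv e (softMax u v)
      = fun z => dirDeriv e u z + dirDeriv e (fun z => softPos (v z - 1 - u z)) z :=
    funext fun z => dirDeriv_add e z (hu.differentiable (by norm_num) z) ((hs.comp hd) z)
  have h2 : dirDeriv e (dirDeriv e fun z => v z - 1 - u z) z
      = dirDeriv e (dirDeriv e v) z - dirDeriv e (dirDeriv e u) z := by
    rw [show (dirDeriv e fun z => v z - 1 - u z) = fun z => dirDeriv e v z - dirDeriv e u z from
      funext fun z => dirDeriv_shift hu hv e z, dirDeriv_sub e z (hv1 z) (hu1 z)]
  rw [h1, dirDeriv_add (G := dirDeriv e fun z => softPos (v z - 1 - u z)) e z (hu1 z)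
    ((contDiff_one_dirDeriv e (contDiff_softPos.comp hc)).differentiable (by norm_num) z),
    dirDeriv_dirDeriv_comp e z contDiff_softPos hc, deriv_softPos, h2, dirDeriv_shift hu hv]
  ring

lemma abs_convex_le {s x y X : ℝ} (h0 : 0 ≤ s) (h1 : s ≤ 1) (hx : |x| ≤ X) (hy : |y| ≤ X) :
    |(1 - s) * x + s * y| ≤ X := by
  calc |(1 - s) * x + s * y| ≤ |(1 - s) * x| + |s * y| := abs_add_le _ _
    _ = (1 - s) * |x| + s * |y| := by
        rw [abs_mul, abs_mul, abs_of_nonneg h0, abs_of_nonneg (sub_nonneg.2 h1)]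
    _ ≤ (1 - s) * X + s * X := by gcongr
    _ = X := by ring

lemma abs_dirDeriv_softMax_le {u v : Z → ℝ} (hu : ContDiff ℝ 2 u) (hv : ContDiff ℝ 2 v)
    {e z : Z} {X : ℝ} (h1 : |dirDeriv e u z| ≤ X) (h2 : |dirDeriv e v z| ≤ X) :
    |dirDeriv e (softMax u v) z| ≤ X := by
  rw [dirDeriv_softMax hu hv]
  exact abs_convex_le (Real.smoothTransition.nonneg _) (Real.smoothTransition.le_one _) h1 h2

lemma abs_dirDeriv_dirDeriv_softMax_le {u v : Z → ℝ} (hu : ContDiff ℝ 2 u) (hv : ContDiff ℝ 2 v)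
    {e z : Z} {S X Y : ℝ} (hS : ∀ s, |deriv τ s| ≤ S)
    (h1 : |dirDeriv e u z| ≤ X) (h2 : |dirDeriv e v z| ≤ X)
    (h3 : |dirDeriv e (dirDeriv e u) z| ≤ Y) (h4 : |dirDeriv e (dirDeriv e v) z| ≤ Y) :
    |dirDeriv e (dirDeriv e (softMax u v)) z| ≤ Y + S * (4 * X ^ 2) := by
  rw [dirDeriv_dirDeriv_softMax hu hv]
  refine (abs_add_le _ _).trans (add_le_add
    (abs_convex_le (Real.smoothTransition.nonneg _) (Real.smoothTransition.le_one _) h3 h4) ?_)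
  rw [abs_mul, abs_pow]
  have : |dirDeriv e v z - dirDeriv e u z| ≤ 2 * X := (abs_sub _ _).trans (by linarith)
  have hS0 : 0 ≤ S := (abs_nonneg _).trans (hS 0)
  calc _ ≤ S * (2 * X) ^ 2 := by gcongr; exact hS _
    _ = _ := by ring

/-- The iterated smooth maximum of `0` and `h 0, …, h (n - 1)`. -/
def softSup (h : ℕ → Z → ℝ) : ℕ → Z → ℝ
  | 0 => fun _ => 0
  | n + 1 => softMax (softSup h n) (h n)

variable {h : ℕ → Z → ℝ}

lemma contDiff_softSup (hh : ∀ j, ContDiff ℝ 2 (h j)) (n : ℕ) : ContDiff ℝ 2 (softSup h n) := by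
  induction n with
  | zero => exact contDiff_const
  | succ n ih => exact contDiff_softMax ih (hh n)

lemma softSup_mono (h : ℕ → Z → ℝ) (z : Z) : Monotone fun n => softSup h n z :=
  monotone_nat_of_le_succ fun _ => le_softMax _ _ z

lemma softSup_nonneg (h : ℕ → Z → ℝ) (n : ℕ) (z : Z) : 0 ≤ softSup h n z :=
  softSup_mono h z (Nat.zero_le n)

lemma sub_two_le_softSup (h : ℕ → Z → ℝ) (z : Z) {j n : ℕ} (hj : j < n) :
    h j z - 2 ≤ softSup h n z :=
  (sub_two_le_softMax (softSup h j) (h j) z).trans (softSup_mono h z hj)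

lemma abs_dirDeriv_softSup_le (hh : ∀ j, ContDiff ℝ 2 (h j)) {e z : Z} {X : ℝ} (hX : 0 ≤ X)
    (hX' : ∀ j, |dirDeriv e (h j) z| ≤ X) (n : ℕ) : |dirDeriv e (softSup h n) z| ≤ X := by
  induction n with
  | zero => simpa [softSup, dirDeriv] using hX
  | succ n ih => exact abs_dirDeriv_softMax_le (contDiff_softSup hh n) (hh n) ih (hX' n)

/-- Here `y` is 4^j for the last index j at which the maximum was updated, or 0. The invariant 4y ≤
4^n makes the inherited bound at most a quarter of the new one, and the constant reproduces itself:
a quarter of 2C + 8SC², plus C + 4SC² from the new term, is at most 2C + 8SC². Hence nothing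
accumulates with `n`. -/
lemma softSup_derivative_bounds (hh : ∀ j, ContDiff ℝ 2 (h j)) {e z : Z} {C S Y : ℝ}
    (hC : 0 ≤ C) (hS : ∀ s, |deriv τ s| ≤ S) (hY : 0 ≤ Y) (n : ℕ)
    (h1 : ∀ j < n, |dirDeriv e (h j) z| ≤ C * 2 ^ j)
    (h2 : ∀ j < n, |dirDeriv e (dirDeriv e (h j)) z| ≤ C * 4 ^ j)
    (hact : ∀ j < n, 1 < h j z → 4 ^ j ≤ Y) :
    ∃ y, 0 ≤ y ∧ y ≤ Y ∧ 4 * y ≤ 4 ^ n ∧ dirDeriv e (softSup h n) z ^ 2 ≤ C ^ 2 * y ∧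
      |dirDeriv e (dirDeriv e (softSup h n)) z| ≤ (2 * C + 8 * S * C ^ 2) * y ∧
      (softSup h n z ≠ 0 → 1 ≤ Y) := by
  have hS0 : 0 ≤ S := (abs_nonneg _).trans (hS 0)
  induction n with
  | zero =>
    have e1 : dirDeriv e (softSup h 0) = fun _ => 0 := by
      funext z; simp [softSup, dirDeriv]
    exact ⟨0, le_rfl, hY, by norm_num, by simp [e1], by rw [e1]; simp [dirDeriv], by simp [softSup]⟩
  | succ n ih =>
    obtain ⟨y, hy0, hyY, hyn, hd1, hd2, hne⟩ := ih (fun j hj => h1 j (by omega))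
      (fun j hj => h2 j (by omega)) (fun j hj => hact j (by omega))
    have hw := contDiff_softSup hh n
    -- In the inactive case τ and τ' vanish at this argument, so value and derivatives are inherited
    -- unchanged. In the active case h n > 1, which gives 4^n ≤ Y.
    by_cases ha : h n z - 1 - softSup h n z ≤ 0
    · have t0 := Real.smoothTransition.zero_of_nonpos ha
      have t1 := deriv_smoothTransition_of_nonpos ha
      refine ⟨y, hy0, hyY, ?_, ?_, ?_, ?_⟩
      · rw [pow_succ]; linarith [pow_pos (by norm_num : (0 : ℝ) < 4) n]
      · rw [softSup, dirDeriv_softMax hw (hh n), t0]; simpa using hd1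
      · rw [softSup, dirDeriv_dirDeriv_softMax hw (hh n), t0, t1]; simpa using hd2
      · rw [softSup, softMax_of_le ha]; exact hne
    · have hpos : 1 < h n z := by linarith [softSup_nonneg h n z]
      have h4 : (4 : ℝ) ^ n = (2 ^ n) ^ 2 := by rw [← pow_mul, mul_comm, pow_mul]; norm_num
      have h4Y := hact n (by omega) hpos
      have hp4 : (0 : ℝ) < 4 ^ n := by positivity
      have hX : |dirDeriv e (softSup h n) z| ≤ C * 2 ^ n := by
        refine abs_le_of_sq_le_sq (hd1.trans ?_) (by positivity)
        rw [mul_pow, ← h4]; gcongr; linarith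
      refine ⟨4 ^ n, hp4.le, h4Y, by rw [pow_succ]; linarith, ?_, ?_, ?_⟩
      · have := abs_dirDeriv_softMax_le hw (hh n) hX (h1 n (by omega))
        rw [softSup]
        calc _ = |dirDeriv e (softMax (softSup h n) (h n)) z| ^ 2 := (sq_abs _).symm
          _ ≤ (C * 2 ^ n) ^ 2 := by gcongr
          _ = _ := by rw [mul_pow, ← h4]
      · have := abs_dirDeriv_dirDeriv_softMax_le hw (hh n) (Y := (2 * C + 8 * S * C ^ 2) * y
            + C * 4 ^ n) hS hX (h1 n (by omega)) (hd2.trans (le_add_of_nonneg_right (by positivity)))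
            ((h2 n (by omega)).trans (le_add_of_nonneg_left (by positivity)))
        rw [softSup]
        refine this.trans ?_
        rw [mul_pow, ← h4]
        have : (2 * C + 8 * S * C ^ 2) * y ≤ (2 * C + 8 * S * C ^ 2) * (4 ^ n / 4) := by
          gcongr; linarith
        have e2 : 0 ≤ C * 4 ^ n := by positivity
        have e3 : 0 ≤ S * C ^ 2 * 4 ^ n := by positivity
        nlinarith
      · intro _
        exact (one_le_pow₀ (by norm_num)).trans h4Y

/-- The truncation built from a family `h` and a function `f`. -/
def truncation (h : ℕ → Z → ℝ) (n : ℕ) (f : Z → ℝ) (z : Z) : ℝ :=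
  τ (softMax (softSup h n) f z)

lemma contDiff_truncation (hh : ∀ j, ContDiff ℝ 2 (h j)) (n : ℕ) {f : Z → ℝ}
    (hf : ContDiff ℝ 2 f) : ContDiff ℝ 2 (truncation h n f) :=
  (contDiff_smoothTransition.of_le (by norm_num)).comp (contDiff_softMax (contDiff_softSup hh n) hf)

lemma truncation_nonneg (h : ℕ → Z → ℝ) (n : ℕ) (f : Z → ℝ) (z : Z) : 0 ≤ truncation h n f z :=
  Real.smoothTransition.nonneg _

lemma truncation_le_one (h : ℕ → Z → ℝ) (n : ℕ) (f : Z → ℝ) (z : Z) : truncation h n f z ≤ 1 :=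
  Real.smoothTransition.le_one _

lemma truncation_eq_one (h : ℕ → Z → ℝ) (n : ℕ) {f : Z → ℝ} {z : Z} (hz : 3 ≤ f z) :
    truncation h n f z = 1 := by
  refine Real.smoothTransition.one_of_one_le ?_
  linarith [sub_two_le_softMax (softSup h n) f z]

lemma abs_dirDeriv_truncation_le (hh : ∀ j, ContDiff ℝ 2 (h j)) (n : ℕ) {f : Z → ℝ}
    (hf : ContDiff ℝ 2 f) {e z : Z} {S X : ℝ} (hS : ∀ s, |deriv τ s| ≤ S) (hX : 0 ≤ X)
    (hX' : ∀ j, |dirDeriv e (h j) z| ≤ X) (hfX : |dirDeriv e f z| ≤ X) :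
    |dirDeriv e (truncation h n f) z| ≤ S * X := by
  have hc := contDiff_softMax (contDiff_softSup hh n) hf
  unfold truncation
  rw [dirDeriv_comp e z (contDiff_smoothTransition.differentiable (by norm_num) _)
    (hc.differentiable (by norm_num) z), abs_mul]
  have hS0 : 0 ≤ S := (abs_nonneg _).trans (hS 0)
  gcongr
  · exact hS _
  · exact abs_dirDeriv_softMax_le (contDiff_softSup hh n) hf (abs_dirDeriv_softSup_le hh hX hX' n)
      hfX

/-- Pointwise bounds for a truncation in terms of a number `Y` that dominates `4 ^ j` for all
active indices `j`. -/
lemma truncation_bounds (hh : ∀ j, ContDiff ℝ 2 (h j)) (n : ℕ) {f : Z → ℝ}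
    (hf : ContDiff ℝ 2 f) {e z : Z} {C S Y : ℝ} (hC : 0 ≤ C) (hS : ∀ s, |deriv τ s| ≤ S)
    (hS' : ∀ s, |deriv (deriv τ) s| ≤ S) (hY : 0 ≤ Y)
    (h1 : ∀ j < n, h j z ≤ 3 → |dirDeriv e (h j) z| ≤ C * 2 ^ j)
    (h2 : ∀ j < n, h j z ≤ 3 → |dirDeriv e (dirDeriv e (h j)) z| ≤ C * 4 ^ j)
    (hact : ∀ j < n, 1 < h j z → 4 ^ j ≤ Y)
    (hf1 : (∀ j < n, h j z ≤ 3) → dirDeriv e f z ^ 2 ≤ C ^ 2 * Y)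
    (hf2 : |dirDeriv e (dirDeriv e f) z| ≤ C * Y) (hfact : 1 < f z → 1 ≤ Y) :
    |truncation h n f z| ≤ Y ∧ |dirDeriv e (truncation h n f) z| ≤ S * C * Y ∧
      |dirDeriv e (dirDeriv e (truncation h n f)) z|
        ≤ (S * C ^ 2 + S * (3 * C + 12 * S * C ^ 2)) * Y := by
  have hS0 : 0 ≤ S := (abs_nonneg _).trans (hS 0)
  have hw := contDiff_softSup hh n
  have hc := contDiff_softMax hw hf
  have hτ := contDiff_smoothTransition
  set w := softMax (softSup h n) f with hwdef
  have hw0 : 0 ≤ w z := (softSup_nonneg h n z).trans (le_softMax _ _ z)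
  have hpos : ∀ j < n, 1 < h j z → 1 ≤ Y := fun j hj hjz =>
    (one_le_pow₀ (by norm_num)).trans (hact j hj hjz)
  have hsup0 : (∀ j < n, h j z ≤ 1) → softSup h n z = 0 := by
    intro hle
    clear_value w
    clear h1 h2 hact hf1 hpos hwdef hw hc hw0
    induction n with
    | zero => rfl
    | succ n ih =>
      have e1 := ih fun j hj => hle j (by omega)
      rw [softSup, softMax_of_le, e1]
      rw [e1]; linarith [hle n (by omega)]
  have hwY : w z ≠ 0 → 1 ≤ Y := by
    intro hne
    by_cases hle : ∀ j < n, h j z ≤ 1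
    · by_contra hY1
      have hf1 : f z ≤ 1 := by by_contra hc; exact hY1 (hfact (not_le.1 hc))
      refine hne ?_
      rw [hwdef, softMax_of_le, hsup0 hle]
      rw [hsup0 hle]; linarith
    · push Not at hle
      obtain ⟨j, hj, hjz⟩ := hle
      exact hpos j hj hjz
  have hd1 : dirDeriv e (truncation h n f) z = deriv τ (w z) * dirDeriv e w z :=
    dirDeriv_comp e z (hτ.differentiable (by norm_num) _) (hc.differentiable (by norm_num) z)
  have hd2 : dirDeriv e (dirDeriv e (truncation h n f)) z = deriv (deriv τ) (w z)
      * dirDeriv e w z ^ 2 + deriv τ (w z) * dirDeriv e (dirDeriv e w) z :=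
    dirDeriv_dirDeriv_comp e z (hτ.of_le (by norm_num)) hc
  have hA : |truncation h n f z| ≤ Y := by
    by_cases hwz : w z = 0
    · have : truncation h n f z = 0 := by
        show τ (w z) = 0
        rw [hwz, Real.smoothTransition.zero]
      rw [this, abs_zero]; exact hY
    · rw [abs_of_nonneg (truncation_nonneg _ _ _ _)]
      exact (truncation_le_one _ _ _ _).trans (hwY hwz)
  refine ⟨hA, ?_⟩
  -- Where w ≥ 1 the step τ is saturated and all derivatives vanish. Where w < 1 every h j is at
  -- most 3, since h j - 2 ≤ w, and the local bounds become available.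
  by_cases hw1 : 1 ≤ w z
  · rw [hd2, hd1, deriv_smoothTransition_of_one_le hw1, deriv_deriv_smoothTransition_of_one_le hw1]
    simp only [zero_mul, add_zero, abs_zero]
    exact ⟨by positivity, by positivity⟩
  · push Not at hw1
    have hle3 : ∀ j < n, h j z ≤ 3 := fun j hj => by
      have e1 := sub_two_le_softSup h z hj
      have e2 := le_softMax (softSup h n) f z
      rw [← hwdef] at e2
      linarith
    obtain ⟨y, hy0, hyY, -, b1, b2, -⟩ := softSup_derivative_bounds hh hC hS hY n
      (fun j hj => h1 j hj (hle3 j hj)) (fun j hj => h2 j hj (hle3 j hj)) hact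
    have sq : (C * √Y) ^ 2 = C ^ 2 * Y := by rw [mul_pow, Real.sq_sqrt hY]
    have c1 : |dirDeriv e (softSup h n) z| ≤ C * √Y :=
      abs_le_of_sq_le_sq (by rw [sq]; exact b1.trans (by gcongr)) (by positivity)
    have c2 : |dirDeriv e f z| ≤ C * √Y :=
      abs_le_of_sq_le_sq (by rw [sq]; exact hf1 hle3) (by positivity)
    have c3 := abs_dirDeriv_softMax_le hw hf c1 c2
    rw [← hwdef] at c3
    have c4 := abs_dirDeriv_dirDeriv_softMax_le hw hf (Y := (3 * C + 8 * S * C ^ 2) * Y) hS c1 c2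
      (b2.trans (by
        have : 0 ≤ C * Y := by positivity
        calc _ ≤ (2 * C + 8 * S * C ^ 2) * Y := by gcongr
          _ ≤ _ := by linarith))
      (hf2.trans (by
        have : 0 ≤ C * Y := by positivity
        have : 0 ≤ S * C ^ 2 * Y := by positivity
        linarith))
    rw [← hwdef, sq] at c4
    constructor
    · rw [hd1, abs_mul]
      -- The derivative of w is of size √Y, not Y. Where w = 0 the factor τ' is zero; where w ≠ 0
      -- one has Y ≥ 1 and hence √Y ≤ Y.
      by_cases hwz : w z = 0
      · rw [hwz, deriv_smoothTransition_of_nonpos le_rfl]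
        simp only [abs_zero, zero_mul]
        positivity
      · have hY1 := hwY hwz
        have : √Y ≤ Y := by
          rw [Real.sqrt_le_left (by linarith)]; nlinarith
        calc _ ≤ S * (C * √Y) := by gcongr; exact hS _
          _ ≤ S * (C * Y) := by gcongr
          _ = _ := by ring
    · rw [hd2]
      refine (abs_add_le _ _).trans ?_
      rw [abs_mul, abs_mul, abs_pow]
      calc _ ≤ S * (C * √Y) ^ 2 + S * ((3 * C + 8 * S * C ^ 2) * Y + S * (4 * (C ^ 2 * Y))) := by
            gcongr
            · exact hS' _
            · exact hS _
        _ = _ := by rw [sq]; ring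

end SoftSup

/-! ### A polynomially decaying averaging kernel -/

section Kernel

variable {N : ℕ}

/-- `y ↦ (1 + |y|²)^{-k}`. -/
def bracketPow (k : ℕ) (y : Space N) : ℝ := ((1 + ‖y‖ ^ 2) ^ k)⁻¹

lemma one_le_bracket (y : Space N) : 1 ≤ 1 + ‖y‖ ^ 2 := by linarith [sq_nonneg ‖y‖]

lemma bracket_pos (y : Space N) : 0 < 1 + ‖y‖ ^ 2 := by positivity

lemma bracketPow_pos (k : ℕ) (y : Space N) : 0 < bracketPow k y := by
  unfold bracketPow; positivity

lemma bracketPow_neg (k : ℕ) (y : Space N) : bracketPow k (-y) = bracketPow k y := by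
  simp [bracketPow]

lemma continuous_bracketPow (k : ℕ) : Continuous (bracketPow (N := N) k) := by
  unfold bracketPow
  exact Continuous.inv₀ (by fun_prop) fun y => (pow_pos (bracket_pos y) k).ne'

lemma bracketPow_succ_mul (k : ℕ) (y : Space N) :
    bracketPow (k + 1) y * (1 + ‖y‖ ^ 2) = bracketPow k y := by
  have := (bracket_pos y).ne'
  unfold bracketPow
  field_simp
  ring

lemma integrable_bracketPow {k : ℕ} (hk : N < 2 * k) : Integrable (bracketPow (N := N) k) := by
  have h := integrable_rpow_neg_one_add_norm_sq (E := Space N) (μ := volume) (r := 2 * k)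
    (by simpa using (by exact_mod_cast hk : (N : ℝ) < 2 * k))
  refine h.congr (Filter.Eventually.of_forall fun y => ?_)
  have : (-(2 * (k : ℝ)) / 2) = -(k : ℝ) := by ring
  simp only [bracketPow]
  rw [this, Real.rpow_neg (bracket_pos y).le, Real.rpow_natCast]

/-- The total mass of the unnormalised kernel. -/
def kernelMass (N : ℕ) : ℝ := ∫ y : Space N, bracketPow (N + 2) y

lemma kernelMass_pos : 0 < kernelMass N := by
  unfold kernelMass
  rw [integral_pos_iff_support_of_nonneg (fun y => (bracketPow_pos _ y).le)
    (integrable_bracketPow (by omega))]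
  have : Function.support (bracketPow (N := N) (N + 2)) = univ :=
    eq_univ_of_forall fun y => (bracketPow_pos _ y).ne'
  rw [this]
  exact Measure.measure_univ_pos.2 (NeZero.ne _)

/-- The averaging kernel. -/
def kernel (y : Space N) : ℝ := (kernelMass N)⁻¹ * bracketPow (N + 2) y

lemma kernel_pos (y : Space N) : 0 < kernel y :=
  mul_pos (inv_pos.2 kernelMass_pos) (bracketPow_pos _ _)

lemma kernel_neg (y : Space N) : kernel (-y) = kernel y := by
  simp [kernel, bracketPow_neg]

lemma continuous_kernel : Continuous (kernel (N := N)) :=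
  continuous_const.mul (continuous_bracketPow _)

lemma integrable_kernel : Integrable (kernel (N := N)) :=
  (integrable_bracketPow (by omega)).const_mul _

lemma integral_kernel : ∫ y : Space N, kernel y = 1 := by
  unfold kernel
  rw [integral_const_mul]
  exact inv_mul_cancel₀ kernelMass_pos.ne'

/-- The exponent N + 2 is chosen so that the second moment needed in Taylor's formula still leaves a
kernel of exponent N + 1, decaying fast enough for the maximal function to dominate it. -/
lemma kernel_mul_bracket (y : Space N) :
    kernel y * (1 + ‖y‖ ^ 2) = (kernelMass N)⁻¹ * bracketPow (N + 1) y := by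
  rw [kernel, mul_assoc, bracketPow_succ_mul]

/-- The derivative of the kernel in the direction `v`. -/
def kernelDeriv (v y : Space N) : ℝ :=
  (kernelMass N)⁻¹ * (-((N + 2 : ℕ) : ℝ) * (2 * inner ℝ y v) * bracketPow (N + 3) y)

/-- The second derivative of the kernel in the direction `v`. -/
def kernelDeriv₂ (v y : Space N) : ℝ :=
  (kernelMass N)⁻¹ * (-((N + 2 : ℕ) : ℝ) * (2 * ‖v‖ ^ 2) * bracketPow (N + 3) y
    + ((N + 2 : ℕ) : ℝ) * ((N + 3 : ℕ) : ℝ) * (2 * inner ℝ y v) ^ 2 * bracketPow (N + 4) y)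

lemma hasLineDerivAt_bracketPow (k : ℕ) (y v : Space N) :
    HasLineDerivAt ℝ (bracketPow k) (-(k : ℝ) * (2 * inner ℝ y v) * bracketPow (k + 1) y) y v := by
  have h1 : HasDerivAt (fun t : ℝ => y + t • v) v 0 := by
    simpa using ((hasDerivAt_id (0 : ℝ)).smul_const v).const_add y
  have h2 : HasDerivAt (fun t : ℝ => 1 + ‖y + t • v‖ ^ 2) (2 * inner ℝ y v) 0 := by
    simpa using (h1.norm_sq).const_add 1
  have h3 := ((h2.pow k).inv (by simpa using (pow_pos (bracket_pos y) k).ne'))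
  have hb := (bracket_pos y).ne'
  unfold HasLineDerivAt
  refine h3.congr_deriv ?_
  simp only [zero_smul, add_zero, bracketPow, Pi.pow_apply]
  rcases k with _ | k
  · simp
  · simp only [Nat.add_sub_cancel]
    field_simp
    ring

lemma hasLineDerivAt_kernel (v y : Space N) : HasLineDerivAt ℝ kernel (kernelDeriv v y) y v := by
  unfold HasLineDerivAt
  exact HasDerivAt.const_mul _ (hasLineDerivAt_bracketPow (N + 2) y v)

lemma hasLineDerivAt_kernelDeriv (v y : Space N) :
    HasLineDerivAt ℝ (kernelDeriv v) (kernelDeriv₂ v y) y v := by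
  have h1 : HasDerivAt (fun t : ℝ => inner ℝ (y + t • v) v) (‖v‖ ^ 2) 0 := by
    have h : HasDerivAt (fun t : ℝ => y + t • v) v 0 := by
      simpa using ((hasDerivAt_id (0 : ℝ)).smul_const v).const_add y
    simpa using h.inner ℝ (hasDerivAt_const (0 : ℝ) v)
  have h2 := hasLineDerivAt_bracketPow (N + 3) y v
  unfold HasLineDerivAt at h2 ⊢
  unfold kernelDeriv
  refine (HasDerivAt.const_mul _ (((h1.const_mul 2).const_mul _).mul h2)).congr_deriv ?_
  simp only [kernelDeriv₂, zero_smul, add_zero]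
  ring

lemma two_mul_abs_inner_le {v : Space N} (hv : ‖v‖ ≤ 1) (y : Space N) :
    |2 * inner ℝ y v| ≤ 1 + ‖y‖ ^ 2 := by
  have h1 : |inner ℝ y v| ≤ ‖y‖ * ‖v‖ := abs_real_inner_le_norm y v
  have h2 : ‖y‖ * ‖v‖ ≤ ‖y‖ := mul_le_of_le_one_right (norm_nonneg _) hv
  rw [abs_mul, abs_two]
  nlinarith [sq_nonneg (‖y‖ - 1)]

/-- A constant bounding the derivatives of the kernel by the kernel. -/
def kernelConst (N : ℕ) : ℝ := ((N : ℝ) + 4) ^ 2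

lemma kernelConst_nonneg : 0 ≤ kernelConst N := sq_nonneg _

/-- Differentiating a power of 1 + |y|² does not worsen its decay, so the kernel dominates its
derivatives. Gaussian or compactly supported kernels lack this property, which is the reason for
polynomial decay. -/
lemma abs_kernelDeriv_le {v : Space N} (hv : ‖v‖ ≤ 1) (y : Space N) :
    |kernelDeriv v y| ≤ kernelConst N * kernel y := by
  have hm := inv_pos.2 (kernelMass_pos (N := N))
  have hb := bracketPow_pos (N + 3) y
  unfold kernelDeriv kernel
  rw [abs_mul, abs_mul, abs_mul, abs_of_pos hm, abs_of_pos hb, abs_neg, Nat.abs_cast,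
    ← bracketPow_succ_mul (N + 2) y]
  calc _ ≤ (kernelMass N)⁻¹ * (((N + 2 : ℕ) : ℝ) * (1 + ‖y‖ ^ 2) * bracketPow (N + 3) y) := by
        gcongr; exact two_mul_abs_inner_le hv y
    _ ≤ (kernelMass N)⁻¹ * (kernelConst N * (1 + ‖y‖ ^ 2) * bracketPow (N + 3) y) := by
        gcongr
        unfold kernelConst; push_cast
        nlinarith [Nat.cast_nonneg (α := ℝ) N]
    _ = _ := by ring

lemma abs_kernelDeriv₂_le {v : Space N} (hv : ‖v‖ ≤ 1) (y : Space N) :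
    |kernelDeriv₂ v y| ≤ kernelConst N * kernel y := by
  have hm := inv_pos.2 (kernelMass_pos (N := N))
  have hb := bracketPow_pos (N + 4) y
  have hv2 : ‖v‖ ^ 2 ≤ 1 := pow_le_one₀ (norm_nonneg _) hv
  have hp := one_le_bracket y
  have hi : (2 * inner ℝ y v) ^ 2 ≤ (1 + ‖y‖ ^ 2) ^ 2 := by
    rw [← sq_abs]; gcongr; exact two_mul_abs_inner_le hv y
  have hN := Nat.cast_nonneg (α := ℝ) N
  unfold kernelDeriv₂ kernel
  rw [abs_mul, abs_of_pos hm, mul_left_comm (kernelConst N)]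
  refine mul_le_mul_of_nonneg_left ?_ hm.le
  rw [← bracketPow_succ_mul (N + 2) y, ← bracketPow_succ_mul (N + 3) y]
  refine (abs_add_le _ _).trans ?_
  rw [abs_mul, abs_mul, abs_neg, Nat.abs_cast,
    abs_of_nonneg (show 0 ≤ 2 * ‖v‖ ^ 2 by positivity),
    abs_of_nonneg (show 0 ≤ bracketPow (N + 4) y * (1 + ‖y‖ ^ 2) by positivity),
    abs_of_nonneg (show 0 ≤ ((N + 2 : ℕ) : ℝ) * ((N + 3 : ℕ) : ℝ) * (2 * inner ℝ y v) ^ 2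
      * bracketPow (N + 4) y by positivity)]
  calc _ ≤ ((N + 2 : ℕ) : ℝ) * (2 * 1) * (bracketPow (N + 4) y * (1 + ‖y‖ ^ 2) * (1 + ‖y‖ ^ 2))
        + ((N + 2 : ℕ) : ℝ) * ((N + 3 : ℕ) : ℝ) * (1 + ‖y‖ ^ 2) ^ 2 * bracketPow (N + 4) y := by
        gcongr
        exact le_mul_of_one_le_right (by positivity) hp
    _ = (((N + 2 : ℕ) : ℝ) * 2 + ((N + 2 : ℕ) : ℝ) * ((N + 3 : ℕ) : ℝ))
        * (bracketPow (N + 4) y * (1 + ‖y‖ ^ 2) * (1 + ‖y‖ ^ 2)) := by ring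
    _ ≤ _ := by
        gcongr
        unfold kernelConst; push_cast; nlinarith

lemma continuous_kernelDeriv (v : Space N) : Continuous (kernelDeriv v) := by
  unfold kernelDeriv
  have := continuous_bracketPow (N := N) (N + 3)
  fun_prop

lemma continuous_kernelDeriv₂ (v : Space N) : Continuous (kernelDeriv₂ v) := by
  unfold kernelDeriv₂
  have := continuous_bracketPow (N := N) (N + 3)
  have := continuous_bracketPow (N := N) (N + 4)
  fun_prop

/-! ### Domination by the maximal function -/

/-- The ball of radius ρR lies in a ball of dyadic radius at most 2ρR, which costs the factor 2^N.
-/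
lemma setLIntegral_ball_comp_le {F : Space N → ℝ≥0∞} (hF : Measurable F) {ρ R : ℝ} (hρ : 0 < ρ)
    (hR : 0 < R) (x : Space N) :
    ∫⁻ y in Metric.ball (0 : Space N) R, F (x + ρ • y)
      ≤ ENNReal.ofReal ((2 * R) ^ N) * volume (Metric.ball (0 : Space N) 1) * maximalFn F x := by
  obtain ⟨i, hi1, hi2⟩ := exists_mem_Ioc_zpow (mul_pos hρ hR) (one_lt_two : (1 : ℝ) < 2)
  have hi3 : (2 : ℝ) ^ (i + 1) ≤ 2 * (ρ * R) := by
    rw [zpow_add_one₀ (by norm_num)]; linarith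
  set s : ℝ := (2 : ℝ) ^ (i + 1) with hs
  have hs0 : 0 < s := by positivity
  have hsub : ∀ y, (Metric.ball (0 : Space N) R).indicator (fun y => F (x + ρ • y)) y
      ≤ (Metric.ball x s).indicator F (x + ρ • y) := by
    intro y
    by_cases hy : y ∈ Metric.ball (0 : Space N) R
    · have : x + ρ • y ∈ Metric.ball x s := by
        rw [mem_ball_zero_iff] at hy
        rw [Metric.mem_ball, dist_self_add_left, norm_smul, Real.norm_of_nonneg hρ.le]
        exact (mul_lt_mul_of_pos_left hy hρ).trans_le hi2
      rw [indicator_of_mem hy, indicator_of_mem this]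
    · rw [indicator_of_notMem hy]; exact zero_le
  rw [← lintegral_indicator measurableSet_ball]
  refine (lintegral_mono hsub).trans ?_
  rw [lintegral_comp_add_smul hρ (hF.indicator measurableSet_ball),
    lintegral_indicator measurableSet_ball, setLIntegral_ball hs0 hF, volume_ball_eq hs0]
  calc _ = ENNReal.ofReal ((ρ ^ N)⁻¹ * s ^ N) * volume (Metric.ball (0 : Space N) 1)
        * ballMean s F x := by rw [ENNReal.ofReal_mul (by positivity)]; ring
    _ ≤ _ := by
        gcongr
        · rw [← inv_pow, ← mul_pow]
          refine pow_le_pow_left₀ (by positivity) ?_ N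
          rw [inv_mul_le_iff₀ hρ]; linarith
        · exact le_iSup (fun i : ℤ => ballMean ((2 : ℝ) ^ i) F x) (i + 1)

/-- One term suffices: for the least k with |y| < 2^k, either k = 0 or |y| ≥ 2^{k-1}, and then 1 +
|y|² ≥ 4^{k-1}. -/
lemma bracketPow_le_tsum (y : Space N) :
    ENNReal.ofReal (bracketPow (N + 1) y) ≤ ∑' k : ℕ, (Metric.ball (0 : Space N) (2 ^ k)).indicator
      (fun _ => ENNReal.ofReal (4 ^ (N + 1) * ((4 ^ (N + 1))⁻¹) ^ k)) y := by
  have hex : ∃ k : ℕ, ‖y‖ < 2 ^ k := pow_unbounded_of_one_lt _ one_lt_two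
  classical
  set k := Nat.find hex with hk
  have hk1 : ‖y‖ < 2 ^ k := Nat.find_spec hex
  refine le_trans ?_ (ENNReal.le_tsum k)
  rw [indicator_of_mem (by simpa using hk1)]
  refine ENNReal.ofReal_le_ofReal ?_
  unfold bracketPow
  rcases Nat.eq_zero_or_pos k with h0 | h0
  · rw [h0, pow_zero, mul_one]
    exact (inv_le_one_of_one_le₀ (one_le_pow₀ (one_le_bracket y))).trans
      (one_le_pow₀ (by norm_num))
  · obtain ⟨j, hj⟩ := Nat.exists_eq_succ_of_ne_zero h0.ne'
    have h2 : (2 : ℝ) ^ j ≤ ‖y‖ := not_lt.1 (Nat.find_min hex (by omega))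
    have h4 : (4 : ℝ) ^ j ≤ 1 + ‖y‖ ^ 2 := by
      have : (4 : ℝ) ^ j = (2 ^ j) ^ 2 := by rw [← pow_mul, mul_comm, pow_mul]; norm_num
      rw [this]
      have : ((2 : ℝ) ^ j) ^ 2 ≤ ‖y‖ ^ 2 := by gcongr
      linarith
    have e : (4 : ℝ) ^ (N + 1) * ((4 ^ (N + 1))⁻¹) ^ k = ((4 ^ j) ^ (N + 1))⁻¹ := by
      rw [hj, ← pow_mul, mul_comm j, pow_mul, Nat.succ_eq_add_one, pow_succ (_⁻¹) j, inv_pow]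
      field_simp
    rw [e]
    gcongr

/-- The constant in the domination of kernel averages by the maximal function. -/
def dominationConst (N : ℕ) : ℝ≥0∞ :=
  ENNReal.ofReal ((kernelMass N)⁻¹) *
    (ENNReal.ofReal (4 ^ (N + 1) * 2 ^ N) * volume (Metric.ball (0 : Space N) 1) * 2)

lemma dominationConst_ne_top : dominationConst N ≠ ∞ :=
  ENNReal.mul_ne_top ENNReal.ofReal_ne_top
    (ENNReal.mul_ne_top (ENNReal.mul_ne_top ENNReal.ofReal_ne_top unitBall_ne_top) (by simp))

lemma lintegral_bracketPow_mul_le {F : Space N → ℝ≥0∞} (hF : Measurable F) {ρ : ℝ} (hρ : 0 < ρ)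
    (x : Space N) :
    ∫⁻ y, ENNReal.ofReal (bracketPow (N + 1) y) * F (x + ρ • y)
      ≤ ENNReal.ofReal (4 ^ (N + 1) * 2 ^ N) * volume (Metric.ball (0 : Space N) 1) * 2
        * maximalFn F x := by
  have hFm : Measurable fun y => F (x + ρ • y) := by fun_prop
  calc _ ≤ ∫⁻ y, ∑' k : ℕ, (Metric.ball (0 : Space N) (2 ^ k)).indicator
        (fun _ => ENNReal.ofReal (4 ^ (N + 1) * ((4 ^ (N + 1))⁻¹) ^ k)) y * F (x + ρ • y) := by
        refine lintegral_mono fun y => ?_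
        rw [ENNReal.tsum_mul_right]
        gcongr
        exact bracketPow_le_tsum y
    _ = ∑' k : ℕ, ENNReal.ofReal (4 ^ (N + 1) * ((4 ^ (N + 1))⁻¹) ^ k)
        * ∫⁻ y in Metric.ball (0 : Space N) (2 ^ k), F (x + ρ • y) := by
        rw [lintegral_tsum]
        swap
        · exact fun k => ((measurable_const.indicator measurableSet_ball).mul hFm).aemeasurable
        refine tsum_congr fun k => ?_
        rw [← lintegral_const_mul _ hFm, ← lintegral_indicator measurableSet_ball]
        refine lintegral_congr fun y => ?_
        by_cases hy : y ∈ Metric.ball (0 : Space N) (2 ^ k)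
        · simp only [indicator_of_mem hy]
        · simp only [indicator_of_notMem hy, zero_mul]
    _ ≤ ∑' k : ℕ, (ENNReal.ofReal (4 ^ (N + 1) * 2 ^ N) * volume (Metric.ball (0 : Space N) 1)
          * maximalFn F x) * (2⁻¹) ^ k := by
        refine ENNReal.tsum_le_tsum fun k => ?_
        -- The volume growth 2^{kN} is beaten by the decay 4^{-k(N+1)} with ratio at most 1/2,
        -- giving a geometric series.
        have h2 : ENNReal.ofReal (4 ^ (N + 1) * ((4 ^ (N + 1))⁻¹) ^ k)
            * ENNReal.ofReal ((2 * 2 ^ k) ^ N) ≤ ENNReal.ofReal (4 ^ (N + 1) * 2 ^ N) * (2⁻¹) ^ k := by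
          rw [← ENNReal.ofReal_mul (by positivity)]
          have : ((2 : ℝ≥0∞)⁻¹) ^ k = ENNReal.ofReal ((2⁻¹ : ℝ) ^ k) := by
            rw [ENNReal.ofReal_pow (by norm_num), ENNReal.ofReal_inv_of_pos (by norm_num)]
            simp
          rw [this, ← ENNReal.ofReal_mul (by positivity)]
          refine ENNReal.ofReal_le_ofReal ?_
          have e : (4 : ℝ) ^ (N + 1) * ((4 ^ (N + 1))⁻¹) ^ k * (2 * 2 ^ k) ^ N
              = 4 ^ (N + 1) * 2 ^ N * ((4 ^ (N + 1))⁻¹ * 2 ^ N) ^ k := by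
            rw [mul_pow 2, mul_pow _ _ k, ← pow_mul 2 k N, ← pow_mul 2 N k, mul_comm k N]; ring
          rw [e]
          gcongr
          rw [inv_mul_le_iff₀ (by positivity)]
          have h1 : (2 : ℝ) ^ N ≤ 4 ^ N := by gcongr; norm_num
          have h2 : (0 : ℝ) < 4 ^ N := by positivity
          rw [pow_succ]; linarith
        calc _ ≤ ENNReal.ofReal (4 ^ (N + 1) * ((4 ^ (N + 1))⁻¹) ^ k)
              * (ENNReal.ofReal ((2 * 2 ^ k) ^ N) * volume (Metric.ball (0 : Space N) 1)
                * maximalFn F x) := by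
              gcongr
              exact setLIntegral_ball_comp_le hF hρ (by positivity) x
          _ = (ENNReal.ofReal (4 ^ (N + 1) * ((4 ^ (N + 1))⁻¹) ^ k)
              * ENNReal.ofReal ((2 * 2 ^ k) ^ N)) * (volume (Metric.ball (0 : Space N) 1)
                * maximalFn F x) := by ring
          _ ≤ (ENNReal.ofReal (4 ^ (N + 1) * 2 ^ N) * (2⁻¹) ^ k)
                * (volume (Metric.ball (0 : Space N) 1) * maximalFn F x) := by gcongr
          _ = _ := by ring
    _ = _ := by
        rw [ENNReal.tsum_mul_left, ENNReal.tsum_geometric_two]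
        ring

/-- Either sign of ρ is allowed, by evenness of the kernel, because Taylor's remainder is integrated
over scales s·r with s in (-1,1]. -/
lemma lintegral_kernel_bracket_mul_le {F : SpaceTime N → ℝ≥0∞} (hF : Measurable F) {ρ : ℝ}
    (hρ : ρ ≠ 0) (z : SpaceTime N) :
    ∫⁻ y, ENNReal.ofReal (kernel y * (1 + ‖y‖ ^ 2)) * F (z - (ρ • y, 0))
      ≤ dominationConst N * maximalX F z := by
  have hFz : Measurable fun x => F (x, z.2) := by fun_prop
  have hpos : ∀ ρ : ℝ, 0 < ρ → ∫⁻ y, ENNReal.ofReal (kernel y * (1 + ‖y‖ ^ 2))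
      * F (z.1 + ρ • y, z.2) ≤ dominationConst N * maximalX F z := by
    intro ρ hρ
    simp_rw [kernel_mul_bracket, ENNReal.ofReal_mul (inv_pos.2 (kernelMass_pos (N := N))).le,
      mul_assoc]
    rw [lintegral_const_mul]
    · rw [dominationConst, mul_assoc]
      gcongr
      exact lintegral_bracketPow_mul_le hFz hρ z.1
    · exact (continuous_bracketPow _).measurable.ennreal_ofReal.mul (by fun_prop)
  have hz : ∀ y : Space N, z - (ρ • y, 0) = (z.1 + (-ρ) • y, z.2) := by
    intro y; ext1 <;> simp [sub_eq_add_neg]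
  simp_rw [hz]
  rcases lt_or_gt_of_ne hρ with h | h
  · exact hpos _ (by linarith)
  · refine le_trans (le_of_eq ?_) (hpos ρ h)
    rw [← lintegral_neg_eq_self (fun y => ENNReal.ofReal (kernel y * (1 + ‖y‖ ^ 2))
      * F (z.1 + ρ • y, z.2))]
    refine lintegral_congr fun y => ?_
    simp [kernel_neg]

lemma lintegral_kernel_mul_le {F : SpaceTime N → ℝ≥0∞} (hF : Measurable F) {ρ : ℝ}
    (hρ : ρ ≠ 0) (z : SpaceTime N) :
    ∫⁻ y, ENNReal.ofReal (kernel y) * F (z - (ρ • y, 0)) ≤ dominationConst N * maximalX F z := by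
  refine le_trans (lintegral_mono fun y => ?_) (lintegral_kernel_bracket_mul_le hF hρ z)
  gcongr
  exact le_mul_of_one_le_right (kernel_pos y).le (one_le_bracket y)

end Kernel

/-! ### Functions with bounded derivatives -/

section BoundedClasses

set_option linter.unusedSectionVars false

variable {Z V : Type*} [NormedAddCommGroup Z] [NormedSpace ℝ Z] [NormedAddCommGroup V]
  [NormedSpace ℝ V]

/-- Bounded continuous functions. -/
structure BddC0 (F : Z → V) : Prop where
  continuous : Continuous F
  bounded : ∃ C, ∀ z, ‖F z‖ ≤ C

/-- Bounded functions with bounded continuous derivative. -/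
structure BddC1 (F : Z → V) : Prop where
  differentiable : Differentiable ℝ F
  zero : BddC0 F
  one : BddC0 (fderiv ℝ F)

/-- Bounded functions with bounded continuous derivatives of order at most two. -/
structure BddC2 (F : Z → V) : Prop where
  differentiable : Differentiable ℝ F
  zero : BddC0 F
  one : BddC1 (fderiv ℝ F)

lemma BddC2.toBddC1 {F : Z → V} (h : BddC2 F) : BddC1 F := ⟨h.differentiable, h.zero, h.one.zero⟩

lemma BddC1.contDiff {F : Z → V} (h : BddC1 F) : ContDiff ℝ 1 F :=
  contDiff_one_iff_fderiv.2 ⟨h.differentiable, h.one.continuous⟩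

lemma BddC2.contDiff {F : Z → V} (h : BddC2 F) : ContDiff ℝ 2 F := by
  rw [show (2 : WithTop ℕ∞) = 1 + 1 by norm_num, contDiff_succ_iff_fderiv]
  exact ⟨h.differentiable, by simp, h.one.contDiff⟩

lemma BddC0.norm {F : Z → V} (h : BddC0 F) : BddC0 fun z => ‖F z‖ := by
  obtain ⟨C, hC⟩ := h.bounded
  exact ⟨h.continuous.norm, C, fun z => by simpa using hC z⟩

lemma BddC0.abs {F : Z → ℝ} (h : BddC0 F) : BddC0 fun z => |F z| := h.norm

lemma BddC0.sub {F G : Z → V} (hF : BddC0 F) (hG : BddC0 G) : BddC0 fun z => F z - G z := by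
  obtain ⟨C, hC⟩ := hF.bounded
  obtain ⟨C', hC'⟩ := hG.bounded
  exact ⟨hF.continuous.sub hG.continuous, C + C', fun z =>
    (norm_sub_le _ _).trans (add_le_add (hC z) (hC' z))⟩

lemma BddC0.add {F G : Z → V} (hF : BddC0 F) (hG : BddC0 G) : BddC0 fun z => F z + G z := by
  obtain ⟨C, hC⟩ := hF.bounded
  obtain ⟨C', hC'⟩ := hG.bounded
  exact ⟨hF.continuous.add hG.continuous, C + C', fun z =>
    (norm_add_le _ _).trans (add_le_add (hC z) (hC' z))⟩

lemma BddC1.sub {F G : Z → V} (hF : BddC1 F) (hG : BddC1 G) : BddC1 fun z => F z - G z := by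
  refine ⟨hF.differentiable.sub hG.differentiable, hF.zero.sub hG.zero, ?_⟩
  have : fderiv ℝ (fun z => F z - G z) = fun z => fderiv ℝ F z - fderiv ℝ G z :=
    funext fun z => fderiv_fun_sub (hF.differentiable z) (hG.differentiable z)
  rw [this]
  exact hF.one.sub hG.one

lemma BddC2.sub {F G : Z → V} (hF : BddC2 F) (hG : BddC2 G) : BddC2 fun z => F z - G z := by
  refine ⟨hF.differentiable.sub hG.differentiable, hF.zero.sub hG.zero, ?_⟩
  have : fderiv ℝ (fun z => F z - G z) = fun z => fderiv ℝ F z - fderiv ℝ G z :=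
    funext fun z => fderiv_fun_sub (hF.differentiable z) (hG.differentiable z)
  rw [this]
  exact hF.one.sub hG.one

lemma BddC0.smul {c : Z → ℝ} {G : Z → V} (hc : BddC0 c) (hG : BddC0 G) :
    BddC0 fun z => c z • G z := by
  obtain ⟨C, hC⟩ := hc.bounded
  obtain ⟨C', hC'⟩ := hG.bounded
  refine ⟨hc.continuous.smul hG.continuous, C * C', fun z => ?_⟩
  rw [norm_smul]
  exact mul_le_mul (hC z) (hC' z) (norm_nonneg _) ((norm_nonneg _).trans (hC z))

lemma BddC0.smulRight {c : Z → (Z →L[ℝ] ℝ)} {G : Z → V} (hc : BddC0 c) (hG : BddC0 G) :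
    BddC0 fun z => (c z).smulRight (G z) := by
  obtain ⟨C, hC⟩ := hc.bounded
  obtain ⟨C', hC'⟩ := hG.bounded
  refine ⟨?_, C * C', fun z => ?_⟩
  · exact (ContinuousLinearMap.smulRightL ℝ Z V).continuous₂.comp₂ hc.continuous hG.continuous
  · rw [ContinuousLinearMap.norm_smulRight_apply]
    exact mul_le_mul (hC z) (hC' z) (norm_nonneg _) ((norm_nonneg _).trans (hC z))

lemma BddC1.smul {c : Z → ℝ} {G : Z → V} (hc : BddC1 c) (hG : BddC1 G) :
    BddC1 fun z => c z • G z := by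
  refine ⟨hc.differentiable.smul hG.differentiable, hc.zero.smul hG.zero, ?_⟩
  have : fderiv ℝ (fun z => c z • G z)
      = fun z => c z • fderiv ℝ G z + (fderiv ℝ c z).smulRight (G z) :=
    funext fun z => fderiv_fun_smul (hc.differentiable z) (hG.differentiable z)
  rw [this]
  exact (hc.zero.smul hG.one).add (hc.one.smulRight hG.zero)

lemma BddC0.comp_real {g : ℝ → ℝ} (hg : Continuous g) {F : Z → ℝ} (hF : BddC0 F) :
    BddC0 fun z => g (F z) := by
  obtain ⟨C, hC⟩ := hF.bounded
  obtain ⟨C', hC'⟩ := (isCompact_closedBall (0 : ℝ) C).exists_bound_of_continuousOn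
    hg.continuousOn
  exact ⟨hg.comp hF.continuous, C', fun z => hC' _ (by simpa using hC z)⟩

lemma fderiv_comp_real {g : ℝ → ℝ} (hg : Differentiable ℝ g) {F : Z → ℝ}
    (hF : Differentiable ℝ F) :
    fderiv ℝ (fun z => g (F z)) = fun z => deriv g (F z) • fderiv ℝ F z :=
  funext fun z => ((hg _).hasDerivAt.comp_hasFDerivAt z (hF z).hasFDerivAt).fderiv

lemma BddC1.comp_real {g : ℝ → ℝ} (hg : ContDiff ℝ 1 g) {F : Z → ℝ} (hF : BddC1 F) :
    BddC1 fun z => g (F z) := by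
  have hd := hg.differentiable (by norm_num)
  refine ⟨hd.comp hF.differentiable, hF.zero.comp_real hg.continuous, ?_⟩
  rw [fderiv_comp_real hd hF.differentiable]
  exact (hF.zero.comp_real (hg.continuous_deriv (by norm_num))).smul hF.one

lemma BddC2.comp_real {g : ℝ → ℝ} (hg : ContDiff ℝ 2 g) {F : Z → ℝ} (hF : BddC2 F) :
    BddC2 fun z => g (F z) := by
  have hd := hg.differentiable (by norm_num)
  have hg' : ContDiff ℝ 1 (deriv g) := ((contDiff_succ_iff_deriv (n := 1)).1
    (by simpa [one_add_one_eq_two] using hg)).2.2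
  refine ⟨hd.comp hF.differentiable, hF.zero.comp_real hg.continuous, ?_⟩
  rw [fderiv_comp_real hd hF.differentiable]
  exact (hF.toBddC1.comp_real hg').smul hF.one

lemma BddC0.clm_apply {W : Type*} [NormedAddCommGroup W] [NormedSpace ℝ W] {G : Z → (W →L[ℝ] V)}
    (hG : BddC0 G) (e : W) : BddC0 fun z => G z e := by
  obtain ⟨C, hC⟩ := hG.bounded
  exact ⟨hG.continuous.clm_apply continuous_const, C * ‖e‖, fun z =>
    ((G z).le_opNorm e).trans (by gcongr; exact hC z)⟩

lemma BddC1.dirDeriv {F : Z → V} (hF : BddC1 F) (e : Z) : BddC0 (dirDeriv e F) :=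
  hF.one.clm_apply e

lemma BddC2.dirDeriv {F : Z → V} (hF : BddC2 F) (e : Z) : BddC1 (dirDeriv e F) := by
  refine ⟨fun z => (hF.one.differentiable z).clm_apply (differentiableAt_const e),
    hF.one.zero.clm_apply e, ?_⟩
  have h : fderiv ℝ (PorousMedium.dirDeriv e F)
      = fun z => (ContinuousLinearMap.apply ℝ V e).comp (fderiv ℝ (fderiv ℝ F) z) :=
    funext fun z => ((ContinuousLinearMap.apply ℝ V e).hasFDerivAt.comp z
      (hF.one.differentiable z).hasFDerivAt).fderiv
  rw [h]
  obtain ⟨C, hC⟩ := hF.one.one.bounded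
  refine ⟨(continuous_const.clm_comp hF.one.one.continuous),
    ‖ContinuousLinearMap.apply ℝ V e‖ * C, fun z => ?_⟩
  exact (ContinuousLinearMap.opNorm_comp_le _ _).trans (by gcongr; exact hC z)

lemma BddC0.schwartz (f : 𝓢(Z, V)) : BddC0 f := by
  obtain ⟨C, -, hC⟩ := f.decay 0 0
  exact ⟨f.continuous, C, fun z => by simpa using hC z⟩

/-- Averages against a polynomially decaying kernel need not be Schwartz functions. The argument
therefore runs in `BddC2`, which is stable under averages, differences and composition with C²
functions of one variable. -/
lemma BddC2.schwartz (f : 𝓢(Z, V)) : BddC2 f := by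
  have h1 : fderiv ℝ f = SchwartzMap.fderivCLM ℝ Z V f := by
    funext z; simp
  refine ⟨f.differentiable, .schwartz f, ?_⟩
  rw [h1]
  have h2 : fderiv ℝ (SchwartzMap.fderivCLM ℝ Z V f)
      = SchwartzMap.fderivCLM ℝ Z _ (SchwartzMap.fderivCLM ℝ Z V f) := by
    funext z; simp
  refine ⟨SchwartzMap.differentiable _, .schwartz _, ?_⟩
  rw [h2]
  exact .schwartz _

end BoundedClasses

/-! ### Averages in the space variable -/

section Average

variable {N : ℕ} {V : Type*} [NormedAddCommGroup V] [NormedSpace ℝ V]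

/-- The average of `F` in the space variable, at scale `r`. -/
def avgX (r : ℝ) (F : SpaceTime N → V) (z : SpaceTime N) : V :=
  ∫ y : Space N, kernel y • F (z - (r • y, 0))

lemma continuous_shift (r : ℝ) (z : SpaceTime N) :
    Continuous fun y : Space N => z - (r • y, (0 : ℝ)) := by fun_prop

lemma BddC0.integrable_mul {F : SpaceTime N → V} (hF : BddC0 F) {κ : Space N → ℝ}
    (hκ : Integrable κ) (r : ℝ) (z : SpaceTime N) :
    Integrable fun y : Space N => κ y • F (z - (r • y, 0)) := by
  obtain ⟨C, hC⟩ := hF.bounded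
  refine (hκ.norm.mul_const C).mono' (hκ.aestronglyMeasurable.smul
    (hF.continuous.comp (continuous_shift r z)).aestronglyMeasurable)
    (Filter.Eventually.of_forall fun y => ?_)
  rw [norm_smul]
  gcongr
  exact hC _

lemma BddC0.integrable_avg {F : SpaceTime N → V} (hF : BddC0 F) (r : ℝ) (z : SpaceTime N) :
    Integrable fun y : Space N => kernel y • F (z - (r • y, 0)) :=
  hF.integrable_mul integrable_kernel r z

lemma BddC0.avgX {F : SpaceTime N → V} (hF : BddC0 F) (r : ℝ) : BddC0 (avgX r F) := by
  obtain ⟨C, hC⟩ := hF.bounded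
  have hb : ∀ (z : SpaceTime N) (y : Space N), ‖kernel y • F (z - (r • y, 0))‖ ≤ kernel y * C := by
    intro z y
    rw [norm_smul, Real.norm_of_nonneg (kernel_pos y).le]
    gcongr
    · exact (kernel_pos y).le
    · exact hC _
  refine ⟨?_, C, fun z => ?_⟩
  · refine continuous_of_dominated (bound := fun y => kernel y * C)
      (fun z => (hF.integrable_avg r z).aestronglyMeasurable)
      (fun z => Filter.Eventually.of_forall (hb z)) (integrable_kernel.mul_const C)
      (Filter.Eventually.of_forall fun y => ?_)
    exact continuous_const.smul (hF.continuous.comp (by fun_prop))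
  · refine (norm_integral_le_of_norm_le (integrable_kernel.mul_const C)
      (Filter.Eventually.of_forall (hb z))).trans ?_
    rw [integral_mul_const, integral_kernel, one_mul]

lemma BddC1.hasFDerivAt_avgX {F : SpaceTime N → V} (hF : BddC1 F) (r : ℝ) (z : SpaceTime N) :
    HasFDerivAt (PorousMedium.avgX r F) (PorousMedium.avgX r (fderiv ℝ F) z) z := by
  obtain ⟨C, hC⟩ := hF.one.bounded
  refine hasFDerivAt_integral_of_dominated_of_fderiv_le (s := univ) (bound := fun y => kernel y * C)
    (F' := fun z y => kernel y • fderiv ℝ F (z - (r • y, 0))) Filter.univ_mem (Filter.Eventually.of_forall fun z =>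
      (hF.zero.integrable_avg r z).aestronglyMeasurable) (hF.zero.integrable_avg r z)
    (hF.one.integrable_avg r z).aestronglyMeasurable
    (Filter.Eventually.of_forall fun y z _ => ?_) (integrable_kernel.mul_const C)
    (Filter.Eventually.of_forall fun y z _ => ?_)
  · rw [norm_smul, Real.norm_of_nonneg (kernel_pos y).le]
    gcongr
    · exact (kernel_pos y).le
    · exact hC _
  · have h := (hF.differentiable (z - (r • y, 0))).hasFDerivAt.comp z
      ((hasFDerivAt_id z).sub_const (r • y, (0 : ℝ)))
    exact h.const_smul (kernel y)

lemma BddC1.fderiv_avgX {F : SpaceTime N → V} (hF : BddC1 F) (r : ℝ) :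
    fderiv ℝ (PorousMedium.avgX r F) = PorousMedium.avgX r (fderiv ℝ F) :=
  funext fun z => (hF.hasFDerivAt_avgX r z).fderiv

lemma BddC1.avgX {F : SpaceTime N → V} (hF : BddC1 F) (r : ℝ) : BddC1 (avgX r F) := by
  refine ⟨fun z => (hF.hasFDerivAt_avgX r z).differentiableAt, hF.zero.avgX r, ?_⟩
  rw [hF.fderiv_avgX r]
  exact hF.one.avgX r

lemma BddC2.avgX {F : SpaceTime N → V} (hF : BddC2 F) (r : ℝ) : BddC2 (avgX r F) := by
  refine ⟨hF.toBddC1.avgX r |>.differentiable, hF.zero.avgX r, ?_⟩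
  rw [hF.toBddC1.fderiv_avgX r]
  exact hF.one.avgX r

lemma BddC1.dirDeriv_avgX [CompleteSpace V] {F : SpaceTime N → V} (hF : BddC1 F) (r : ℝ)
    (e : SpaceTime N) :
    PorousMedium.dirDeriv e (PorousMedium.avgX r F)
      = PorousMedium.avgX r (PorousMedium.dirDeriv e F) := by
  funext z
  unfold PorousMedium.dirDeriv
  rw [hF.fderiv_avgX r, PorousMedium.avgX,
    ContinuousLinearMap.integral_apply (hF.one.integrable_avg r z)]
  rfl

lemma norm_avgX_le (r : ℝ) (F : SpaceTime N → V) (z : SpaceTime N) :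
    ‖avgX r F z‖ ≤ avgX r (fun z => ‖F z‖) z := by
  refine (norm_integral_le_integral_norm _).trans (le_of_eq ?_)
  refine integral_congr_ae (Filter.Eventually.of_forall fun y => ?_)
  simp only [norm_smul, Real.norm_of_nonneg (kernel_pos y).le, smul_eq_mul]

lemma avgX_mono {F G : SpaceTime N → ℝ} (hF : BddC0 F) (hG : BddC0 G) (r : ℝ)
    (h : ∀ z, F z ≤ G z) (z : SpaceTime N) : avgX r F z ≤ avgX r G z :=
  integral_mono (hF.integrable_avg r z) (hG.integrable_avg r z) fun y => by
    simp only [smul_eq_mul]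
    exact mul_le_mul_of_nonneg_left (h _) (kernel_pos y).le

lemma avgX_sub {F G : SpaceTime N → V} (hF : BddC0 F) (hG : BddC0 G) (r : ℝ) (z : SpaceTime N) :
    avgX r (fun z => F z - G z) z = avgX r F z - avgX r G z := by
  unfold avgX
  rw [← integral_sub (hF.integrable_avg r z) (hG.integrable_avg r z)]
  simp_rw [smul_sub]

lemma avgX_add_const {F : SpaceTime N → ℝ} (hF : BddC0 F) (c r : ℝ) (z : SpaceTime N) :
    avgX r (fun z => F z + c) z = avgX r F z + c := by
  unfold avgX
  simp_rw [smul_add]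
  rw [integral_add (hF.integrable_avg r z) (integrable_kernel.smul_const c), integral_smul_const,
    integral_kernel, one_smul]

lemma avgX_nonneg {F : SpaceTime N → ℝ} (hF : ∀ z, 0 ≤ F z) (r : ℝ) (z : SpaceTime N) :
    0 ≤ avgX r F z :=
  integral_nonneg fun y => mul_nonneg (kernel_pos y).le (hF _)

lemma enorm_avgX_le {F : SpaceTime N → V} (hF : Continuous F) {r : ℝ} (hr : r ≠ 0)
    (z : SpaceTime N) :
    ‖avgX r F z‖ₑ ≤ dominationConst N * maximalX (fun z => ‖F z‖ₑ) z := by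
  refine (enorm_integral_le_lintegral_enorm _).trans
    (le_trans (le_of_eq ?_) (lintegral_kernel_mul_le hF.enorm.measurable hr z))
  refine lintegral_congr fun y => ?_
  rw [enorm_smul, Real.enorm_of_nonneg (kernel_pos y).le]

lemma maximalX_mono {F G : SpaceTime N → ℝ≥0∞} (h : ∀ z, F z ≤ G z) (z : SpaceTime N) :
    maximalX F z ≤ maximalX G z :=
  iSup_mono fun _ => ballMean_mono (fun _ => h _) _

lemma maximalX_const_mul {F : SpaceTime N → ℝ≥0∞} (hF : Measurable F) (c : ℝ≥0∞)
    (z : SpaceTime N) : maximalX (fun z => c * F z) z = c * maximalX F z := by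
  unfold maximalX maximalFn ballMean
  rw [ENNReal.mul_iSup]
  refine iSup_congr fun i => ?_
  rw [lintegral_const_mul _ (by fun_prop)]
  ring

/-- Averages at two scales commute. -/
lemma avgX_comm {F : SpaceTime N → ℝ} (hF : BddC0 F) (r s : ℝ) (z : SpaceTime N) :
    avgX r (avgX s F) z = avgX s (avgX r F) z := by
  obtain ⟨C, hC⟩ := hF.bounded
  have key : ∀ r s : ℝ, avgX r (avgX s F) z
      = ∫ y : Space N, ∫ x : Space N, kernel y * kernel x * F (z - (r • y, 0) - (s • x, 0)) := by
    intro r s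
    unfold avgX
    refine integral_congr_ae (Filter.Eventually.of_forall fun y => ?_)
    simp only [smul_eq_mul]
    rw [← integral_const_mul]
    simp_rw [mul_assoc]
  rw [key, key, integral_integral_swap]
  · refine integral_congr_ae (Filter.Eventually.of_forall fun y => ?_)
    refine integral_congr_ae (Filter.Eventually.of_forall fun x => ?_)
    simp only
    rw [mul_comm (kernel y), sub_right_comm]
  · have hK : Integrable (fun p : Space N × Space N => kernel p.1 * kernel p.2)
        (volume.prod volume) := integrable_kernel.mul_prod integrable_kernel
    exact hK.mul_bdd (c := C) (hF.continuous.comp (by fun_prop)).aestronglyMeasurable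
      (Filter.Eventually.of_forall fun y => hC _)

/-- Integration by parts against a kernel. -/
lemma integral_kernel_dirDeriv {F : SpaceTime N → ℝ} (hF : BddC1 F) {κ κ' : Space N → ℝ}
    {v : Space N} (hκ : Integrable κ) (hκ' : Integrable κ')
    (hd : ∀ y, HasLineDerivAt ℝ κ (κ' y) y v) {r : ℝ} (hr : r ≠ 0) (z : SpaceTime N) :
    ∫ y, κ y * dirDeriv (v, 0) F (z - (r • y, 0)) = r⁻¹ * ∫ y, κ' y * F (z - (r • y, 0)) := by
  have hg : ∀ y, HasLineDerivAt ℝ (fun y : Space N => F (z - (r • y, 0)))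
      (-r * dirDeriv (v, 0) F (z - (r • y, 0))) y v := by
    intro y
    have h1 : HasDerivAt (fun t : ℝ => z - (r • (y + t • v), (0 : ℝ))) (-(r • v), 0) 0 := by
      have h2 : HasDerivAt (fun t : ℝ => r • (y + t • v)) (r • v) 0 := by
        exact ((((hasDerivAt_id' (0 : ℝ)).smul_const v).const_add y).const_smul r).congr_deriv
          (by simp)
      simpa using (h2.prodMk (hasDerivAt_const (0 : ℝ) (0 : ℝ))).const_sub z
    have h3 := (hF.differentiable (z - (r • (y + (0 : ℝ) • v), 0))).hasFDerivAt.comp_hasDerivAt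
      (0 : ℝ) h1
    unfold HasLineDerivAt
    refine h3.congr_deriv ?_
    simp only [zero_smul, add_zero]
    rw [show ((-(r • v), 0) : SpaceTime N) = (-r) • (v, 0) by simp, map_smul]
    rfl
  have h := integral_bilinear_hasLineDerivAt_right_eq_neg_left_of_integrable (μ := volume)
    (B := ContinuousLinearMap.mul ℝ ℝ) (f := κ) (f' := κ') (v := v)
    (g := fun y => F (z - (r • y, 0))) (g' := fun y => -r * dirDeriv (v, 0) F (z - (r • y, 0)))
    (by simpa using hF.zero.integrable_mul hκ' r z)
    (by
      simpa [mul_left_comm] using ((hF.dirDeriv (v, 0)).integrable_mul hκ r z).const_mul (-r))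
    (by simpa using hF.zero.integrable_mul hκ r z) (fun y _ => hd y) (fun y _ => hg y)
  simp only [ContinuousLinearMap.mul_apply'] at h
  simp_rw [fun y => mul_left_comm (κ y) (-r)] at h
  rw [integral_const_mul] at h
  rw [eq_inv_mul_iff_mul_eq₀ hr]
  linarith

/-! ### Derivatives of averages controlled by averages -/

lemma integrable_kernelDeriv {v : Space N} (hv : ‖v‖ ≤ 1) : Integrable (kernelDeriv v) :=
  (integrable_kernel.const_mul (kernelConst N)).mono'
    (continuous_kernelDeriv v).aestronglyMeasurable
    (Filter.Eventually.of_forall fun y => abs_kernelDeriv_le hv y)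

lemma integrable_kernelDeriv₂ {v : Space N} (hv : ‖v‖ ≤ 1) : Integrable (kernelDeriv₂ v) :=
  (integrable_kernel.const_mul (kernelConst N)).mono'
    (continuous_kernelDeriv₂ v).aestronglyMeasurable
    (Filter.Eventually.of_forall fun y => abs_kernelDeriv₂_le hv y)

lemma abs_integral_kernel_le {F : SpaceTime N → ℝ} (hF : BddC0 F) {κ : Space N → ℝ}
    (hκ : ∀ y, |κ y| ≤ kernelConst N * kernel y) (r : ℝ) (z : SpaceTime N) :
    |∫ y, κ y * F (z - (r • y, 0))| ≤ kernelConst N * avgX r (fun z => |F z|) z := by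
  unfold avgX
  rw [← integral_const_mul, ← Real.norm_eq_abs]
  refine norm_integral_le_of_norm_le ((hF.abs.integrable_avg r z).const_mul _)
    (Filter.Eventually.of_forall fun y => ?_)
  rw [norm_mul, smul_eq_mul, ← mul_assoc]
  exact mul_le_mul_of_nonneg_right (hκ y) (norm_nonneg _)

/-- Integration by parts puts the derivative on the kernel, which is bounded by the kernel again.
For F ≥ 0 this reads |∂h| ≤ C r⁻¹ h with h the average itself. -/
lemma abs_dirDeriv_avgX_le {F : SpaceTime N → ℝ} (hF : BddC1 F) {v : Space N} (hv : ‖v‖ ≤ 1)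
    {r : ℝ} (hr : 0 < r) (z : SpaceTime N) :
    |dirDeriv (v, 0) (avgX r F) z| ≤ kernelConst N * r⁻¹ * avgX r (fun z => |F z|) z := by
  rw [hF.dirDeriv_avgX]
  unfold avgX
  simp_rw [smul_eq_mul]
  rw [integral_kernel_dirDeriv hF integrable_kernel (integrable_kernelDeriv hv)
    (hasLineDerivAt_kernel v) hr.ne', abs_mul, abs_of_pos (inv_pos.2 hr), mul_comm (kernelConst N),
    mul_assoc]
  gcongr
  exact abs_integral_kernel_le hF.zero (abs_kernelDeriv_le hv) r z

lemma abs_dirDeriv_dirDeriv_avgX_le {F : SpaceTime N → ℝ} (hF : BddC2 F) {v : Space N}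
    (hv : ‖v‖ ≤ 1) {r : ℝ} (hr : 0 < r) (z : SpaceTime N) :
    |dirDeriv (v, 0) (dirDeriv (v, 0) (avgX r F)) z|
      ≤ kernelConst N * (r⁻¹) ^ 2 * avgX r (fun z => |F z|) z := by
  rw [hF.toBddC1.dirDeriv_avgX, (hF.dirDeriv _).dirDeriv_avgX]
  unfold avgX
  simp_rw [smul_eq_mul]
  rw [integral_kernel_dirDeriv (hF.dirDeriv _) integrable_kernel (integrable_kernelDeriv hv)
    (hasLineDerivAt_kernel v) hr.ne', integral_kernel_dirDeriv hF.toBddC1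
    (integrable_kernelDeriv hv) (integrable_kernelDeriv₂ hv) (hasLineDerivAt_kernelDeriv v) hr.ne',
    ← mul_assoc, ← sq, abs_mul, abs_of_pos (pow_pos (inv_pos.2 hr) 2), mul_comm (kernelConst N),
    mul_assoc]
  gcongr
  exact abs_integral_kernel_le hF.zero (abs_kernelDeriv₂_le hv) r z

end Average

/-! ### Approximation by averages -/

section Approximation

variable {N : ℕ}

/-- The function s ↦ g(s) + g(-s) has derivative p(s) - p(-s), the integral of p' over (-s,s); the
mean value inequality on [0,1] finishes. -/
lemma abs_second_difference_le {g p p' : ℝ → ℝ} (hg : ∀ s, HasDerivAt g (p s) s)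
    (hp : ∀ s, HasDerivAt p (p' s) s) (hp' : Continuous p') :
    |g 1 + g (-1) - 2 * g 0| ≤ ∫ s in (-1 : ℝ)..1, |p' s| := by
  have hInt : ∀ a b : ℝ, IntervalIntegrable (fun s => |p' s|) volume a b := fun a b =>
    hp'.abs.intervalIntegrable a b
  have hd : ∀ s, HasDerivAt (fun s => g s + g (-s)) (p s - p (-s)) s := by
    intro s
    have h := (hg (-s)).comp s (hasDerivAt_neg s)
    exact ((hg s).add h).congr_deriv (by simp [sub_eq_add_neg])
  have hb : ∀ s ∈ Icc (0 : ℝ) 1, ‖p s - p (-s)‖ ≤ ∫ s in (-1 : ℝ)..1, |p' s| := by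
    rintro s ⟨hs0, hs1⟩
    have h1 : ∫ x in (-s)..s, p' x = p s - p (-s) :=
      intervalIntegral.integral_eq_sub_of_hasDerivAt (fun x _ => hp x)
        (hp'.intervalIntegrable _ _)
    rw [← h1]
    refine (intervalIntegral.norm_integral_le_integral_norm (by linarith)).trans ?_
    exact intervalIntegral.integral_mono_interval (by linarith) (by linarith) hs1
      (Filter.Eventually.of_forall fun _ => abs_nonneg _) (hInt _ _)
  have := (convex_Icc (0 : ℝ) 1).norm_image_sub_le_of_norm_hasDerivWithin_le
    (fun s _ => (hd s).hasDerivWithinAt) hb (left_mem_Icc.2 zero_le_one)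
    (right_mem_Icc.2 zero_le_one)
  simp only [neg_zero, sub_zero, norm_one, mul_one, Real.norm_eq_abs] at this
  refine le_trans (le_of_eq ?_) this
  congr 1; ring

lemma hasDerivAt_line {Z : Type*} [NormedAddCommGroup Z] [NormedSpace ℝ Z] {F : Z → ℝ}
    (hF : Differentiable ℝ F) (z w : Z) (s : ℝ) :
    HasDerivAt (fun s : ℝ => F (z - s • w)) (-dirDeriv w F (z - s • w)) s := by
  have h1 : HasDerivAt (fun s : ℝ => z - s • w) (-w) s := by
    simpa using ((hasDerivAt_id s).smul_const w).const_sub z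
  have h2 := (hF (z - s • w)).hasFDerivAt.comp_hasDerivAt s h1
  exact h2.congr_deriv (by simp [dirDeriv])

lemma enorm_second_difference_le {F : SpaceTime N → ℝ} (hF : BddC2 F) (z w : SpaceTime N) :
    ‖F (z - w) + F (z + w) - 2 * F z‖ₑ
      ≤ ∫⁻ s in Ioc (-1 : ℝ) 1, ‖dirDeriv w (dirDeriv w F) (z - s • w)‖ₑ := by
  have hp : ∀ s, HasDerivAt (fun s : ℝ => -dirDeriv w F (z - s • w))
      (dirDeriv w (dirDeriv w F) (z - s • w)) s := fun s => by
    exact (hasDerivAt_line (hF.dirDeriv w).differentiable z w s).neg.congr_deriv (neg_neg _)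
  have h := abs_second_difference_le (hasDerivAt_line hF.differentiable z w) hp
    ((hF.dirDeriv w).dirDeriv w |>.continuous.comp (by fun_prop))
  simp only [one_smul, neg_smul, sub_neg_eq_add, zero_smul, sub_zero] at h
  rw [intervalIntegral.integral_of_le (by norm_num)] at h
  rw [Real.enorm_eq_ofReal_abs]
  refine (ENNReal.ofReal_le_ofReal h).trans ?_
  rw [← Real.enorm_of_nonneg (integral_nonneg fun _ => abs_nonneg _)]
  refine (enorm_integral_le_lintegral_enorm _).trans (le_of_eq ?_)
  refine lintegral_congr fun s => ?_
  rw [Real.enorm_abs]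

/-- `F₂` dominates the second derivatives of `f` in the space variable. -/
def HessianBound (f : SpaceTime N → ℝ) (F₂ : SpaceTime N → ℝ≥0∞) : Prop :=
  ∀ v z, ‖dirDeriv (v, 0) (dirDeriv (v, 0) f) z‖ₑ ≤ ENNReal.ofReal (‖v‖ ^ 2) * F₂ z

/-- Evenness of the kernel removes the first-order term and leaves second differences. These are
integrals of second derivatives along segments; the weight |y|² goes into the kernel, and for each
position on the segment the y-integral is dominated by the maximal function. -/
lemma enorm_avgX_sub_le {f : SpaceTime N → ℝ} (hf : BddC2 f) {F₂ : SpaceTime N → ℝ≥0∞}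
    (hF₂ : Measurable F₂) (hb : HessianBound f F₂) {r : ℝ} (hr : 0 < r) (z : SpaceTime N) :
    ‖avgX r f z - f z‖ₑ ≤ 2 * ENNReal.ofReal (r ^ 2) * (dominationConst N * maximalX F₂ z) := by
  have hi := hf.zero.integrable_avg r z
  have hi' : Integrable fun y : Space N => kernel y • f (z + (r • y, 0)) := by
    simpa [sub_eq_add_neg] using hf.zero.integrable_avg (-r) z
  have hsymm : avgX r f z = ∫ y : Space N, kernel y • f (z + (r • y, 0)) := by
    unfold avgX
    rw [← integral_neg_eq_self]
    refine integral_congr_ae (Filter.Eventually.of_forall fun y => ?_)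
    simp only [kernel_neg, smul_neg]
    congr 2
    ext1 <;> simp [sub_eq_add_neg]
  have hsum : avgX r f z - f z + (avgX r f z - f z)
      = ∫ y : Space N, kernel y • (f (z - (r • y, 0)) + f (z + (r • y, 0)) - 2 * f z) := by
    have e : ∀ y : Space N, kernel y • (f (z - (r • y, 0)) + f (z + (r • y, 0)) - 2 * f z)
        = kernel y • f (z - (r • y, 0)) + kernel y • f (z + (r • y, 0)) - kernel y * (2 * f z) := by
      intro y; simp only [smul_eq_mul]; ring
    simp_rw [e]
    have hadd : Integrable fun y : Space N =>
        kernel y • f (z - (r • y, 0)) + kernel y • f (z + (r • y, 0)) := hi.add hi'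
    rw [integral_sub hadd (integrable_kernel.mul_const _), integral_add hi hi', ← hsymm,
      integral_mul_const, integral_kernel]
    unfold avgX
    ring
  -- The symmetrised integral computes twice the difference; the gain of 1/2 is given up.
  have hle : ‖avgX r f z - f z‖ₑ ≤ ‖avgX r f z - f z + (avgX r f z - f z)‖ₑ := by
    rw [Real.enorm_eq_ofReal_abs, Real.enorm_eq_ofReal_abs, ← two_mul, abs_mul, abs_two]
    exact ENNReal.ofReal_le_ofReal (by linarith [abs_nonneg (avgX r f z - f z)])
  refine hle.trans ?_
  rw [hsum]
  refine (enorm_integral_le_lintegral_enorm _).trans ?_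
  have hmeas : Measurable fun p : Space N × ℝ =>
      ENNReal.ofReal (kernel p.1 * (1 + ‖p.1‖ ^ 2)) * F₂ (z - ((p.2 * r) • p.1, 0)) := by
    have := (continuous_kernel (N := N)).measurable
    fun_prop
  calc ∫⁻ y : Space N, ‖kernel y • (f (z - (r • y, 0)) + f (z + (r • y, 0)) - 2 * f z)‖ₑ
      ≤ ∫⁻ y : Space N, ∫⁻ s in Ioc (-1 : ℝ) 1, ENNReal.ofReal (r ^ 2) *
          (ENNReal.ofReal (kernel y * (1 + ‖y‖ ^ 2)) * F₂ (z - ((s * r) • y, 0))) := by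
        refine lintegral_mono fun y => ?_
        rw [enorm_smul, Real.enorm_of_nonneg (kernel_pos y).le]
        refine (mul_le_mul_right (enorm_second_difference_le hf z (r • y, 0)) _).trans ?_
        rw [← lintegral_const_mul' _ _ ENNReal.ofReal_ne_top]
        refine lintegral_mono fun s => ?_
        have e : z - s • ((r • y, 0) : SpaceTime N) = z - ((s * r) • y, 0) := by
          simp [mul_smul]
        rw [e]
        refine (mul_le_mul_right (hb (r • y) _) _).trans ?_
        rw [← mul_assoc, ← ENNReal.ofReal_mul (kernel_pos y).le, ← mul_assoc,
          ← ENNReal.ofReal_mul (by positivity)]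
        refine mul_le_mul_left (ENNReal.ofReal_le_ofReal ?_) _
        rw [norm_smul, mul_pow, Real.norm_of_nonneg hr.le]
        have := mul_pos (kernel_pos y) (pow_pos hr 2)
        nlinarith
    _ = ENNReal.ofReal (r ^ 2) * ∫⁻ s in Ioc (-1 : ℝ) 1, ∫⁻ y : Space N,
          ENNReal.ofReal (kernel y * (1 + ‖y‖ ^ 2)) * F₂ (z - ((s * r) • y, 0)) := by
        rw [lintegral_lintegral_swap (hmeas.const_mul _).aemeasurable,
          ← lintegral_const_mul' _ _ ENNReal.ofReal_ne_top]
        refine lintegral_congr fun s => ?_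
        rw [← lintegral_const_mul' _ _ ENNReal.ofReal_ne_top]
    _ ≤ ENNReal.ofReal (r ^ 2) * ∫⁻ s in Ioc (-1 : ℝ) 1, dominationConst N * maximalX F₂ z := by
        gcongr ENNReal.ofReal (r ^ 2) * ?_
        refine lintegral_mono_ae ?_
        have h0 : ∀ᵐ s : ℝ ∂volume.restrict (Ioc (-1 : ℝ) 1), s ≠ 0 :=
          ae_restrict_of_ae (Measure.ae_ne volume 0)
        filter_upwards [h0] with s hs
        exact lintegral_kernel_bracket_mul_le hF₂ (mul_ne_zero hs hr.ne') z
    _ = _ := by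
        rw [setLIntegral_const, Real.volume_Ioc]
        norm_num
        ring

lemma maximalX_const (c : ℝ≥0∞) (z : SpaceTime N) : maximalX (fun _ => c) z = c := by
  simp [maximalX, maximalFn, ballMean_const]

/-- The average at the dyadic scale `2^{-j}`. -/
def dyadicAvg (j : ℕ) (F : SpaceTime N → ℝ) : SpaceTime N → ℝ := avgX ((2 : ℝ) ^ j)⁻¹ F

lemma scale_pos (j : ℕ) : (0 : ℝ) < ((2 : ℝ) ^ j)⁻¹ := by positivity

lemma scale_sq (j : ℕ) : (((2 : ℝ) ^ j)⁻¹) ^ 2 = ((4 : ℝ) ^ j)⁻¹ := by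
  rw [inv_pow, ← pow_mul, mul_comm, pow_mul]; norm_num

lemma exists_hessianBound_const {f : SpaceTime N → ℝ} (hf : BddC2 f) :
    ∃ B : ℝ, 0 ≤ B ∧ HessianBound f fun _ => ENNReal.ofReal B := by
  obtain ⟨B, hB⟩ := hf.one.one.bounded
  have hB0 : 0 ≤ B := (norm_nonneg _).trans (hB 0)
  refine ⟨B, hB0, fun v z => ?_⟩
  rw [← ENNReal.ofReal_mul (by positivity), Real.enorm_eq_ofReal_abs]
  refine ENNReal.ofReal_le_ofReal ?_
  have h1 : dirDeriv ((v, 0) : SpaceTime N) (dirDeriv (v, 0) f) z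
      = fderiv ℝ (fderiv ℝ f) z (v, 0) (v, 0) := by
    have := ((ContinuousLinearMap.apply ℝ ℝ ((v, 0) : SpaceTime N)).hasFDerivAt.comp z
      (hf.one.differentiable z).hasFDerivAt).fderiv
    unfold dirDeriv
    erw [this]
    rfl
  have hn : ‖((v, 0) : SpaceTime N)‖ = ‖v‖ := by simp [Prod.norm_def]
  rw [h1]
  refine ((fderiv ℝ (fderiv ℝ f) z (v, 0)).le_opNorm _).trans ?_
  refine (mul_le_mul_of_nonneg_right ((fderiv ℝ (fderiv ℝ f) z).le_opNorm _)
    (norm_nonneg _)).trans ?_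
  rw [hn]
  have := mul_le_mul_of_nonneg_right (hB z) (sq_nonneg ‖v‖)
  nlinarith

/-- Averaging twice at small scales changes a function little. -/
lemma exists_dyadicAvg_close {f : SpaceTime N → ℝ} (hf : BddC2 f) {ε : ℝ} (hε : 0 < ε) :
    ∃ J : ℕ, ∀ z, |dyadicAvg J (dyadicAvg (J + 1) f) z - f z| ≤ ε := by
  -- A purely qualitative bound by a constant. It only serves to choose J, which may depend on f
  -- because no later constant depends on J.
  obtain ⟨B, hB0, hB⟩ := exists_hessianBound_const hf
  set D := (dominationConst N).toReal
  have hD : dominationConst N = ENNReal.ofReal D := (ENNReal.ofReal_toReal dominationConst_ne_top).symm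
  have hD0 : 0 ≤ D := ENNReal.toReal_nonneg
  have h1 : ∀ (j : ℕ) z, |dyadicAvg j f z - f z| ≤ 2 * D * B * (4⁻¹) ^ j := by
    intro j z
    have := enorm_avgX_sub_le hf measurable_const hB (scale_pos j) z
    rw [maximalX_const, hD, Real.enorm_eq_ofReal_abs, scale_sq, ← ENNReal.ofReal_mul hD0,
      show (2 : ℝ≥0∞) = ENNReal.ofReal 2 by simp, ← ENNReal.ofReal_mul (by norm_num),
      ← ENNReal.ofReal_mul (by positivity), ENNReal.ofReal_le_ofReal_iff (by positivity)] at this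
    refine this.trans (le_of_eq ?_)
    rw [inv_pow]; ring
  have h2 : Filter.Tendsto (fun j : ℕ => 4 * D * B * (4⁻¹ : ℝ) ^ j) Filter.atTop (nhds 0) := by
    simpa using (tendsto_pow_atTop_nhds_zero_of_lt_one (by norm_num : (0 : ℝ) ≤ 4⁻¹)
      (by norm_num)).const_mul (4 * D * B)
  obtain ⟨J, hJ⟩ := (h2.eventually_lt_const hε).exists
  refine ⟨J, fun z => ?_⟩
  have hA : BddC0 fun z => dyadicAvg (J + 1) f z - f z := (hf.zero.avgX _).sub hf.zero
  have e : dyadicAvg J (dyadicAvg (J + 1) f) z - f z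
      = avgX ((2 : ℝ) ^ J)⁻¹ (fun z => dyadicAvg (J + 1) f z - f z) z + (dyadicAvg J f z - f z) := by
    simp only [dyadicAvg]
    rw [avgX_sub (hf.zero.avgX _) hf.zero]
    ring
  rw [e]
  refine (abs_add_le _ _).trans ?_
  have h3 : |avgX ((2 : ℝ) ^ J)⁻¹ (fun z => dyadicAvg (J + 1) f z - f z) z|
      ≤ 2 * D * B * (4⁻¹) ^ J := by
    rw [← Real.norm_eq_abs]
    refine (norm_avgX_le _ _ _).trans ?_
    unfold avgX
    have hc : ∫ y : Space N, kernel y • (2 * D * B * (4⁻¹) ^ J) = 2 * D * B * (4⁻¹) ^ J := by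
      rw [integral_smul_const, integral_kernel, one_smul]
    rw [← hc]
    refine integral_mono (hA.norm.integrable_avg _ z) (integrable_kernel.smul_const _) fun y => ?_
    refine mul_le_mul_of_nonneg_left ((h1 _ _).trans ?_) (kernel_pos y).le
    rw [pow_succ]
    have : 0 ≤ 2 * D * B * (4⁻¹ : ℝ) ^ J := by positivity
    nlinarith
  have h4 := h1 J z
  linarith

end Approximation

/-! ### Truncation of functions in `W^{2,1}_{a,b}` -/

section Truncation

variable {N : ℕ}

/-- A smooth version of the absolute value. -/
def softAbs (s : ℝ) : ℝ := √(1 + s ^ 2) - 1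

lemma contDiff_softAbs : ContDiff ℝ 2 softAbs := by
  unfold softAbs
  refine ContDiff.sub (ContDiff.sqrt (by fun_prop) fun s => ?_) contDiff_const
  positivity

lemma softAbs_nonneg (s : ℝ) : 0 ≤ softAbs s := by
  unfold softAbs
  rw [sub_nonneg, Real.one_le_sqrt]
  linarith [sq_nonneg s]

lemma softAbs_le_abs (s : ℝ) : softAbs s ≤ |s| := by
  unfold softAbs
  rw [sub_le_iff_le_add, Real.sqrt_le_left (by positivity)]
  nlinarith [abs_nonneg s, sq_abs s]

lemma abs_le_softAbs_add_one (s : ℝ) : |s| ≤ softAbs s + 1 := by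
  unfold softAbs
  rw [sub_add_cancel]
  exact Real.abs_le_sqrt (by linarith)

lemma abs_deriv_softAbs_le (s : ℝ) : |deriv softAbs s| ≤ 1 := by
  have h1 : HasDerivAt (fun s : ℝ => 1 + s ^ 2) (2 * s) s := by
    simpa using (hasDerivAt_pow 2 s).const_add 1
  have h2 := (h1.sqrt (by positivity)).sub_const 1
  have hs : 0 < √(1 + s ^ 2) := Real.sqrt_pos.2 (by positivity)
  have h3 : deriv softAbs s = 2 * s / (2 * √(1 + s ^ 2)) := h2.deriv
  rw [h3, mul_div_mul_left _ _ two_ne_zero, abs_div, abs_of_pos hs, div_le_one hs]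
  exact Real.abs_le_sqrt (by linarith)

/-- The dyadic pieces of `f`. -/
def dyadicPiece (f : SpaceTime N → ℝ) : ℕ → SpaceTime N → ℝ
  | 0 => dyadicAvg 1 f
  | j + 1 => fun z => dyadicAvg (j + 2) f z - dyadicAvg j f z

/-- A smooth local mean of the absolute value of the dyadic pieces of `f`. -/
def pieceMean (f : SpaceTime N → ℝ) (j : ℕ) : SpaceTime N → ℝ :=
  dyadicAvg j fun z => softAbs (dyadicPiece f j z)

/-- The mollification of `f` at scale `2^{-J}`. -/
def mollified (f : SpaceTime N → ℝ) (J : ℕ) : SpaceTime N → ℝ :=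
  dyadicAvg J (dyadicAvg (J + 1) f)

variable {f : SpaceTime N → ℝ}

lemma BddC2.dyadicAvg (hf : BddC2 f) (j : ℕ) : BddC2 (dyadicAvg j f) := hf.avgX _

lemma BddC2.dyadicPiece (hf : BddC2 f) : ∀ j, BddC2 (dyadicPiece f j)
  | 0 => hf.dyadicAvg 1
  | j + 1 => (hf.dyadicAvg (j + 2)).sub (hf.dyadicAvg j)

lemma BddC2.pieceMean (hf : BddC2 f) (j : ℕ) : BddC2 (pieceMean f j) :=
  ((hf.dyadicPiece j).comp_real contDiff_softAbs).dyadicAvg j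

lemma BddC2.mollified (hf : BddC2 f) (J : ℕ) : BddC2 (mollified f J) :=
  (hf.dyadicAvg _).dyadicAvg _

/-- Averages commute, so A_{J+1}A_{J+2}f - A_J A_{J+1}f = A_{J+1}(A_{J+2}f - A_J f). This is why
pieces skip one scale: each piece then appears under an average of its own scale, the same as in
`pieceMean`. -/
lemma mollified_succ (hf : BddC2 f) (J : ℕ) (z : SpaceTime N) :
    mollified f (J + 1) z = mollified f J z + dyadicAvg (J + 1) (dyadicPiece f (J + 1)) z := by
  have h1 : dyadicAvg (J + 1) (dyadicPiece f (J + 1)) z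
      = dyadicAvg (J + 1) (dyadicAvg (J + 2) f) z - dyadicAvg (J + 1) (dyadicAvg J f) z :=
    avgX_sub (hf.dyadicAvg (J + 2)).zero (hf.dyadicAvg J).zero _ z
  have h2 : mollified f J z = dyadicAvg (J + 1) (dyadicAvg J f) z := avgX_comm hf.zero _ _ z
  rw [h1, h2, mollified]
  ring

/-- The local mean of the absolute value of a dyadic piece. -/
def pieceAbs (f : SpaceTime N → ℝ) (j : ℕ) : SpaceTime N → ℝ :=
  dyadicAvg j fun z => |dyadicPiece f j z|

lemma pieceMean_le_pieceAbs (hf : BddC2 f) (j : ℕ) (z : SpaceTime N) :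
    pieceMean f j z ≤ pieceAbs f j z :=
  avgX_mono ((hf.dyadicPiece j).zero.comp_real contDiff_softAbs.continuous)
    (hf.dyadicPiece j).zero.abs _ (fun _ => softAbs_le_abs _) z

lemma pieceAbs_le (hf : BddC2 f) (j : ℕ) (z : SpaceTime N) :
    pieceAbs f j z ≤ pieceMean f j z + 1 := by
  have hs := (hf.dyadicPiece j).zero.comp_real contDiff_softAbs.continuous
  have h1 : BddC0 fun _ : SpaceTime N => (1 : ℝ) := ⟨continuous_const, 1, by simp⟩
  have h := avgX_mono (hf.dyadicPiece j).zero.abs (hs.add h1) ((2 : ℝ) ^ j)⁻¹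
    (fun _ => abs_le_softAbs_add_one _) z
  rwa [avgX_add_const hs] at h

lemma abs_softAbs_comp (F : SpaceTime N → ℝ) :
    (fun z => |softAbs (F z)|) = fun z => softAbs (F z) :=
  funext fun _ => abs_of_nonneg (softAbs_nonneg _)

lemma abs_dirDeriv_pieceMean_le (hf : BddC2 f) (j : ℕ) {v : Space N} (hv : ‖v‖ ≤ 1)
    (z : SpaceTime N) :
    |dirDeriv (v, 0) (pieceMean f j) z| ≤ kernelConst N * 2 ^ j * pieceMean f j z := by
  have := abs_dirDeriv_avgX_le ((hf.dyadicPiece j).comp_real contDiff_softAbs).toBddC1 hv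
    (scale_pos j) z
  rwa [abs_softAbs_comp, inv_inv] at this

lemma abs_dirDeriv_dirDeriv_pieceMean_le (hf : BddC2 f) (j : ℕ) {v : Space N} (hv : ‖v‖ ≤ 1)
    (z : SpaceTime N) :
    |dirDeriv (v, 0) (dirDeriv (v, 0) (pieceMean f j)) z|
      ≤ kernelConst N * 4 ^ j * pieceMean f j z := by
  have := abs_dirDeriv_dirDeriv_avgX_le ((hf.dyadicPiece j).comp_real contDiff_softAbs) hv
    (scale_pos j) z
  rw [abs_softAbs_comp, inv_inv, ← pow_mul, mul_comm j, pow_mul] at this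
  norm_num at this
  exact this

lemma abs_dirDeriv_mollified_le (hf : BddC2 f) {v : Space N} (hv : ‖v‖ ≤ 1) (z : SpaceTime N)
    (J : ℕ) : |dirDeriv (v, 0) (mollified f J) z|
      ≤ kernelConst N * ∑ j ∈ Finset.range (J + 1), 2 ^ j * pieceAbs f j z := by
  have hpiece : ∀ j, |dirDeriv (v, 0) (dyadicAvg j (dyadicPiece f j)) z|
      ≤ kernelConst N * (2 ^ j * pieceAbs f j z) := by
    intro j
    have := abs_dirDeriv_avgX_le (hf.dyadicPiece j).toBddC1 hv (scale_pos j) z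
    rwa [inv_inv, mul_assoc] at this
  induction J with
  | zero => simpa [mollified, dyadicPiece] using hpiece 0
  | succ J ih =>
    have e : mollified f (J + 1)
        = fun z => mollified f J z + dyadicAvg (J + 1) (dyadicPiece f (J + 1)) z :=
      funext (mollified_succ hf J)
    rw [e, dirDeriv_add _ _ ((hf.mollified J).differentiable z)
      (((hf.dyadicPiece (J + 1)).dyadicAvg (J + 1)).differentiable z), Finset.sum_range_succ, mul_add]
    exact (abs_add_le _ _).trans (add_le_add ih (hpiece (J + 1)))

/-- A dyadic sum whose terms are bounded by both a growing and a decaying geometric sequence. -/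
lemma sum_two_pow_mul_le {α : ℕ → ℝ} {y : ℝ} (hy : 0 ≤ y) (n : ℕ)
    (h4 : ∀ j < n, α j ≤ 4) (hα : ∀ j < n, α j ≤ (4 ^ j)⁻¹ * y ^ 2) :
    ∑ j ∈ Finset.range n, 2 ^ j * α j ≤ 17 * y := by
  -- The bound α ≤ 4 is used while 2^m is below 2y, the decaying bound afterwards.
  have htriv : ∀ m ≤ n, ∑ j ∈ Finset.range m, 2 ^ j * α j ≤ 4 * 2 ^ m := by
    intro m hm
    induction m with
    | zero => simp
    | succ m ih =>
      rw [Finset.sum_range_succ, pow_succ]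
      have h1 := ih (by omega)
      have h2 := mul_le_mul_of_nonneg_left (h4 m (by omega)) (pow_nonneg (zero_le_two (α := ℝ)) m)
      linarith
  -- When 2^m first passes 2y the sum is below 16y by the trivial bound, and the reserve 2y²/2^m is
  -- at most y; hence 17. Each later term, at most y²/2^m, is paid for by halving the reserve.
  have main : ∀ m ≤ n, 2 ^ m < 2 * y ∨
      ∑ j ∈ Finset.range m, 2 ^ j * α j ≤ 17 * y - 2 * y ^ 2 * (2 ^ m)⁻¹ := by
    intro m hm
    induction m with
    | zero =>
      by_cases h : 1 < 2 * y
      · left; simpa using h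
      · right
        simp only [Finset.range_zero, Finset.sum_empty, pow_zero, inv_one, mul_one]
        nlinarith
    | succ m ih =>
      have hp : (0 : ℝ) < 2 ^ m := by positivity
      have hinv : ((2 : ℝ) ^ (m + 1))⁻¹ = (2 ^ m)⁻¹ / 2 := by rw [pow_succ, mul_inv]; ring
      rcases ih (by omega) with h | h
      · by_cases h' : (2 : ℝ) ^ (m + 1) < 2 * y
        · exact Or.inl h'
        · right
          have h1 := htriv (m + 1) hm
          have h2 : y ≤ 2 ^ m := by rw [pow_succ] at h'; linarith
          have h3 : y ^ 2 * (2 ^ m)⁻¹ ≤ y := by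
            rw [mul_inv_le_iff₀ hp]; nlinarith
          rw [hinv]
          rw [pow_succ] at h1
          linarith
      · right
        rw [Finset.sum_range_succ, hinv]
        have h1 : 2 ^ m * α m ≤ y ^ 2 * (2 ^ m)⁻¹ := by
          refine (mul_le_mul_of_nonneg_left (hα m (by omega)) hp.le).trans (le_of_eq ?_)
          have : (4 : ℝ) ^ m = 2 ^ m * 2 ^ m := by rw [← mul_pow]; norm_num
          rw [this]
          field_simp
        linarith
  rcases main n le_rfl with h | h
  · linarith [htriv n le_rfl]
  · have : 0 ≤ 2 * y ^ 2 * ((2 : ℝ) ^ n)⁻¹ := by positivity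
    linarith

/-- The function controlling a truncation and its space derivatives. -/
def spaceControl (f : SpaceTime N → ℝ) (F₂ : SpaceTime N → ℝ≥0∞) (z : SpaceTime N) : ℝ≥0∞ :=
  maximalX (maximalX F₂) z + maximalX (maximalX fun z => ‖f z‖ₑ) z

/-- The function controlling the time derivative of a truncation. -/
def timeControl (f : SpaceTime N → ℝ) : SpaceTime N → ℝ≥0∞ :=
  maximalX (maximalX fun z => ‖dirDeriv (0, 1) f z‖ₑ)

lemma enorm_dyadicAvg_le {F : SpaceTime N → ℝ} (hF : Continuous F) (j : ℕ) (z : SpaceTime N) :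
    ‖dyadicAvg j F z‖ₑ ≤ dominationConst N * maximalX (fun z => ‖F z‖ₑ) z :=
  enorm_avgX_le hF (scale_pos j).ne' z

lemma enorm_dyadicAvg_le_of_le {F : SpaceTime N → ℝ} (hF : Continuous F) (j : ℕ)
    {H : SpaceTime N → ℝ≥0∞} (hH : Measurable H) {c : ℝ≥0∞} (h : ∀ z, ‖F z‖ₑ ≤ c * H z)
    (z : SpaceTime N) :
    ‖dyadicAvg j F z‖ₑ ≤ dominationConst N * c * maximalX H z := by
  refine (enorm_dyadicAvg_le hF j z).trans ?_
  rw [mul_assoc, ← maximalX_const_mul hH]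
  gcongr
  exact maximalX_mono h z

lemma enorm_dyadicAvg_dyadicAvg_le {F : SpaceTime N → ℝ} (hF : BddC0 F) (i j : ℕ)
    (z : SpaceTime N) :
    ‖dyadicAvg i (dyadicAvg j F) z‖ₑ
      ≤ dominationConst N ^ 2 * maximalX (maximalX fun z => ‖F z‖ₑ) z := by
  rw [sq]
  exact enorm_dyadicAvg_le_of_le (hF.avgX _).continuous i
    (measurable_maximalX hF.continuous.enorm.measurable) (enorm_dyadicAvg_le hF.continuous j) z

variable {F₂ : SpaceTime N → ℝ≥0∞}

/-- Both averages are compared with f. The factor is 2(4^{-(j+2)} + 4^{-j}) = 8.5 · 4^{-(j+1)},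
rounded up to 16. -/
lemma enorm_dyadicPiece_succ_le (hf : BddC2 f) (hF₂ : Measurable F₂) (hb : HessianBound f F₂)
    (j : ℕ) (z : SpaceTime N) :
    ‖dyadicPiece f (j + 1) z‖ₑ
      ≤ (16 * ENNReal.ofReal ((4 ^ (j + 1))⁻¹) * dominationConst N) * maximalX F₂ z := by
  have h1 := enorm_avgX_sub_le hf hF₂ hb (scale_pos (j + 2)) z
  have h2 := enorm_avgX_sub_le hf hF₂ hb (scale_pos j) z
  rw [scale_sq] at h1 h2
  have e : dyadicPiece f (j + 1) z = (dyadicAvg (j + 2) f z - f z) - (dyadicAvg j f z - f z) := by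
    simp only [dyadicPiece]; ring
  rw [e]
  refine enorm_sub_le.trans ((add_le_add h1 h2).trans ?_)
  rw [← add_mul, ← mul_add, ← ENNReal.ofReal_add (by positivity) (by positivity), mul_assoc (16 * _)]
  refine mul_le_mul_left ?_ _
  rw [show (2 : ℝ≥0∞) = ENNReal.ofReal 2 by simp, show (16 : ℝ≥0∞) = ENNReal.ofReal 16 by simp,
    ← ENNReal.ofReal_mul (by norm_num), ← ENNReal.ofReal_mul (by norm_num)]
  refine ENNReal.ofReal_le_ofReal ?_
  have hp : (0 : ℝ) < (4 ^ j)⁻¹ := by positivity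
  rw [pow_add, pow_add, mul_inv, mul_inv]
  norm_num
  linarith

/-- The piece of index 0 is an average of f and not a difference, so it has no second-order
cancellation; it accounts for the term in |f| in `spaceControl`. -/
lemma ofReal_pieceAbs_le (hf : BddC2 f) (hF₂ : Measurable F₂) (hb : HessianBound f F₂)
    (j : ℕ) (z : SpaceTime N) :
    ENNReal.ofReal (pieceAbs f j z)
      ≤ ENNReal.ofReal ((4 ^ j)⁻¹) * (16 * dominationConst N ^ 2 * spaceControl f F₂ z) := by
  have h0 : 0 ≤ pieceAbs f j z := avgX_nonneg (fun _ => abs_nonneg _) _ z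
  rw [← Real.enorm_of_nonneg h0]
  have hc := (hf.dyadicPiece j).zero.continuous.abs
  rcases j with _ | j
  · refine (enorm_dyadicAvg_le_of_le hc 0 (measurable_maximalX hf.zero.continuous.enorm.measurable)
      (c := dominationConst N) (fun z => ?_) z).trans ?_
    · rw [Real.enorm_abs]
      exact enorm_dyadicAvg_le hf.zero.continuous 1 z
    · simp only [pow_zero, inv_one, ENNReal.ofReal_one, one_mul, spaceControl]
      calc _ = 1 * dominationConst N ^ 2 * maximalX (maximalX fun z => ‖f z‖ₑ) z := by ring
        _ ≤ _ := mul_le_mul' (mul_le_mul_left (by norm_num) _) le_add_self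
  · refine (enorm_dyadicAvg_le_of_le hc (j + 1) (measurable_maximalX hF₂)
      (c := 16 * ENNReal.ofReal ((4 ^ (j + 1))⁻¹) * dominationConst N) (fun z => ?_) z).trans ?_
    · rw [Real.enorm_abs]
      exact enorm_dyadicPiece_succ_le hf hF₂ hb j z
    · calc _ = ENNReal.ofReal ((4 ^ (j + 1))⁻¹) * (16 * dominationConst N ^ 2
            * maximalX (maximalX F₂) z) := by ring
        _ ≤ _ := by
            gcongr
            exact le_self_add

/-- A constant in the truncation estimates. -/
def truncConst (N : ℕ) : ℝ := 20 * kernelConst N + 1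

/-- The truncation of `f` at scale `2^{-J}`. -/
def smoothTrunc (f : SpaceTime N → ℝ) (J : ℕ) : SpaceTime N → ℝ :=
  truncation (pieceMean f) (J + 1) (mollified f J)

/-- The single number Y dominates 4^j A_j|p_j| for all j, the mollification and its second
derivatives, which is all that `truncation_bounds` asks for once the gradient is summed over scales.
-/
lemma smoothTrunc_space_bounds (hf : BddC2 f) (hF₂ : Measurable F₂) (hb : HessianBound f F₂)
    {S : ℝ} (hS : ∀ s, |deriv Real.smoothTransition s| ≤ S)
    (hS' : ∀ s, |deriv (deriv Real.smoothTransition) s| ≤ S) (J : ℕ) {v : Space N} (hv : ‖v‖ ≤ 1)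
    {z : SpaceTime N} (hz : spaceControl f F₂ z ≠ ∞) :
    let Y := (16 * dominationConst N ^ 2 * spaceControl f F₂ z).toReal
    let C := truncConst N
    |smoothTrunc f J z| ≤ Y ∧ |dirDeriv (v, 0) (smoothTrunc f J) z| ≤ S * C * Y ∧
      |dirDeriv (v, 0) (dirDeriv (v, 0) (smoothTrunc f J)) z|
        ≤ (S * C ^ 2 + S * (3 * C + 12 * S * C ^ 2)) * Y := by
  intro Y C
  have hfin : 16 * dominationConst N ^ 2 * spaceControl f F₂ z ≠ ∞ :=
    ENNReal.mul_ne_top (ENNReal.mul_ne_top (by simp) (ENNReal.pow_ne_top dominationConst_ne_top)) hz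
  have hY : 0 ≤ Y := ENNReal.toReal_nonneg
  have hYeq : 16 * dominationConst N ^ 2 * spaceControl f F₂ z = ENNReal.ofReal Y :=
    (ENNReal.ofReal_toReal hfin).symm
  have hk := kernelConst_nonneg (N := N)
  have hC : 0 ≤ C := by simp only [C, truncConst]; positivity
  have hα : ∀ j, pieceAbs f j z ≤ (4 ^ j)⁻¹ * Y := by
    intro j
    have := ofReal_pieceAbs_le hf hF₂ hb j z
    rwa [hYeq, ← ENNReal.ofReal_mul (by positivity),
      ENNReal.ofReal_le_ofReal_iff (by positivity)] at this
  have hle : ∀ {x : ℝ} {G : ℝ≥0∞}, ‖x‖ₑ ≤ dominationConst N ^ 2 * G → G ≤ spaceControl f F₂ z →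
      |x| ≤ Y := by
    intro x G h1 h2
    rw [← ENNReal.ofReal_le_ofReal_iff hY, ← Real.enorm_eq_ofReal_abs, ← hYeq]
    refine h1.trans ?_
    gcongr
    exact le_mul_of_one_le_left zero_le (by norm_num)
  have hfY : |mollified f J z| ≤ Y :=
    hle (enorm_dyadicAvg_dyadicAvg_le hf.zero _ _ z) le_add_self
  have hf2Y : |dirDeriv (v, 0) (dirDeriv (v, 0) (mollified f J)) z| ≤ Y := by
    refine hle (G := maximalX (maximalX F₂) z) ?_ le_self_add
    have e : dirDeriv (v, 0) (dirDeriv (v, 0) (mollified f J))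
        = dyadicAvg J (dyadicAvg (J + 1) (dirDeriv (v, 0) (dirDeriv (v, 0) f))) := by
      unfold mollified dyadicAvg
      rw [(hf.avgX _).toBddC1.dirDeriv_avgX, hf.toBddC1.dirDeriv_avgX,
        ((hf.dirDeriv _).avgX _).dirDeriv_avgX, (hf.dirDeriv _).dirDeriv_avgX]
    rw [e]
    refine (enorm_dyadicAvg_dyadicAvg_le ((hf.dirDeriv _).dirDeriv _) _ _ z).trans ?_
    gcongr
    refine maximalX_mono (fun z => maximalX_mono (fun z => (hb v z).trans ?_) z) z
    refine mul_le_of_le_one_left zero_le ?_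
    rw [ENNReal.ofReal_le_one]
    exact pow_le_one₀ (norm_nonneg _) hv
  refine truncation_bounds (fun j => (hf.pieceMean j).contDiff) (J + 1) (hf.mollified J).contDiff
    hC hS hS' hY ?_ ?_ ?_ ?_ ?_ ?_
  · intro j _ h3
    refine (abs_dirDeriv_pieceMean_le hf j hv z).trans ?_
    calc _ ≤ kernelConst N * 2 ^ j * 3 := by gcongr
      _ ≤ C * 2 ^ j := by
          have : 0 ≤ (2 : ℝ) ^ j := by positivity
          have : 0 ≤ kernelConst N * (2 : ℝ) ^ j := by positivity
          simp only [C, truncConst]; linarith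
  · intro j _ h3
    refine (abs_dirDeriv_dirDeriv_pieceMean_le hf j hv z).trans ?_
    calc _ ≤ kernelConst N * 4 ^ j * 3 := by gcongr
      _ ≤ C * 4 ^ j := by
          have : 0 ≤ (4 : ℝ) ^ j := by positivity
          have : 0 ≤ kernelConst N * (4 : ℝ) ^ j := by positivity
          simp only [C, truncConst]; linarith
  -- Activity: 1 < h_j ≤ A_j|p_j| ≤ 4^{-j} Y.
  · intro j _ h1
    have h2 := (h1.trans_le (pieceMean_le_pieceAbs hf j z)).le.trans (hα j)
    rwa [← div_eq_inv_mul, one_le_div (by positivity)] at h2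
  -- Since A_j|p_j| ≤ h_j + 1 ≤ 4, the dyadic sum bounding the gradient is at most 17√Y.
  · intro h3
    have hsum := sum_two_pow_mul_le (α := fun j => pieceAbs f j z) (Real.sqrt_nonneg Y) (J + 1)
      (fun j hj => (pieceAbs_le hf j z).trans (by linarith [h3 j hj]))
      (fun j _ => by rw [Real.sq_sqrt hY]; exact hα j)
    have h4 : |dirDeriv (v, 0) (mollified f J) z| ≤ C * √Y := by
      refine (abs_dirDeriv_mollified_le hf hv z J).trans ?_
      refine (mul_le_mul_of_nonneg_left hsum hk).trans ?_
      have := Real.sqrt_nonneg Y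
      have : 0 ≤ kernelConst N * √Y := by positivity
      simp only [C, truncConst]; linarith
    calc _ = |dirDeriv (v, 0) (mollified f J) z| ^ 2 := (sq_abs _).symm
      _ ≤ (C * √Y) ^ 2 := by gcongr
      _ = _ := by rw [mul_pow, Real.sq_sqrt hY]
  · refine hf2Y.trans ?_
    have : 0 ≤ kernelConst N * Y := by positivity
    simp only [C, truncConst]; linarith
  · intro h1
    exact (h1.le.trans (le_abs_self _)).trans hfY

/-! ### Time derivative of the truncation -/

lemma dirDeriv_dyadicPiece (hf : BddC2 f) (e : SpaceTime N) :
    ∀ j, dirDeriv e (dyadicPiece f j) = dyadicPiece (dirDeriv e f) j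
  | 0 => hf.toBddC1.dirDeriv_avgX _ e
  | j + 1 => by
    funext z
    simp only [dyadicPiece]
    rw [dirDeriv_sub e z ((hf.dyadicAvg _).differentiable z) ((hf.dyadicAvg _).differentiable z)]
    unfold dyadicAvg
    rw [hf.toBddC1.dirDeriv_avgX, hf.toBddC1.dirDeriv_avgX]

lemma enorm_dyadicPiece_le {F : SpaceTime N → ℝ} (hF : BddC0 F) (j : ℕ) (z : SpaceTime N) :
    ‖dyadicPiece F j z‖ₑ ≤ (2 * dominationConst N) * maximalX (fun z => ‖F z‖ₑ) z := by
  have h := fun i => enorm_dyadicAvg_le hF.continuous i z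
  rcases j with _ | j
  · refine (h 1).trans ?_
    gcongr
    exact le_mul_of_one_le_left zero_le (by norm_num)
  · refine enorm_sub_le.trans ((add_le_add (h _) (h _)).trans (le_of_eq ?_))
    ring

/-- The derivative passes through both averages, and `softAbs` is 1-Lipschitz; the bound is uniform
in j. -/
lemma enorm_dirDeriv_pieceMean_le (hf : BddC2 f) (j : ℕ) (e z : SpaceTime N) :
    ‖dirDeriv e (pieceMean f j) z‖ₑ
      ≤ 2 * dominationConst N ^ 2 * maximalX (maximalX fun z => ‖dirDeriv e f z‖ₑ) z := by
  have hd := hf.dyadicPiece j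
  have hs := hd.comp_real contDiff_softAbs
  have e1 : dirDeriv e (pieceMean f j)
      = dyadicAvg j (dirDeriv e fun z => softAbs (dyadicPiece f j z)) :=
    hs.toBddC1.dirDeriv_avgX _ e
  rw [e1]
  refine (enorm_dyadicAvg_le_of_le (hs.dirDeriv e).zero.continuous j (measurable_maximalX
    (hf.dirDeriv e).zero.continuous.enorm.measurable) (c := 2 * dominationConst N)
    (fun z => ?_) z).trans (le_of_eq (by ring))
  rw [dirDeriv_comp e z (contDiff_softAbs.differentiable (by norm_num) _) (hd.differentiable z),
    enorm_mul, dirDeriv_dyadicPiece hf]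
  refine le_trans ?_ (enorm_dyadicPiece_le (hf.dirDeriv e).zero j z)
  refine mul_le_of_le_one_left zero_le ?_
  rw [Real.enorm_eq_ofReal_abs, ENNReal.ofReal_le_one]
  exact abs_deriv_softAbs_le _

/-- Only a common bound for the time derivatives of the h_j and of the mollification is needed, by
convexity. No square and no space derivative occurs, so the estimate can be used in L^b
independently of a. -/
lemma smoothTrunc_time_bound (hf : BddC2 f) {S : ℝ} (hS0 : 0 < S)
    (hS : ∀ s, |deriv Real.smoothTransition s| ≤ S) (J : ℕ) (z : SpaceTime N) :
    ‖dirDeriv (0, 1) (smoothTrunc f J) z‖ₑ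
      ≤ ENNReal.ofReal S * (2 * dominationConst N ^ 2 + 1) * timeControl f z := by
  by_cases ht : timeControl f z = ∞
  · rw [ht, ENNReal.mul_top (mul_ne_zero (by simpa using hS0) (by simp))]
    exact le_top
  have hfin : (2 * dominationConst N ^ 2 + 1) * timeControl f z ≠ ∞ :=
    ENNReal.mul_ne_top (ENNReal.add_ne_top.2 ⟨ENNReal.mul_ne_top (by simp)
      (ENNReal.pow_ne_top dominationConst_ne_top), by simp⟩) ht
  set X := ((2 * dominationConst N ^ 2 + 1) * timeControl f z).toReal
  have hX : 0 ≤ X := ENNReal.toReal_nonneg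
  have hXeq : (2 * dominationConst N ^ 2 + 1) * timeControl f z = ENNReal.ofReal X :=
    (ENNReal.ofReal_toReal hfin).symm
  rw [mul_assoc, hXeq, ← ENNReal.ofReal_mul hS0.le, Real.enorm_eq_ofReal_abs]
  refine ENNReal.ofReal_le_ofReal (abs_dirDeriv_truncation_le
    (fun j => (hf.pieceMean j).contDiff) (J + 1) (hf.mollified J).contDiff hS hX (fun j => ?_) ?_)
  · rw [← ENNReal.ofReal_le_ofReal_iff hX, ← Real.enorm_eq_ofReal_abs, ← hXeq]
    refine (enorm_dirDeriv_pieceMean_le hf j _ z).trans ?_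
    exact mul_le_mul_left le_self_add _
  · rw [← ENNReal.ofReal_le_ofReal_iff hX, ← Real.enorm_eq_ofReal_abs, ← hXeq]
    have e : dirDeriv (0, 1) (mollified f J)
        = dyadicAvg J (dyadicAvg (J + 1) (dirDeriv (0, 1) f)) := by
      unfold mollified dyadicAvg
      rw [(hf.avgX _).toBddC1.dirDeriv_avgX, hf.toBddC1.dirDeriv_avgX]
    rw [e]
    refine (enorm_dyadicAvg_dyadicAvg_le (hf.dirDeriv _).zero _ _ z).trans ?_
    refine mul_le_mul_left (le_trans ?_ le_self_add) _
    exact le_mul_of_one_le_left zero_le (by norm_num)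

/-- **Smooth truncation.** A function that is at least `4` on a set `A` can be replaced by a
function with values in `[0, 1]` that is `1` on `A`, with control on the derivatives. -/
theorem exists_truncation (N : ℕ) : ∃ C : ℝ≥0∞, C ≠ ∞ ∧ ∀ (f : SpaceTime N → ℝ)
    (F₂ : SpaceTime N → ℝ≥0∞), BddC2 f → Measurable F₂ → HessianBound f F₂ →
    ∃ ψ : SpaceTime N → ℝ, ContDiff ℝ 2 ψ ∧ (∀ z, 0 ≤ ψ z) ∧ (∀ z, ψ z ≤ 1) ∧
      (∀ z, 4 ≤ f z → ψ z = 1) ∧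
      (∀ z, ‖ψ z‖ₑ ≤ C * spaceControl f F₂ z) ∧
      (∀ v : Space N, ‖v‖ ≤ 1 → ∀ z, ‖dirDeriv (v, 0) ψ z‖ₑ ≤ C * spaceControl f F₂ z) ∧
      (∀ v : Space N, ‖v‖ ≤ 1 → ∀ z,
        ‖dirDeriv (v, 0) (dirDeriv (v, 0) ψ) z‖ₑ ≤ C * spaceControl f F₂ z) ∧
      ∀ z, ‖dirDeriv (0, 1) ψ z‖ₑ ≤ C * timeControl f z := by
  obtain ⟨S₀, hS₀, hS₁, hS₂⟩ := exists_smoothTransition_bound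
  -- Strict positivity makes the bounds trivial at points where a control function is infinite.
  set S := S₀ + 1
  have hS0 : 0 < S := by positivity
  have hS : ∀ s, |deriv Real.smoothTransition s| ≤ S := fun s => (hS₁ s).trans (by simp [S])
  have hS' : ∀ s, |deriv (deriv Real.smoothTransition) s| ≤ S :=
    fun s => (hS₂ s).trans (by simp [S])
  set c := truncConst N
  have hc : 0 < c := by
    have := kernelConst_nonneg (N := N)
    simp only [c, truncConst]; positivity
  set R := 1 + S * c + (S * c ^ 2 + S * (3 * c + 12 * S * c ^ 2)) with hR
  have hR1 : 1 ≤ R := by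
    have h1 : 0 ≤ S * c := by positivity
    have h2 : 0 ≤ S * c ^ 2 + S * (3 * c + 12 * S * c ^ 2) := by positivity
    linarith
  have hR2 : S * c ≤ R := by
    have h2 : 0 ≤ S * c ^ 2 + S * (3 * c + 12 * S * c ^ 2) := by positivity
    linarith
  have hR3 : S * c ^ 2 + S * (3 * c + 12 * S * c ^ 2) ≤ R := by
    have h1 : 0 ≤ S * c := by positivity
    linarith
  set D := 16 * dominationConst N ^ 2 + 1 with hD
  have hDfin : 16 * dominationConst N ^ 2 ≠ ∞ :=
    ENNReal.mul_ne_top (by simp) (ENNReal.pow_ne_top dominationConst_ne_top)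
  have hCfin : ENNReal.ofReal R * D ≠ ∞ :=
    ENNReal.mul_ne_top ENNReal.ofReal_ne_top (ENNReal.add_ne_top.2 ⟨hDfin, by simp⟩)
  have hC0 : ENNReal.ofReal R * D ≠ 0 := mul_ne_zero (by simpa using by linarith) (by simp [hD])
  have hC0' : ENNReal.ofReal S * (2 * dominationConst N ^ 2 + 1) ≠ ∞ :=
    ENNReal.mul_ne_top ENNReal.ofReal_ne_top (ENNReal.add_ne_top.2 ⟨ENNReal.mul_ne_top (by simp)
      (ENNReal.pow_ne_top dominationConst_ne_top), by simp⟩)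
  refine ⟨ENNReal.ofReal R * D + ENNReal.ofReal S * (2 * dominationConst N ^ 2 + 1),
    ENNReal.add_ne_top.2 ⟨hCfin, hC0'⟩, ?_⟩
  intro f F₂ hf hF₂ hb
  -- Within error 1, f ≥ 4 gives a mollification of at least 3, and the soft maximum, which loses at
  -- most 2, is then at least 1.
  obtain ⟨J, hJ⟩ := exists_dyadicAvg_close hf one_pos
  have conv : ∀ {x t : ℝ} {z : SpaceTime N}, t ≤ R →
      (spaceControl f F₂ z ≠ ∞ → |x| ≤ t * (16 * dominationConst N ^ 2
        * spaceControl f F₂ z).toReal) →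
      ‖x‖ₑ ≤ (ENNReal.ofReal R * D + ENNReal.ofReal S * (2 * dominationConst N ^ 2 + 1))
        * spaceControl f F₂ z := by
    intro x t z ht hx
    refine le_trans ?_ (mul_le_mul_left le_self_add _)
    by_cases hz : spaceControl f F₂ z = ∞
    · rw [hz, ENNReal.mul_top hC0]; exact le_top
    · have hfin := ENNReal.mul_ne_top hDfin hz
      calc ‖x‖ₑ ≤ ENNReal.ofReal (R * (16 * dominationConst N ^ 2 * spaceControl f F₂ z).toReal) := by
            rw [Real.enorm_eq_ofReal_abs]
            exact ENNReal.ofReal_le_ofReal ((hx hz).trans (by gcongr))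
        _ = ENNReal.ofReal R * (16 * dominationConst N ^ 2) * spaceControl f F₂ z := by
            rw [ENNReal.ofReal_mul (by linarith), ENNReal.ofReal_toReal hfin]; ring
        _ ≤ _ := by
            gcongr
            exact le_self_add
  have hsp := fun (v : Space N) (hv : ‖v‖ ≤ 1) (z : SpaceTime N) (hz : spaceControl f F₂ z ≠ ∞) =>
    smoothTrunc_space_bounds hf hF₂ hb hS hS' J hv hz
  refine ⟨smoothTrunc f J, contDiff_truncation (fun j => (hf.pieceMean j).contDiff) _
    (hf.mollified J).contDiff, truncation_nonneg _ _ _, truncation_le_one _ _ _, ?_, ?_, ?_, ?_, ?_⟩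
  · intro z hz
    refine truncation_eq_one _ _ ?_
    have := (abs_le.1 (hJ z)).1
    show 3 ≤ dyadicAvg J (dyadicAvg (J + 1) f) z
    linarith
  · exact fun z => conv hR1 fun hz => by
      rw [one_mul]; exact (hsp 0 (by simp) z hz).1
  · exact fun v hv z => conv hR2 fun hz => (hsp v hv z hz).2.1
  · exact fun v hv z => conv hR3 fun hz => (hsp v hv z hz).2.2
  · intro z
    refine (smoothTrunc_time_bound hf hS0 hS J z).trans ?_
    exact mul_le_mul_left le_add_self _

end Truncation

/-! ### Bounded potentials of sets of zero capacity -/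

section Potential

variable {N : ℕ}

lemma dirDeriv_spatial (F : SpaceTime N → ℝ) (v : Space N) (z : SpaceTime N) :
    dirDeriv (v, 0) F z = ∑ i, v i * partialX i F z := by
  have hv : ((v, 0) : SpaceTime N)
      = ∑ i, v i • ((EuclideanSpace.single i 1, 0) : SpaceTime N) := by
    refine Prod.ext ?_ ?_
    · ext k
      simp [Prod.fst_sum, Pi.single_apply]
    · simp [Prod.snd_sum]
  unfold dirDeriv partialX
  rw [hv, map_sum]
  simp only [map_smul, smul_eq_mul]

lemma abs_apply_le_norm (v : Space N) (i : Fin N) : |v i| ≤ ‖v‖ := by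
  simpa using PiLp.norm_apply_le v i

/-- The sum of the absolute values of the second derivatives in the space variable. -/
def hessianSum (f : SpaceTime N → ℝ) (z : SpaceTime N) : ℝ :=
  ∑ i : Fin N, ∑ j : Fin N, ‖partialX j (partialX i f) z‖

lemma hessianBound_hessianSum {f : SpaceTime N → ℝ} (hf : BddC2 f) :
    HessianBound f fun z => ‖hessianSum f z‖ₑ := by
  intro v z
  have hd : ∀ i, Differentiable ℝ (partialX i f) := fun i => (hf.dirDeriv _).differentiable
  have h1 : dirDeriv (v, 0) (dirDeriv (v, 0) f) z
      = ∑ j, ∑ i, v j * (v i * partialX j (partialX i f) z) := by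
    rw [show dirDeriv ((v, 0) : SpaceTime N) f = fun z => ∑ i, v i * partialX i f z from
      funext fun z => dirDeriv_spatial f v z, dirDeriv_spatial]
    refine Finset.sum_congr rfl fun j _ => ?_
    rw [← Finset.mul_sum]
    congr 1
    have h2 := fderiv_fun_sum (u := Finset.univ) fun i _ => (hd i z).const_mul (v i)
    rw [partialX, h2, _root_.sum_apply]
    refine Finset.sum_congr rfl fun i _ => ?_
    rw [fderiv_const_mul (hd i z)]
    rfl
  have h2 : ‖dirDeriv (v, 0) (dirDeriv (v, 0) f) z‖ ≤ ‖v‖ ^ 2 * hessianSum f z := by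
    rw [h1, hessianSum, Finset.sum_comm, Finset.mul_sum]
    refine (norm_sum_le _ _).trans (Finset.sum_le_sum fun i _ => ?_)
    rw [Finset.mul_sum]
    refine (norm_sum_le _ _).trans (Finset.sum_le_sum fun j _ => ?_)
    rw [norm_mul, norm_mul, ← mul_assoc, sq]
    refine mul_le_mul_of_nonneg_right ?_ (norm_nonneg _)
    exact mul_le_mul (abs_apply_le_norm v j) (abs_apply_le_norm v i) (norm_nonneg _) (norm_nonneg _)
  beta_reduce
  rw [← ofReal_norm, ← ofReal_norm, ← ENNReal.ofReal_mul (by positivity)]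
  refine ENNReal.ofReal_le_ofReal (h2.trans ?_)
  exact mul_le_mul_of_nonneg_left (Real.le_norm_self _) (by positivity)

lemma BddC2.continuous_partialX_partialX {f : SpaceTime N → ℝ} (hf : BddC2 f) (i j : Fin N) :
    Continuous (partialX j (partialX i f)) :=
  ((hf.dirDeriv (EuclideanSpace.single i 1, 0)).dirDeriv (EuclideanSpace.single j 1, 0)).continuous

lemma BddC2.continuous_hessianSum {f : SpaceTime N → ℝ} (hf : BddC2 f) :
    Continuous (hessianSum f) :=
  continuous_finsetSum _ fun i _ => continuous_finsetSum _ fun j _ =>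
    (hf.continuous_partialX_partialX i j).norm

lemma BddC2.eLpNorm_hessianSum_le {f : SpaceTime N → ℝ} (hf : BddC2 f) {p : ℝ≥0∞} (hp : 1 ≤ p) :
    eLpNorm (hessianSum f) p volume
      ≤ ∑ i : Fin N, ∑ j : Fin N, eLpNorm (partialX j (partialX i f)) p volume := by
  have hm : ∀ i j, AEStronglyMeasurable (fun z => ‖partialX j (partialX i f) z‖) volume :=
    fun i j => (hf.continuous_partialX_partialX i j).norm.aestronglyMeasurable
  have e1 : hessianSum f = ∑ i : Fin N, ∑ j : Fin N, fun z => ‖partialX j (partialX i f) z‖ := by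
    ext z
    simp [hessianSum, Finset.sum_apply]
  rw [e1]
  refine (eLpNorm_sum_le (fun i _ => ?_) hp).trans (Finset.sum_le_sum fun i _ => ?_)
  · exact Finset.aestronglyMeasurable_sum _ fun j _ => hm i j
  refine (eLpNorm_sum_le (fun j _ => hm i j) hp).trans (Finset.sum_le_sum fun j _ => ?_)
  rw [eLpNorm_norm]

lemma dirDeriv_const_smul (e : SpaceTime N) (c : ℝ) (F : SpaceTime N → ℝ) :
    dirDeriv e (c • F) = c • dirDeriv e F := by
  ext z
  simp [dirDeriv, fderiv_const_smul_field]

lemma mixedNorm_parts_le (a b : ℝ) (ha : 1 ≤ a) (φ : 𝓢(SpaceTime N, ℝ)) (c : ℝ) :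
    eLpNorm (c • ⇑φ) (ENNReal.ofReal a) volume ≤ ‖c‖ₑ * mixedNorm a b φ ∧
    eLpNorm (hessianSum (c • ⇑φ)) (ENNReal.ofReal a) volume ≤ ‖c‖ₑ * mixedNorm a b φ ∧
    eLpNorm (dirDeriv (0, 1) (c • ⇑φ)) (ENNReal.ofReal b) volume ≤ ‖c‖ₑ * mixedNorm a b φ := by
  have h1 : BddC2 (⇑(c • φ)) := BddC2.schwartz _
  rw [show ⇑(c • φ) = c • ⇑φ from rfl] at h1
  refine ⟨?_, ?_, ?_⟩
  · rw [eLpNorm_const_smul]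
    refine mul_le_mul_right ?_ _
    unfold mixedNorm
    rw [add_assoc, add_assoc]
    exact le_self_add
  · refine (h1.eLpNorm_hessianSum_le (by simpa using ENNReal.ofReal_le_ofReal ha)).trans ?_
    have h2 : ∀ i j : Fin N, partialX j (partialX i (c • ⇑φ)) = c • partialX j (partialX i φ) := by
      intro i j
      exact (congrArg (dirDeriv _) (dirDeriv_const_smul _ c φ)).trans (dirDeriv_const_smul _ c _)
    simp only [h2, eLpNorm_const_smul]
    simp only [← Finset.mul_sum]
    exact mul_le_mul_right le_add_self _
  · rw [dirDeriv_const_smul, eLpNorm_const_smul]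
    refine mul_le_mul_right ?_ _
    unfold mixedNorm
    rw [add_assoc, add_assoc, add_left_comm]
    exact le_self_add

lemma lintegral_enorm_rpow_eq {F : SpaceTime N → ℝ} {p : ℝ} (hp : 0 < p) :
    ∫⁻ z, ‖F z‖ₑ ^ p = eLpNorm F (ENNReal.ofReal p) volume ^ p := by
  rw [eLpNorm_eq_eLpNorm' (by simpa using hp) ENNReal.ofReal_ne_top, ENNReal.toReal_ofReal hp.le,
    lintegral_rpow_enorm_eq_rpow_eLpNorm' hp]

lemma lintegral_maximalX_maximalX_rpow_le {F : SpaceTime N → ℝ≥0∞} (hF : Measurable F) {p : ℝ}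
    (hp : 1 < p) :
    ∫⁻ z, maximalX (maximalX F) z ^ p ≤ maximalConst N p ^ 2 * ∫⁻ z, F z ^ p := by
  refine (lintegral_maximalX_rpow_le (measurable_maximalX hF) hp).trans ?_
  rw [sq, mul_assoc]
  exact mul_le_mul_right (lintegral_maximalX_rpow_le hF hp) _

lemma exists_pos_forall_mul_rpow_le {c ε : ℝ≥0∞} (hc : c ≠ ∞) (hε : ε ≠ 0) {p : ℝ} (hp : 0 < p) :
    ∃ δ : ℝ≥0∞, δ ≠ 0 ∧ ∀ x ≤ δ, c * x ^ p ≤ ε := by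
  refine ⟨(ε / (c + 1)) ^ p⁻¹, ?_, fun x hx => ?_⟩
  · rw [Ne, ENNReal.rpow_eq_zero_iff]
    simp [hε, hc, hp.le, ENNReal.div_eq_zero_iff]
  · calc c * x ^ p ≤ (c + 1) * ((ε / (c + 1)) ^ p⁻¹) ^ p :=
          mul_le_mul' le_self_add (ENNReal.rpow_le_rpow hx hp.le)
      _ = (c + 1) * (ε / (c + 1)) := by rw [ENNReal.rpow_inv_rpow hp.ne']
      _ ≤ ε := ENNReal.mul_div_le

/-- A compact set of zero capacity has potentials with values in `[0, 1]` of arbitrarily small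
energy. -/
theorem exists_potential {a b : ℝ} (ha : 1 < a) (hb : 1 < b) {K : Set (SpaceTime N)}
    (hK : capCompact a b K = 0) {ε : ℝ≥0∞} (hε : ε ≠ 0) :
    ∃ (ψ : SpaceTime N → ℝ) (G H : SpaceTime N → ℝ≥0∞), ContDiff ℝ 2 ψ ∧ Measurable G ∧
      Measurable H ∧ (∀ z, 0 ≤ ψ z) ∧ (∀ z, ψ z ≤ 1) ∧ (∀ z ∈ K, ψ z = 1) ∧
      (∀ z, ‖ψ z‖ₑ ≤ G z) ∧ (∀ v : Space N, ‖v‖ ≤ 1 → ∀ z, ‖dirDeriv (v, 0) ψ z‖ₑ ≤ G z) ∧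
      (∀ v : Space N, ‖v‖ ≤ 1 → ∀ z, ‖dirDeriv (v, 0) (dirDeriv (v, 0) ψ) z‖ₑ ≤ G z) ∧
      (∀ z, ‖dirDeriv (0, 1) ψ z‖ₑ ≤ H z) ∧ ∫⁻ z, G z ^ a ≤ ε ∧ ∫⁻ z, H z ^ b ≤ ε := by
  obtain ⟨C, hC, htrunc⟩ := exists_truncation N
  have ha0 : 0 < a := by linarith
  have hb0 : 0 < b := by linarith
  have hCa : C ^ a * (2 ^ (a - 1) * (maximalConst N a ^ 2 * 2)) ≠ ∞ := by
    have := maximalConst_ne_top (N := N) ha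
    finiteness
  have hCb : C ^ b * maximalConst N b ^ 2 ≠ ∞ := by
    have := maximalConst_ne_top (N := N) hb
    finiteness
  obtain ⟨δ₁, hδ₁, h₁⟩ := exists_pos_forall_mul_rpow_le hCa hε ha0
  obtain ⟨δ₂, hδ₂, h₂⟩ := exists_pos_forall_mul_rpow_le hCb hε hb0
  obtain ⟨φ, ⟨U, -, hKU, hU⟩, hφ⟩ : ∃ φ : 𝓢(SpaceTime N, ℝ),
      (∃ U, IsOpen U ∧ K ⊆ U ∧ ∀ z ∈ U, 1 ≤ φ z) ∧
        mixedNorm a b φ ^ a < (min δ₁ δ₂ / 4) ^ a := by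
    have : capCompact a b K < (min δ₁ δ₂ / 4) ^ a := by
      rw [hK]
      refine ENNReal.rpow_pos_of_nonneg ?_ ha0.le
      exact ENNReal.div_pos (by simp [hδ₁, hδ₂]) (by simp)
    simpa only [capCompact, iInf_lt_iff, exists_prop] using this
  have hφ' : 4 * mixedNorm a b φ ≤ min δ₁ δ₂ := by
    have := ((ENNReal.rpow_lt_rpow_iff ha0).1 hφ).le
    calc 4 * mixedNorm a b φ ≤ 4 * (min δ₁ δ₂ / 4) := mul_le_mul_right this _
      _ ≤ _ := ENNReal.mul_div_le
  -- The factor 4 turns φ ≥ 1 on K into the threshold of the truncation, and explains the division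
  -- by 4 in the choice of φ.
  set f : SpaceTime N → ℝ := (4 : ℝ) • ⇑φ with hf
  have hfB : BddC2 f := BddC2.schwartz ((4 : ℝ) • φ)
  obtain ⟨p1, p2, p3⟩ := mixedNorm_parts_le a b ha.le φ (4 : ℝ)
  rw [show ‖(4 : ℝ)‖ₑ = 4 by simp [← ofReal_norm]] at p1 p2 p3
  rw [← hf] at p1 p2 p3
  have hm1 : Measurable fun z => ‖f z‖ₑ := hfB.contDiff.continuous.enorm.measurable
  have hm2 : Measurable fun z => ‖hessianSum f z‖ₑ := hfB.continuous_hessianSum.enorm.measurable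
  have hm3 : Measurable fun z => ‖dirDeriv (0, 1) f z‖ₑ :=
    (hfB.toBddC1.dirDeriv (0, 1)).continuous.enorm.measurable
  obtain ⟨ψ, c1, c2, c3, c4, c5, c6, c7, c8⟩ := htrunc f _ hfB hm2 (hessianBound_hessianSum hfB)
  have hM2 := measurable_maximalX (measurable_maximalX hm2)
  have hM1 := measurable_maximalX (measurable_maximalX hm1)
  have hM3 := measurable_maximalX (measurable_maximalX hm3)
  have hM : Measurable fun z => maximalX (maximalX fun z => ‖hessianSum f z‖ₑ) z
      + maximalX (maximalX fun z => ‖f z‖ₑ) z := hM2.add hM1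
  refine ⟨ψ, fun z => C * spaceControl f (fun z => ‖hessianSum f z‖ₑ) z,
    fun z => C * timeControl f z, c1, hM.const_mul C, hM3.const_mul C, c2, c3,
    fun z hz => c4 z ?_, c5, c6, c7, c8, ?_, ?_⟩
  · have := hU z (hKU hz)
    simp only [hf, Pi.smul_apply, smul_eq_mul]
    linarith
  · refine le_trans ?_ (h₁ _ (hφ'.trans (min_le_left _ _)))
    simp only [ENNReal.mul_rpow_of_nonneg C _ ha0.le, spaceControl]
    rw [lintegral_const_mul _ (hM.pow_const a), mul_assoc]
    refine mul_le_mul_right ?_ _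
    calc _ ≤ ∫⁻ z, 2 ^ (a - 1) * (maximalX (maximalX fun z => ‖hessianSum f z‖ₑ) z ^ a
            + maximalX (maximalX fun z => ‖f z‖ₑ) z ^ a) :=
          lintegral_mono fun z => ENNReal.rpow_add_le_mul_rpow_add_rpow _ _ ha.le
      _ = 2 ^ (a - 1) * ((∫⁻ z, maximalX (maximalX fun z => ‖hessianSum f z‖ₑ) z ^ a)
            + ∫⁻ z, maximalX (maximalX fun z => ‖f z‖ₑ) z ^ a) := by
          rw [lintegral_const_mul' _ _ (by finiteness), lintegral_add_left (hM2.pow_const a)]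
      _ ≤ 2 ^ (a - 1) * (maximalConst N a ^ 2 * (4 * mixedNorm a b φ) ^ a
            + maximalConst N a ^ 2 * (4 * mixedNorm a b φ) ^ a) := by
          refine mul_le_mul_right (add_le_add ?_ ?_) _
          · refine (lintegral_maximalX_maximalX_rpow_le hm2 ha).trans (mul_le_mul_right ?_ _)
            rw [lintegral_enorm_rpow_eq ha0]
            exact ENNReal.rpow_le_rpow p2 ha0.le
          · refine (lintegral_maximalX_maximalX_rpow_le hm1 ha).trans (mul_le_mul_right ?_ _)
            rw [lintegral_enorm_rpow_eq ha0]
            exact ENNReal.rpow_le_rpow p1 ha0.le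
      _ = _ := by
          ring
  · refine le_trans ?_ (h₂ _ (hφ'.trans (min_le_right _ _)))
    simp only [ENNReal.mul_rpow_of_nonneg C _ hb0.le, timeControl]
    rw [lintegral_const_mul _ (hM3.pow_const b), mul_assoc]
    refine mul_le_mul_right ?_ _
    refine (lintegral_maximalX_maximalX_rpow_le hm3 hb).trans (mul_le_mul_right ?_ _)
    rw [lintegral_enorm_rpow_eq hb0]
    exact ENNReal.rpow_le_rpow p3 hb0.le

lemma capCompact_eq_zero_of_subset {a b : ℝ} {K E : Set (SpaceTime N)} (hK : IsCompact K)
    (hKE : K ⊆ E) (hE : cap a b E = 0) : capCompact a b K = 0 := by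
  refine le_antisymm (le_trans ?_ hE.le) (zero_le)
  refine le_iInf fun O => le_iInf fun _ => le_iInf fun hEO => ?_
  exact le_iSup_of_le K (le_iSup_of_le hK (le_iSup_of_le (hKE.trans hEO) le_rfl))

end Potential

/-! ### Test functions -/

section TestFunctions

variable {N : ℕ}

lemma contDiff_slice {χ : SpaceTime N → ℝ} (hχ : ContDiff ℝ 2 χ) (t : ℝ) :
    ContDiff ℝ 2 fun x => χ (x, t) :=
  hχ.comp (contDiff_id.prodMk contDiff_const)

lemma fderiv_slice {χ : SpaceTime N → ℝ} (hχ : ContDiff ℝ 2 χ) (z : SpaceTime N) :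
    fderiv ℝ (fun x => χ (x, z.2)) z.1
      = (fderiv ℝ χ z).comp (ContinuousLinearMap.inl ℝ (Space N) ℝ) := by
  have h1 : HasFDerivAt χ (fderiv ℝ χ z) (z.1, z.2) := (hχ.differentiable (by simp) z).hasFDerivAt
  exact (h1.comp z.1 (hasFDerivAt_prodMk_left z.1 z.2)).fderiv

lemma iteratedFDeriv_two_slice {χ : SpaceTime N → ℝ} (hχ : ContDiff ℝ 2 χ) (z : SpaceTime N) :
    iteratedFDeriv ℝ 2 (fun x => χ (x, z.2)) z.1
      = (iteratedFDeriv ℝ 2 χ z).compContinuousLinearMap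
        fun _ => ContinuousLinearMap.inl ℝ (Space N) ℝ := by
  have hs : (fun x => χ (x, z.2))
      = (fun y => χ (y + (0, z.2))) ∘ ContinuousLinearMap.inl ℝ (Space N) ℝ := by
    ext x
    simp
  have h2 : ContDiff ℝ 2 fun y => χ (y + (0, z.2)) := hχ.comp (contDiff_id.add contDiff_const)
  rw [hs, ContinuousLinearMap.iteratedFDeriv_comp_right _ h2 _ (by norm_num),
    iteratedFDeriv_comp_add_right]
  simp

lemma dirDeriv_dirDeriv_eq {χ : SpaceTime N → ℝ} (hχ : ContDiff ℝ 2 χ) (e z : SpaceTime N) :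
    dirDeriv e (dirDeriv e χ) z = fderiv ℝ (fderiv ℝ χ) z e e := by
  have h1 : DifferentiableAt ℝ (fderiv ℝ χ) z :=
    (hχ.fderiv_right (m := 1) (by norm_num)).differentiable (by simp) z
  have h2 := h1.hasFDerivAt.clm_apply (hasFDerivAt_const e z)
  change fderiv ℝ (fun y => fderiv ℝ χ y e) z e = _
  rw [h2.fderiv]
  simp

lemma spaceLaplacian_eq {χ : SpaceTime N → ℝ} (hχ : ContDiff ℝ 2 χ) (z : SpaceTime N) :
    spaceLaplacian χ z = ∑ i : Fin N, dirDeriv (EuclideanSpace.single i 1, 0)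
      (dirDeriv (EuclideanSpace.single i 1, 0) χ) z := by
  rw [spaceLaplacian, InnerProductSpace.laplacian_eq_iteratedFDeriv_orthonormalBasis _
    (EuclideanSpace.basisFun (Fin N) ℝ)]
  refine Finset.sum_congr rfl fun i _ => ?_
  rw [iteratedFDeriv_two_slice hχ, dirDeriv_dirDeriv_eq hχ]
  rw [ContinuousMultilinearMap.compContinuousLinearMap_apply, iteratedFDeriv_two_apply]
  simp

lemma timeDeriv_eq {χ : SpaceTime N → ℝ} (hχ : ContDiff ℝ 2 χ) {z : SpaceTime N}
    (hz : 0 ≤ z.2) : timeDeriv χ z = dirDeriv (0, 1) χ z := by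
  have h1 : HasFDerivAt χ (fderiv ℝ χ z) (z.1, z.2) := (hχ.differentiable (by simp) z).hasFDerivAt
  have h2 := (h1.comp z.2 (hasFDerivAt_prodMk_right z.1 z.2)).hasDerivAt
  have h3 : HasDerivAt (fun t => χ (z.1, t)) (dirDeriv (0, 1) χ z) z.2 :=
    h2.congr_deriv (by simp [dirDeriv])
  exact h3.hasDerivWithinAt.derivWithin (uniqueDiffOn_Ici 0 z.2 hz)

/-- The support may extend to negative times, so neighbourhoods of points with t = 0 can be used
freely; only its part in t ≥ 0 has to be compact in Ω × [0,T). -/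
lemma isTestFunction_of_contDiff {Ω : Set (Space N)} {T : ℝ} {χ : SpaceTime N → ℝ}
    (hχ : ContDiff ℝ 2 χ) (hc : HasCompactSupport χ) (hs : tsupport χ ⊆ Ω ×ˢ Iio T) :
    IsTestFunction Ω T χ where
  contDiffOn_space t _ := (contDiff_slice hχ t).contDiffOn
  differentiable_time x _ t _ :=
    ((hχ.comp (contDiff_const.prodMk contDiff_id) :
      ContDiff ℝ 2 fun t => χ (x, t)).differentiable (by simp) t).differentiableWithinAt
  continuousOn := hχ.continuous.continuousOn
  continuousOn_fderiv := by
    simp only [fderiv_slice hχ]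
    exact ((hχ.continuous_fderiv (by simp)).clm_comp continuous_const).continuousOn
  continuousOn_fderiv_two := by
    simp only [iteratedFDeriv_two_slice hχ]
    exact ((ContinuousMultilinearMap.compContinuousLinearMapL (F := ℝ)
      fun _ : Fin 2 => ContinuousLinearMap.inl ℝ (Space N) ℝ).continuous.comp
      (hχ.continuous_iteratedFDeriv (m := 2) (by norm_num))).continuousOn
  continuousOn_timeDeriv := by
    have h1 : Continuous (dirDeriv (0, 1) χ) := (contDiff_one_dirDeriv _ hχ).continuous
    exact h1.continuousOn.congr fun z hz => timeDeriv_eq hχ hz.2.1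
  compact_support := by
    refine ⟨tsupport χ ∩ {z | 0 ≤ z.2},
      hc.isCompact.inter_right (isClosed_le continuous_const continuous_snd),
      fun z hz => ⟨(hs hz.1).1, hz.2, (hs hz.1).2⟩, fun z hz hz' => ?_⟩
    by_contra h
    exact hz' ⟨subset_tsupport _ h, hz.2.1⟩

/-- A smooth cutoff function between a compact set and an open neighbourhood, together with a
bound for its derivatives. -/
lemma exists_cutoff {K O : Set (SpaceTime N)} (hK : IsCompact K) (hO : IsOpen O) (hKO : K ⊆ O) :
    ∃ (ζ : SpaceTime N → ℝ) (L : ℝ≥0∞), ContDiff ℝ 2 ζ ∧ HasCompactSupport ζ ∧ tsupport ζ ⊆ O ∧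
      (∀ z, 0 ≤ ζ z) ∧ (∀ z, ζ z ≤ 1) ∧ (∀ z ∈ K, ζ z = 1) ∧ 1 ≤ L ∧ L ≠ ∞ ∧
      ∀ e, ‖e‖ ≤ 1 → ∀ z, ‖dirDeriv e ζ z‖ₑ ≤ L ∧ ‖dirDeriv e (dirDeriv e ζ) z‖ₑ ≤ L := by
  obtain ⟨B, hB, hKB, hBO⟩ := exists_compact_between hK hO hKO
  obtain ⟨f, hf0, hf1, hf⟩ := exists_contMDiffMap_zero_one_of_isClosed (n := ⊤)
    (modelWithCornersSelf ℝ (SpaceTime N)) (isOpen_interior (s := B)).isClosed_compl hK.isClosed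
    (disjoint_left.2 fun z hz hz' => hz (hKB hz'))
  have hcd : ContDiff ℝ 2 (f : SpaceTime N → ℝ) :=
    (contMDiff_iff_contDiff.1 f.contMDiff).of_le (WithTop.coe_le_coe.2 (le_top : (2 : ℕ∞) ≤ ⊤))
  have hts : tsupport (f : SpaceTime N → ℝ) ⊆ B := by
    refine closure_minimal (fun z hz => ?_) hB.isClosed
    by_contra h
    exact hz (hf0 fun h' => h (interior_subset h'))
  have hcs : HasCompactSupport (f : SpaceTime N → ℝ) :=
    hB.of_isClosed_subset (isClosed_tsupport _) hts
  have hcd' : ContDiff ℝ 1 (fderiv ℝ (f : SpaceTime N → ℝ)) := hcd.fderiv_right (by norm_num)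
  obtain ⟨c₁, h₁⟩ := hcd'.continuous.bounded_above_of_compact_support (hcs.fderiv ℝ)
  obtain ⟨c₂, h₂⟩ := (hcd'.continuous_fderiv (by simp)).bounded_above_of_compact_support
    ((hcs.fderiv ℝ).fderiv ℝ)
  refine ⟨f, ENNReal.ofReal (max 1 (max c₁ c₂)), hcd, hcs, hts.trans hBO, fun z => (hf z).1,
    fun z => (hf z).2, hf1, by simp, ENNReal.ofReal_ne_top, fun e he z => ⟨?_, ?_⟩⟩
  · rw [← ofReal_norm]
    refine ENNReal.ofReal_le_ofReal ?_
    refine ((fderiv ℝ f z).le_of_opNorm_le (h₁ z) e).trans ?_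
    have h0 := (norm_nonneg _).trans (h₁ z)
    exact (mul_le_of_le_one_right h0 he).trans ((le_max_left _ _).trans (le_max_right _ _))
  · rw [← ofReal_norm, dirDeriv_dirDeriv_eq hcd]
    refine ENNReal.ofReal_le_ofReal ?_
    have h0 := (norm_nonneg _).trans (h₂ z)
    refine (ContinuousLinearMap.le_of_opNorm₂_le_of_le _ (h₂ z |>.trans_eq (by rfl)) he he).trans ?_
    rw [mul_one, mul_one]
    exact (le_max_right _ _).trans (le_max_right _ _)

lemma enorm_mul_le_of_le_one {x y : ℝ} {A : ℝ≥0∞} (hx : ‖x‖ₑ ≤ A) (hy : |y| ≤ 1) :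
    ‖x * y‖ₑ ≤ A := by
  rw [enorm_mul, ← Real.enorm_abs y, Real.enorm_eq_ofReal (abs_nonneg y)]
  exact (mul_le_of_le_one_right' (by simpa using hy)).trans hx

lemma enorm_dirDeriv_mul_le {ψ ζ : SpaceTime N → ℝ} (hψ : ContDiff ℝ 2 ψ) (hζ : ContDiff ℝ 2 ζ)
    (h1 : ∀ z, |ζ z| ≤ 1) {L : ℝ≥0∞} (e z : SpaceTime N) (hL : ‖dirDeriv e ζ z‖ₑ ≤ L) :
    ‖dirDeriv e (fun y => ψ y * ζ y) z‖ₑ ≤ L * ‖ψ z‖ₑ + ‖dirDeriv e ψ z‖ₑ := by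
  rw [dirDeriv_mul e z (hψ.differentiable (by simp) z) (hζ.differentiable (by simp) z)]
  refine (enorm_add_le _ _).trans (add_le_add ?_ (enorm_mul_le_of_le_one le_rfl (h1 z)))
  rw [enorm_mul, mul_comm]
  exact mul_le_mul_left hL _

lemma enorm_dirDeriv_dirDeriv_mul_le {ψ ζ : SpaceTime N → ℝ} (hψ : ContDiff ℝ 2 ψ)
    (hζ : ContDiff ℝ 2 ζ) (h1 : ∀ z, |ζ z| ≤ 1) {L G : ℝ≥0∞} (e z : SpaceTime N) (hL1 : 1 ≤ L)
    (hL : ‖dirDeriv e ζ z‖ₑ ≤ L) (hL' : ‖dirDeriv e (dirDeriv e ζ) z‖ₑ ≤ L) (hG : ‖ψ z‖ₑ ≤ G)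
    (hG' : ‖dirDeriv e ψ z‖ₑ ≤ G) (hG'' : ‖dirDeriv e (dirDeriv e ψ) z‖ₑ ≤ G) :
    ‖dirDeriv e (dirDeriv e fun y => ψ y * ζ y) z‖ₑ ≤ 4 * L * G := by
  have d1 := hψ.differentiable (by simp)
  have d2 := hζ.differentiable (by simp)
  have d3 : Differentiable ℝ (dirDeriv e ψ) :=
    (contDiff_one_dirDeriv e hψ).differentiable (by simp)
  have d4 : Differentiable ℝ (dirDeriv e ζ) :=
    (contDiff_one_dirDeriv e hζ).differentiable (by simp)
  have e1 : dirDeriv e (fun y => ψ y * ζ y) = fun y => ψ y * dirDeriv e ζ y + dirDeriv e ψ y * ζ y :=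
    funext fun y => dirDeriv_mul e y (d1 y) (d2 y)
  rw [e1, dirDeriv_add (F := fun y => ψ y * dirDeriv e ζ y) (G := fun y => dirDeriv e ψ y * ζ y)
    e z ((d1 z).mul (d4 z)) ((d3 z).mul (d2 z)), dirDeriv_mul e z (d1 z) (d4 z),
    dirDeriv_mul e z (d3 z) (d2 z)]
  have p : ∀ {x y : ℝ} {A B : ℝ≥0∞}, ‖x‖ₑ ≤ A → ‖y‖ₑ ≤ B → ‖x * y‖ₑ ≤ B * A := by
    intro x y A B hx hy
    rw [enorm_mul, mul_comm]
    exact mul_le_mul' hy hx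
  calc _ ≤ (L * G + L * G) + (L * G + L * G) := by
        refine (enorm_add_le _ _).trans (add_le_add ?_ ?_)
        · exact (enorm_add_le _ _).trans (add_le_add (p hG hL') (p hG' hL))
        · refine (enorm_add_le _ _).trans (add_le_add (p hG' hL) ?_)
          exact (enorm_mul_le_of_le_one hG'' (h1 z)).trans (le_mul_of_one_le_left' hL1)
    _ = 4 * L * G := by ring

end TestFunctions

/-! ### The equation tested with small potentials -/

section Estimate

variable {N : ℕ}

lemma enorm_signedPow {a : ℝ} (ha : 0 < a) (s : ℝ) : ‖signedPow a s‖ₑ = ‖s‖ₑ ^ a := by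
  have h1 : |signedPow a s| = |s| ^ a := by
    rw [signedPow, abs_mul, abs_of_nonneg (Real.rpow_nonneg (abs_nonneg s) _)]
    rcases eq_or_ne s 0 with rfl | hs
    · simp [Real.zero_rpow ha.ne']
    · have : 0 < |s| := abs_pos.2 hs
      rw [Real.rpow_sub_one this.ne', div_mul_cancel₀ _ this.ne']
  rw [← ofReal_norm, ← ofReal_norm, Real.norm_eq_abs, Real.norm_eq_abs, h1,
    ENNReal.ofReal_rpow_of_nonneg (abs_nonneg s) ha.le]

/-- Integrals of a fixed integrable weight against functions with values in `[0, 1]` are small if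
the functions are small in measure. -/
lemma exists_pos_lintegral_mul_le {α : Type*} [MeasurableSpace α] {ν : Measure α} {w : α → ℝ≥0∞}
    (hw : ∫⁻ z, w z ∂ν ≠ ∞) {a : ℝ} (ha : 0 < a) {η : ℝ≥0∞} (hη : η ≠ 0) :
    ∃ δ : ℝ≥0∞, δ ≠ 0 ∧ ∀ g : α → ℝ≥0∞, Measurable g → (∀ z, g z ≤ 1) →
      ∫⁻ z, g z ^ a ∂ν ≤ δ → ∫⁻ z, w z * g z ∂ν ≤ η := by
  have hη2 : η / 2 ≠ 0 := by simpa using hη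
  obtain ⟨θ, hθ0, hθ⟩ := exists_pos_forall_mul_rpow_le hw hη2 one_pos
  obtain ⟨δ, hδ, h⟩ := exists_pos_setLIntegral_lt_of_measure_lt hw hη2
  set κ := min θ 1 with hκ
  have hκ0 : κ ≠ 0 := by simp [hκ, hθ0]
  have hκ1 : κ ≠ ∞ := ne_top_of_le_ne_top ENNReal.one_ne_top (min_le_right _ _)
  have hκa0 : κ ^ a ≠ 0 := by simp [ENNReal.rpow_eq_zero_iff, hκ0, hκ1]
  have hκa : κ ^ a ≠ ∞ := ENNReal.rpow_ne_top_of_nonneg ha.le hκ1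
  set δ' := min δ 1 with hδ'
  have hδ'0 : δ' ≠ 0 := by simp [hδ', hδ.ne']
  have hδ'1 : δ' ≠ ∞ := ne_top_of_le_ne_top ENNReal.one_ne_top (min_le_right _ _)
  -- By Chebyshev {g ≥ κ} has measure below δ, and there g ≤ 1 and absolute continuity of the
  -- integral of w applies; on the complement w·g ≤ κw.
  refine ⟨κ ^ a * (δ' / 2), mul_ne_zero hκa0 (by simpa using hδ'0), fun g hg hg1 hga => ?_⟩
  have hA : MeasurableSet {z | κ ≤ g z} := measurableSet_le measurable_const hg
  have hνA : ν {z | κ ≤ g z} < δ := by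
    have h1 := mul_meas_ge_le_lintegral (μ := ν) (hg.pow_const a) (κ ^ a)
    simp only [ENNReal.rpow_le_rpow_iff ha] at h1
    have h2 := (ENNReal.mul_le_mul_iff_right hκa0 hκa).1 (h1.trans hga)
    exact h2.trans_lt ((ENNReal.half_lt_self hδ'0 hδ'1).trans_le (min_le_left _ _))
  rw [← lintegral_add_compl _ hA, ← ENNReal.add_halves η]
  refine add_le_add ?_ ?_
  · refine le_trans (lintegral_mono fun z => ?_) (h _ hνA).le
    exact mul_le_of_le_one_right' (hg1 z)
  · calc _ ≤ ∫⁻ z in {z | κ ≤ g z}ᶜ, w z * κ ∂ν :=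
          setLIntegral_mono' hA.compl fun z hz => mul_le_mul_right (lt_of_not_ge fun h => hz h).le _
      _ ≤ ∫⁻ z, w z * κ ∂ν := setLIntegral_le_lintegral _ _
      _ = (∫⁻ z, w z ∂ν) * κ := lintegral_mul_const' _ _ hκ1
      _ ≤ _ := by simpa using hθ κ (min_le_left _ _)

lemma exists_pos_lintegral_mul_le_of_conj {α : Type*} [MeasurableSpace α] {ν : Measure α}
    {p p' : ℝ} (hp : p.HolderConjugate p') {f : α → ℝ≥0∞} (hf : AEMeasurable f ν)
    (hfp : ∫⁻ z, f z ^ p ∂ν ≠ ∞) {η : ℝ≥0∞} (hη : η ≠ 0) :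
    ∃ δ : ℝ≥0∞, δ ≠ 0 ∧ ∀ g : α → ℝ≥0∞, Measurable g →
      ∫⁻ z, g z ^ p' ∂ν ≤ δ → ∫⁻ z, f z * g z ∂ν ≤ η := by
  have h1 : (∫⁻ z, f z ^ p ∂ν) ^ (1 / p) ≠ ∞ :=
    ENNReal.rpow_ne_top_of_nonneg (by simpa using hp.nonneg) hfp
  obtain ⟨δ, hδ, h⟩ := exists_pos_forall_mul_rpow_le h1 hη (p := 1 / p')
    (by simpa using hp.symm.pos)
  refine ⟨δ, hδ, fun g hg hgδ => ?_⟩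
  exact (ENNReal.lintegral_mul_le_Lp_mul_Lq ν hp hf hg.aemeasurable).trans (h _ hgδ)

/-- The left-hand side of the weak formulation. -/
def weakForm (Ω : Set (Space N)) (T m q : ℝ) (u χ : SpaceTime N → ℝ) : ℝ :=
  -(∫ z in cylinder Ω T, u z * timeDeriv χ z)
    - (∫ z in cylinder Ω T, signedPow m (u z) * spaceLaplacian χ z)
    + ∫ z in cylinder Ω T, signedPow q (u z) * χ z

lemma measurableSet_cylinder {Ω : Set (Space N)} (hΩ : IsOpen Ω) (T : ℝ) :
    MeasurableSet (cylinder Ω T) :=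
  (hΩ.prod isOpen_Ioo).measurableSet

/-- Sets of zero capacity have test functions for which the left-hand side of the weak formulation
is small. -/
theorem exists_testFunction {Ω : Set (Space N)} (hΩ : IsOpen Ω) (hb : Bornology.IsBounded Ω)
    {T m q : ℝ} (hm : 0 < m) (hq1 : 1 < q) (hqm : m < q) {u : SpaceTime N → ℝ}
    (hu : AEStronglyMeasurable u (volume.restrict (cylinder Ω T)))
    (hInt : IntegrableOn (fun z => signedPow q (u z)) (cylinder Ω T))
    {K O : Set (SpaceTime N)} (hK : IsCompact K) (hO : IsOpen O) (hKO : K ⊆ O)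
    (hOΩ : O ⊆ Ω ×ˢ Iio T) (hcap : capCompact (q / (q - m)) (q / (q - 1)) K = 0)
    {ε : ℝ} (hε : 0 < ε) :
    ∃ χ : SpaceTime N → ℝ, IsTestFunction Ω T χ ∧ Continuous χ ∧ (∀ z, 0 ≤ χ z) ∧
      (∀ z, χ z ≤ 1) ∧ (∀ z ∈ K, χ z = 1) ∧ (∀ z ∉ O, χ z = 0) ∧ |weakForm Ω T m q u χ| ≤ ε := by
  set Q := cylinder Ω T with hQ
  have hQm : MeasurableSet Q := measurableSet_cylinder hΩ T
  set ν := (volume : Measure (SpaceTime N)).restrict Q with hν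
  have hq0 : 0 < q := by linarith
  have hνfin : IsFiniteMeasure ν := by
    have : Bornology.IsBounded Q := hb.prod (Metric.isBounded_Ioo 0 T)
    exact ⟨by simpa [hν] using this.measure_lt_top⟩
  set U : SpaceTime N → ℝ≥0∞ := fun z => ‖u z‖ₑ with hU
  have hUm : AEMeasurable U ν := hu.enorm
  have hUq : ∫⁻ z, U z ^ q ∂ν ≠ ∞ := by
    have := hInt.hasFiniteIntegral
    rw [hasFiniteIntegral_iff_enorm] at this
    simp only [enorm_signedPow hq0] at this
    exact this.ne
  -- From |u| ≤ 1 + |u|^q on a cylinder of finite measure.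
  have hU1 : ∫⁻ z, U z ∂ν ≠ ∞ := by
    have h1 : ∫⁻ z, U z ∂ν ≤ ∫⁻ z, (1 + U z ^ q) ∂ν := by
      refine lintegral_mono fun z => ?_
      rcases le_total (U z) 1 with h | h
      · exact h.trans le_self_add
      · refine le_trans ?_ le_add_self
        simpa using ENNReal.rpow_le_rpow_of_exponent_le h hq1.le
    refine ne_top_of_le_ne_top ?_ h1
    rw [lintegral_add_left measurable_const]
    simp [hUq]
  obtain ⟨ζ, L, z1, z2, z3, z4, z5, z6, z7, z8, z9⟩ := exists_cutoff hK hO hKO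
  have hζ1 : ∀ z, |ζ z| ≤ 1 := fun z => abs_le.2 ⟨by linarith [z4 z], z5 z⟩
  have ha : 1 < q / (q - m) := by
    rw [one_lt_div (by linarith)]; linarith
  have hb' : 1 < q / (q - 1) := by
    rw [one_lt_div (by linarith)]; linarith
  -- The exponents of the capacity are exactly the conjugates of q and of q/m, the integrability
  -- exponents of u and |u|^m.
  have conj1 : q.HolderConjugate (q / (q - 1)) := by
    rw [Real.holderConjugate_iff]
    refine ⟨hq1, ?_⟩
    field_simp
    ring
  have conj2 : (q / m).HolderConjugate (q / (q - m)) := by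
    rw [Real.holderConjugate_iff]
    refine ⟨(one_lt_div hm).2 hqm, ?_⟩
    field_simp
    ring
  set η : ℝ≥0∞ := ENNReal.ofReal ε / 3 with hη
  have hη0 : η ≠ 0 := by simp [hη, hε]
  -- The weight of the undifferentiated potential: L|u| arises when ∂_t falls on the cutoff, |u|^q
  -- from the absorption term.
  have hw : ∫⁻ z, (L * U z + U z ^ q) ∂ν ≠ ∞ := by
    rw [lintegral_add_left' (hUm.const_mul L), lintegral_const_mul'' L hUm]
    exact ENNReal.add_ne_top.2 ⟨ENNReal.mul_ne_top z8 hU1, hUq⟩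
  have hc : (N : ℝ≥0∞) * (4 * L) ≠ ∞ := by finiteness
  have hUm' : ∫⁻ z, ((N : ℝ≥0∞) * (4 * L) * U z ^ m) ^ (q / m) ∂ν ≠ ∞ := by
    simp only [ENNReal.mul_rpow_of_nonneg _ _ (div_pos hq0 hm).le, ← ENNReal.rpow_mul,
      mul_div_cancel₀ q hm.ne']
    rw [lintegral_const_mul' _ _ (by finiteness)]
    exact ENNReal.mul_ne_top (by finiteness) hUq
  obtain ⟨δ₁, d1, k1⟩ := exists_pos_lintegral_mul_le hw (zero_lt_one.trans ha) hη0
  obtain ⟨δ₂, d2, k2⟩ := exists_pos_lintegral_mul_le_of_conj conj1 hUm hUq hη0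
  obtain ⟨δ₃, d3, k3⟩ := exists_pos_lintegral_mul_le_of_conj conj2
    ((hUm.pow_const m).const_mul _) hUm' hη0
  obtain ⟨ψ, G, H, p1, p2, p3, p4, p5, p6, p7, p8, p9, p10, p11, p12⟩ :=
    exists_potential ha hb' hcap (ε := min δ₁ (min δ₂ δ₃)) (by simp [d1, d2, d3])
  have hψm : Measurable fun z => ‖ψ z‖ₑ := p1.continuous.enorm.measurable
  have hψ1 : ∀ z, ‖ψ z‖ₑ ≤ 1 := fun z => by
    rw [Real.enorm_eq_ofReal (p4 z)]
    simpa using p5 z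
  have hle : ∀ F : SpaceTime N → ℝ≥0∞, ∫⁻ z, F z ∂ν ≤ ∫⁻ z, F z :=
    fun F => lintegral_mono' Measure.restrict_le_self le_rfl
  have I1 : ∫⁻ z, (L * U z + U z ^ q) * ‖ψ z‖ₑ ∂ν ≤ η := by
    refine k1 _ hψm hψ1 (le_trans ?_ (p11.trans (min_le_left _ _)))
    refine (hle _).trans (lintegral_mono fun z => ?_)
    exact ENNReal.rpow_le_rpow (p7 z) (by linarith)
  have I2 : ∫⁻ z, U z * H z ∂ν ≤ η :=
    k2 H p3 ((hle _).trans (p12.trans ((min_le_right _ _).trans (min_le_left _ _))))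
  have I3 : ∫⁻ z, (N : ℝ≥0∞) * (4 * L) * U z ^ m * G z ∂ν ≤ η :=
    k3 G p2 ((hle _).trans (p11.trans ((min_le_right _ _).trans (min_le_right _ _))))
  set χ : SpaceTime N → ℝ := fun z => ψ z * ζ z with hχ
  have hχC : ContDiff ℝ 2 χ := p1.mul z1
  have hsupp : tsupport χ ⊆ tsupport ζ := closure_mono fun z hz h => hz (by simp [hχ, h])
  have hT1 : ∀ z ∈ Q, ‖u z * timeDeriv χ z‖ₑ ≤ L * U z * ‖ψ z‖ₑ + U z * H z := by
    intro z hz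
    rw [timeDeriv_eq hχC hz.2.1.le, enorm_mul]
    have h1 := enorm_dirDeriv_mul_le p1 z1 hζ1 ((0, 1) : SpaceTime N) z
      (z9 _ (by simp [Prod.norm_def]) z).1
    calc _ ≤ U z * (L * ‖ψ z‖ₑ + H z) :=
          mul_le_mul_right (h1.trans (add_le_add le_rfl (p10 z))) _
      _ = _ := by ring
  have hX1 : ∀ z, ‖signedPow m (u z) * spaceLaplacian χ z‖ₑ
      ≤ (N : ℝ≥0∞) * (4 * L) * U z ^ m * G z := by
    intro z
    rw [enorm_mul, enorm_signedPow hm, spaceLaplacian_eq hχC]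
    have h1 : ‖∑ i : Fin N, dirDeriv (EuclideanSpace.single i 1, 0)
        (dirDeriv (EuclideanSpace.single i 1, 0) χ) z‖ₑ ≤ ∑ _i : Fin N, 4 * L * G z := by
      refine (enorm_sum_le _ _).trans (Finset.sum_le_sum fun i _ => ?_)
      have hn : ‖(EuclideanSpace.single i 1 : Space N)‖ ≤ 1 := by simp
      have hn' : ‖((EuclideanSpace.single i 1, 0) : SpaceTime N)‖ ≤ 1 := by
        simp [Prod.norm_def]
      exact enorm_dirDeriv_dirDeriv_mul_le p1 z1 hζ1 _ z z7 (z9 _ hn' z).1 (z9 _ hn' z).2 (p7 z)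
        (p8 _ hn z) (p9 _ hn z)
    calc _ ≤ U z ^ m * ∑ _i : Fin N, 4 * L * G z := mul_le_mul_right h1 _
      _ = _ := by simp; ring
  have hq1' : ∀ z, ‖signedPow q (u z) * χ z‖ₑ ≤ U z ^ q * ‖ψ z‖ₑ := by
    intro z
    rw [enorm_mul, enorm_signedPow hq0]
    exact mul_le_mul_right (enorm_mul_le_of_le_one le_rfl (hζ1 z)) _
  have hfinal : ‖weakForm Ω T m q u χ‖ₑ ≤ ENNReal.ofReal ε := by
    have hmeas1 : AEMeasurable (fun z => L * U z * ‖ψ z‖ₑ) ν :=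
      (hUm.const_mul L).mul hψm.aemeasurable
    have hmeas2 : AEMeasurable (fun z => U z * H z) ν := hUm.mul p3.aemeasurable
    calc ‖weakForm Ω T m q u χ‖ₑ
        ≤ ‖∫ z, u z * timeDeriv χ z ∂ν‖ₑ + ‖∫ z, signedPow m (u z) * spaceLaplacian χ z ∂ν‖ₑ
          + ‖∫ z, signedPow q (u z) * χ z ∂ν‖ₑ := by
          unfold weakForm
          refine (enorm_add_le _ _).trans (add_le_add (enorm_sub_le.trans ?_) le_rfl)
          rw [enorm_neg]
      _ ≤ (∫⁻ z, (L * U z * ‖ψ z‖ₑ + U z * H z) ∂ν)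
          + (∫⁻ z, (N : ℝ≥0∞) * (4 * L) * U z ^ m * G z ∂ν) + ∫⁻ z, U z ^ q * ‖ψ z‖ₑ ∂ν := by
          refine add_le_add (add_le_add ?_ ?_) ?_
          · exact (enorm_integral_le_lintegral_enorm _).trans (setLIntegral_mono' hQm hT1)
          · exact (enorm_integral_le_lintegral_enorm _).trans (lintegral_mono hX1)
          · exact (enorm_integral_le_lintegral_enorm _).trans (lintegral_mono hq1')
      _ = (∫⁻ z, (L * U z + U z ^ q) * ‖ψ z‖ₑ ∂ν) + (∫⁻ z, U z * H z ∂ν)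
          + ∫⁻ z, (N : ℝ≥0∞) * (4 * L) * U z ^ m * G z ∂ν := by
          simp only [add_mul]
          rw [lintegral_add_left' hmeas1, lintegral_add_left' hmeas1]
          ring
      _ ≤ η + η + η := add_le_add (add_le_add I1 I2) I3
      _ = ENNReal.ofReal ε := ENNReal.add_thirds _
  refine ⟨χ, isTestFunction_of_contDiff hχC (z2.mono' (subset_closure.trans hsupp))
    ((hsupp.trans z3).trans hOΩ), hχC.continuous, fun z => mul_nonneg (p4 z) (z4 z),
    fun z => mul_le_one₀ (p5 z) (z4 z) (z5 z), fun z hz => by simp [hχ, p6 z hz, z6 z hz],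
    fun z hz => ?_, ?_⟩
  · by_contra h
    exact hz (z3 (hsupp (subset_tsupport _ h)))
  · rw [← ofReal_norm] at hfinal
    exact (ENNReal.ofReal_le_ofReal_iff hε.le).1 hfinal

end Estimate

/-! ### Absolute continuity of the data -/

section AbsoluteContinuity

variable {N : ℕ}

/-- The measure `ρ + τ ⊗ δ_{t = 0}`. -/
def jointData (ρ : Measure (SpaceTime N)) (τ : Measure (Space N)) : Measure (SpaceTime N) :=
  ρ + τ.map fun x => (x, 0)

instance (ρ : Measure (SpaceTime N)) (τ : Measure (Space N)) [IsFiniteMeasure ρ]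
    [IsFiniteMeasure τ] : IsFiniteMeasure (jointData ρ τ) := by
  unfold jointData
  infer_instance

lemma measurable_atZero : Measurable fun x : Space N => ((x, 0) : SpaceTime N) := by fun_prop

lemma jointData_apply (ρ : Measure (SpaceTime N)) (τ : Measure (Space N)) {A : Set (SpaceTime N)}
    (hA : MeasurableSet A) : jointData ρ τ A = ρ A + τ {x | (x, 0) ∈ A} := by
  rw [jointData, Measure.add_apply, Measure.map_apply measurable_atZero hA]
  rfl

lemma integrable_of_mem_unitInterval {X : Type*} [TopologicalSpace X] [MeasurableSpace X]
    [OpensMeasurableSpace X] {ρ : Measure X} [IsFiniteMeasure ρ] {χ : X → ℝ} (hχ : Continuous χ)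
    (h0 : ∀ z, 0 ≤ χ z) (h1 : ∀ z, χ z ≤ 1) : Integrable χ ρ := by
  refine Integrable.of_bound hχ.measurable.aestronglyMeasurable 1 (ae_of_all _ fun z => ?_)
  rw [Real.norm_eq_abs, abs_of_nonneg (h0 z)]
  exact h1 z

lemma integral_jointData {ρ : Measure (SpaceTime N)} {τ : Measure (Space N)} [IsFiniteMeasure ρ]
    [IsFiniteMeasure τ] {χ : SpaceTime N → ℝ} (hχ : Continuous χ) (h0 : ∀ z, 0 ≤ χ z)
    (h1 : ∀ z, χ z ≤ 1) : ∫ z, χ z ∂jointData ρ τ = (∫ z, χ z ∂ρ) + ∫ x, χ (x, 0) ∂τ := by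
  rw [jointData, integral_add_measure (integrable_of_mem_unitInterval hχ h0 h1)
    (integrable_of_mem_unitInterval hχ h0 h1), integral_map measurable_atZero.aemeasurable
    hχ.measurable.aestronglyMeasurable]

lemma measureReal_le_integral_le {ρ : Measure (SpaceTime N)} [IsFiniteMeasure ρ]
    {K O : Set (SpaceTime N)} (hK : MeasurableSet K) (hO : MeasurableSet O) {χ : SpaceTime N → ℝ}
    (hχ : Continuous χ) (h0 : ∀ z, 0 ≤ χ z) (h1 : ∀ z, χ z ≤ 1) (hχK : ∀ z ∈ K, χ z = 1)
    (hχO : ∀ z ∉ O, χ z = 0) : ρ.real K ≤ ∫ z, χ z ∂ρ ∧ ∫ z, χ z ∂ρ ≤ ρ.real O := by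
  have hi := integrable_of_mem_unitInterval (ρ := ρ) hχ h0 h1
  constructor
  · rw [← integral_indicator_one hK]
    refine integral_mono ((integrable_const 1).indicator hK) hi fun z => ?_
    by_cases hz : z ∈ K
    · simp [hz, hχK z hz]
    · simp [hz, h0 z]
  · rw [← integral_indicator_one hO]
    refine integral_mono hi ((integrable_const 1).indicator hO) fun z => ?_
    by_cases hz : z ∈ O
    · simp [hz, h1 z]
    · simp [hz, hχO z hz]

lemma posPart_eq_zero_of_totalVariation {X : Type*} [MeasurableSpace X] {ν : SignedMeasure X}
    {A : Set X} (h : ν.totalVariation A = 0) :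
    ν.toJordanDecomposition.posPart A = 0 ∧ ν.toJordanDecomposition.negPart A = 0 := by
  rw [SignedMeasure.totalVariation, Measure.add_apply] at h
  simpa using h

lemma ConcentratedOn.signedIntegral_eq {X : Type*} [MeasurableSpace X] {ν : SignedMeasure X}
    {S : Set X} (h : ConcentratedOn ν S) (f : X → ℝ) :
    signedIntegral ν S f = (∫ x, f x ∂ν.toJordanDecomposition.posPart)
      - ∫ x, f x ∂ν.toJordanDecomposition.negPart := by
  obtain ⟨h1, h2⟩ := posPart_eq_zero_of_totalVariation h
  rw [signedIntegral, Measure.restrict_eq_self_of_ae_mem (measure_eq_zero_iff_ae_notMem.1 h1 |>.mono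
    fun x hx => not_not.1 hx), Measure.restrict_eq_self_of_ae_mem
    (measure_eq_zero_iff_ae_notMem.1 h2 |>.mono fun x hx => not_not.1 hx)]

/-- The positive and the negative parts of the data agree on compact sets of zero capacity. -/
theorem jointData_eq_of_capCompact_eq_zero {Ω : Set (Space N)} (hΩ : IsOpen Ω)
    (hb : Bornology.IsBounded Ω) {T m q : ℝ} (hm : 0 < m) (hq1 : 1 < q) (hqm : m < q)
    {μ : SignedMeasure (SpaceTime N)} (hμ : ConcentratedOn μ (cylinder Ω T))
    {σ : SignedMeasure (Space N)} (hσ : ConcentratedOn σ Ω) {u : SpaceTime N → ℝ}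
    (hu : IsVeryWeakSolution Ω T m (signedPow q) μ σ u) {K : Set (SpaceTime N)} (hK : IsCompact K)
    (hKΩ : K ⊆ Ω ×ˢ Iio T) (hcap : capCompact (q / (q - m)) (q / (q - 1)) K = 0) :
    jointData μ.toJordanDecomposition.posPart σ.toJordanDecomposition.posPart K
      = jointData μ.toJordanDecomposition.negPart σ.toJordanDecomposition.negPart K := by
  set P := jointData μ.toJordanDecomposition.posPart σ.toJordanDecomposition.posPart
  set M := jointData μ.toJordanDecomposition.negPart σ.toJordanDecomposition.negPart
  -- One ε comes from the weak form, the other from the excess of P or M on the neighbourhood O of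
  -- K.
  suffices h : ∀ ε > 0, |P.real K - M.real K| ≤ 2 * ε by
    have h2 : P.real K - M.real K = 0 := by
      by_contra hne
      have := h (|P.real K - M.real K| / 4) (by positivity)
      have := abs_pos.2 hne
      linarith
    exact (measureReal_eq_measureReal_iff (by finiteness) (by finiteness)).1 (sub_eq_zero.1 h2)
  intro ε hε
  have hε' : ENNReal.ofReal ε ≠ 0 := by simpa using hε
  obtain ⟨O₁, hKO₁, hO₁, hP⟩ := hK.exists_isOpen_lt_add (μ := P) hε'
  obtain ⟨O₂, hKO₂, hO₂, hM⟩ := hK.exists_isOpen_lt_add (μ := M) hε'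
  set O := (O₁ ∩ O₂) ∩ Ω ×ˢ Iio T with hOdef
  have hO : IsOpen O := (hO₁.inter hO₂).inter (hΩ.prod isOpen_Iio)
  have hKO : K ⊆ O := subset_inter (subset_inter hKO₁ hKO₂) hKΩ
  have key : ∀ (R : Measure (SpaceTime N)) [IsFiniteMeasure R] (O' : Set (SpaceTime N)), O ⊆ O' →
      R O' < R K + ENNReal.ofReal ε → R.real O ≤ R.real K + ε := by
    intro R _ O' hO' h
    have h1 : R O ≤ R K + ENNReal.ofReal ε := (measure_mono hO').trans h.le
    have h2 := ENNReal.toReal_mono (by finiteness) h1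
    rwa [ENNReal.toReal_add (by finiteness) (by finiteness), ENNReal.toReal_ofReal hε.le] at h2
  have hP' := key P O₁ (inter_subset_left.trans inter_subset_left) hP
  have hM' := key M O₂ (inter_subset_left.trans inter_subset_right) hM
  obtain ⟨χ, t1, t2, t3, t4, t5, t6, t7⟩ := exists_testFunction hΩ hb hm hq1 hqm
    hu.memLp.aestronglyMeasurable hu.integrable hK hO hKO inter_subset_right hcap hε
  -- As the data are concentrated on the cylinder and on Ω, the right-hand side of the equation is
  -- the integral of χ against the interior and initial data together.
  have heq : weakForm Ω T m q u χ = (∫ z, χ z ∂P) - ∫ z, χ z ∂M := by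
    rw [integral_jointData t2 t3 t4, integral_jointData t2 t3 t4, weakForm, hu.equation χ t1,
      hμ.signedIntegral_eq, hσ.signedIntegral_eq]
    ring
  rw [heq] at t7
  obtain ⟨b1, b2⟩ := measureReal_le_integral_le (ρ := P) hK.measurableSet hO.measurableSet t2 t3 t4
    t5 t6
  obtain ⟨c1, c2⟩ := measureReal_le_integral_le (ρ := M) hK.measurableSet hO.measurableSet t2 t3 t4
    t5 t6
  obtain ⟨l1, l2⟩ := abs_le.1 t7
  rw [abs_le]
  constructor <;> linarith

/-- Mutually singular parts of the data that agree on compact sets of zero capacity vanish on sets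
of zero capacity. -/
lemma eq_zero_of_jointData_eq {Ω : Set (Space N)} (hΩ : IsOpen Ω) {T a b : ℝ} (hT : 0 < T)
    {μ₁ μ₂ : Measure (SpaceTime N)} {σ₁ σ₂ : Measure (Space N)} [IsFiniteMeasure μ₁]
    [IsFiniteMeasure σ₁] (hμ : μ₁ ⟂ₘ μ₂)
    (hσ : σ₁ ⟂ₘ σ₂) (hμ₁ : μ₁ (cylinder Ω T)ᶜ = 0) (hμ₂ : μ₂ (cylinder Ω T)ᶜ = 0)
    (hσ₁ : σ₁ Ωᶜ = 0)
    (h : ∀ K : Set (SpaceTime N), IsCompact K → K ⊆ Ω ×ˢ Iio T → capCompact a b K = 0 →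
      jointData μ₁ σ₁ K = jointData μ₂ σ₂ K)
    {E : Set (SpaceTime N)} (hE : MeasurableSet E) (hcap : cap a b E = 0) :
    μ₁ E = 0 ∧ σ₁ {x | (x, 0) ∈ E} = 0 := by
  have hQ : MeasurableSet (cylinder Ω T) := measurableSet_cylinder hΩ T
  constructor
  · obtain ⟨s, hs, hs1, hs2⟩ := hμ
    have hA : MeasurableSet ((E ∩ cylinder Ω T) ∩ sᶜ) := (hE.inter hQ).inter hs.compl
    -- A compact subset of the cylinder does not meet t = 0, so the initial data drop out; μ₂
    -- vanishes on sᶜ, and equality of the joint data leaves μ₁(K) = 0.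
    have h0 : μ₁ ((E ∩ cylinder Ω T) ∩ sᶜ) = 0 := by
      rw [hA.measure_eq_iSup_isCompact]
      simp only [ENNReal.iSup_eq_zero]
      intro K hKA hK
      have h1 := h K hK (fun z hz => ⟨(hKA hz).1.2.1, (hKA hz).1.2.2.2⟩)
        (capCompact_eq_zero_of_subset hK (fun z hz => (hKA hz).1.1) hcap)
      have h2 : {x : Space N | ((x, 0) : SpaceTime N) ∈ K} = ∅ :=
        eq_empty_of_forall_notMem fun x hx => lt_irrefl _ (hKA hx).1.2.2.1
      rw [jointData_apply _ _ hK.measurableSet, jointData_apply _ _ hK.measurableSet, h2,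
        measure_empty, measure_empty, add_zero, add_zero,
        measure_mono_null (fun z hz => (hKA hz).2) hs2] at h1
      exact h1
    refine measure_mono_null (t := (E ∩ cylinder Ω T) ∩ sᶜ ∪ (cylinder Ω T)ᶜ ∪ s) ?_
      (measure_union_null (measure_union_null h0 hμ₁) hs1)
    intro z hz
    simp only [mem_union, mem_inter_iff, mem_compl_iff]
    tauto
  · obtain ⟨s, hs, hs1, hs2⟩ := hσ
    have hA : MeasurableSet (({x : Space N | ((x, 0) : SpaceTime N) ∈ E} ∩ Ω) ∩ sᶜ) :=
      ((measurable_atZero hE).inter hΩ.measurableSet).inter hs.compl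
    have h0 : σ₁ (({x | (x, 0) ∈ E} ∩ Ω) ∩ sᶜ) = 0 := by
      rw [hA.measure_eq_iSup_isCompact]
      simp only [ENNReal.iSup_eq_zero]
      intro K' hKA hK'
      -- Lifted to t = 0, the set lies outside the open cylinder, so now the interior data drop out.
      set K : Set (SpaceTime N) := (fun x => (x, 0)) '' K' with hKdef
      have hK : IsCompact K := hK'.image (by fun_prop)
      have hKE : K ⊆ E := by
        rintro _ ⟨x, hx, rfl⟩
        exact (hKA hx).1.1
      have hKΩ : K ⊆ Ω ×ˢ Iio T := by
        rintro _ ⟨x, hx, rfl⟩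
        exact ⟨(hKA hx).1.2, hT⟩
      have hKQ : K ⊆ (cylinder Ω T)ᶜ := by
        rintro _ ⟨x, hx, rfl⟩ hz
        exact lt_irrefl _ hz.2.1
      have h1 := h K hK hKΩ (capCompact_eq_zero_of_subset hK hKE hcap)
      have h2 : {x : Space N | ((x, 0) : SpaceTime N) ∈ K} = K' := by
        ext x
        simp [hKdef]
      rw [jointData_apply _ _ hK.measurableSet, jointData_apply _ _ hK.measurableSet, h2,
        measure_mono_null hKQ hμ₁, measure_mono_null hKQ hμ₂, zero_add, zero_add,
        measure_mono_null (fun z hz => (hKA hz).2) hs2] at h1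
      exact h1
    refine measure_mono_null (t := ({x | (x, 0) ∈ E} ∩ Ω) ∩ sᶜ ∪ Ωᶜ ∪ s) ?_
      (measure_union_null (measure_union_null h0 hσ₁) hs1)
    intro z hz
    simp only [mem_union, mem_inter_iff, mem_compl_iff]
    tauto

/-- A set separating σ⁺ from σ⁻ pulls back along `Prod.fst` to one separating their images, so the
images form the Jordan decomposition of the image measure, by uniqueness. -/
lemma totalVariation_tensorDirac (σ : SignedMeasure (Space N)) {E : Set (SpaceTime N)}
    (hE : MeasurableSet E) :
    (tensorDirac σ 0).totalVariation E = σ.totalVariation {x | (x, 0) ∈ E} := by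
  set j := σ.toJordanDecomposition with hj
  have hsing : (j.posPart.map fun x => ((x, 0) : SpaceTime N)) ⟂ₘ
      (j.negPart.map fun x => ((x, 0) : SpaceTime N)) := by
    obtain ⟨s, hs, h1, h2⟩ := j.mutuallySingular
    refine ⟨Prod.fst ⁻¹' s, measurable_fst hs, ?_, ?_⟩
    · rw [Measure.map_apply measurable_atZero (measurable_fst hs)]
      exact h1
    · rw [Measure.map_apply measurable_atZero (measurable_fst hs).compl]
      exact h2
  have h : tensorDirac σ 0 = JordanDecomposition.toSignedMeasure
      ⟨j.posPart.map fun x => (x, 0), j.negPart.map fun x => (x, 0), hsing⟩ := by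
    ext A hA
    rw [tensorDirac, VectorMeasure.map_apply _ measurable_atZero hA,
      SignedMeasure.apply_eq_posPart_real_sub_negPart_real _ (measurable_atZero hA),
      JordanDecomposition.toSignedMeasure, _root_.sub_apply,
      Measure.toSignedMeasure_apply_measurable hA, Measure.toSignedMeasure_apply_measurable hA,
      map_measureReal_apply measurable_atZero hA, map_measureReal_apply measurable_atZero hA]
  rw [SignedMeasure.totalVariation, SignedMeasure.toJordanDecomposition_eq h,
    SignedMeasure.totalVariation, Measure.add_apply, Measure.add_apply,
    Measure.map_apply measurable_atZero hE, Measure.map_apply measurable_atZero hE]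
  rfl

end AbsoluteContinuity

end PorousMedium

end

theorem mainTheorem3 (N : ℕ) (hN : 2 ≤ N) (Ω : Set (PorousMedium.Space N))
    (hΩ_open : IsOpen Ω) (hΩ_conn : IsConnected Ω) (hΩ_bdd : Bornology.IsBounded Ω)
    (T m q : ℝ) (hT : 0 < T) (hm : ((N : ℝ) - 2) / (N : ℝ) < m) (hq : max 1 m < q)
    (μ : MeasureTheory.SignedMeasure (PorousMedium.SpaceTime N))
    (hμ : PorousMedium.ConcentratedOn μ (PorousMedium.cylinder Ω T))
    (σ : MeasureTheory.SignedMeasure (PorousMedium.Space N))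
    (hσ : PorousMedium.ConcentratedOn σ Ω)
    (hsol : ∃ u : PorousMedium.SpaceTime N → ℝ,
      PorousMedium.IsVeryWeakSolution Ω T m (PorousMedium.signedPow q) μ σ u) :
    PorousMedium.AbsContinuous μ (PorousMedium.cap (q / (q - m)) (q / (q - 1))) ∧
      PorousMedium.AbsContinuous (PorousMedium.tensorDirac σ 0)
        (PorousMedium.cap (q / (q - m)) (q / (q - 1))) := by
  obtain ⟨u, hu⟩ := hsol
  have hq1 : 1 < q := (le_max_left _ _).trans_lt hq
  have hqm : m < q := (le_max_right _ _).trans_lt hq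
  -- For N ≥ 2 the lower bound (N-2)/N is nonnegative; positivity of m is what the pairing of |u|^m
  -- in L^{q/m} requires.
  have hm0 : 0 < m := by
    have hN' : (2 : ℝ) ≤ N := by exact_mod_cast hN
    exact (div_nonneg (by linarith) (by linarith)).trans_lt hm
  have hK := fun K (hK : IsCompact K) hKΩ hcap =>
    PorousMedium.jointData_eq_of_capCompact_eq_zero hΩ_open hΩ_bdd hm0 hq1 hqm hμ hσ hu hK hKΩ hcap
  obtain ⟨hμ₁, hμ₂⟩ := PorousMedium.posPart_eq_zero_of_totalVariation hμ
  obtain ⟨hσ₁, hσ₂⟩ := PorousMedium.posPart_eq_zero_of_totalVariation hσ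
  have key : ∀ E, MeasurableSet E → PorousMedium.cap (q / (q - m)) (q / (q - 1)) E = 0 →
      μ.totalVariation E = 0 ∧ σ.totalVariation {x | (x, 0) ∈ E} = 0 := by
    intro E hE hcap
    have hp := PorousMedium.eq_zero_of_jointData_eq hΩ_open hT
      μ.toJordanDecomposition.mutuallySingular σ.toJordanDecomposition.mutuallySingular
      hμ₁ hμ₂ hσ₁ hK hE hcap
    -- The same argument with the roles of positive and negative parts exchanged.
    have hn := PorousMedium.eq_zero_of_jointData_eq hΩ_open hT
      μ.toJordanDecomposition.mutuallySingular.symm σ.toJordanDecomposition.mutuallySingular.symm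
      hμ₂ hμ₁ hσ₂ (fun K h1 h2 h3 => (hK K h1 h2 h3).symm) hE hcap
    constructor
    · rw [MeasureTheory.SignedMeasure.totalVariation, MeasureTheory.Measure.add_apply, hp.1, hn.1,
        add_zero]
    · rw [MeasureTheory.SignedMeasure.totalVariation, MeasureTheory.Measure.add_apply, hp.2, hn.2,
        add_zero]
  refine ⟨fun E hE hcap => (key E hE hcap).1, fun E hE hcap => ?_⟩
  rw [PorousMedium.totalVariation_tensorDirac σ hE]
  exact (key E hE hcap).2
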